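/- Let $b\ge 1$ be an integer and let $V$ be the vertex set of the infinite $b$-regular tree with root $\varrho$ (every vertex $\nu$ has $b$ offspring $\nu1,\dots,\nu b$), augmented by a parent $\overleftarrow{\varrho}$ adjoined to the root. Write $\overleftarrow{\nu}$ for the parent of $\nu$, let $|\nu|$ be the distance of $\nu$ from $\varrho$, and set $|\overleftarrow{\varrho}|=-1$. To the tree vertices $\nu\neq\overleftarrow{\varrho}$ attach i.i.d. random vectors $\mathbf A_\nu=(A_{\nu1},\dots,A_{\nu b})$ with entries in $(0,\infty)$ (the entries of one vector may be dependent), and put $$\omega(\nu,\nu i)=\frac{A_{\nu i}}{1+\sum_{j=1}^b A_{\nu j}},\qquad \omega(\nu,\overleftarrow{\nu})=\frac{1}{1+\sum_{j=1}^b A_{\nu j}},\qquad \omega(\overleftarrow{\varrho},\varrho)=1 .$$ Given the environment $\omega$, let $\mathbf X=(X_n)_{n\ge0}$ be the Markov chain on $V$ with $X_0=\varrho$ and transition probabilities $\omega$, and let $\mathbf P$ (with expectation $\mathbf E$) be the annealed measure, i.e. the semi-direct product of the law of the environment (with expectation $\mathbb E$) and the law of the chain given the environment. Set $\tau_0=0$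 and, for $m\ge1$, $$\tau_m=\inf\Big\{k>\tau_{m-1}:\ \sup_{j<k}|X_j|<|X_k|\le\inf_{j\ge k}|X_j|\Big\}\qquad(\inf\emptyset=\infty).$$ Assume that $$\inf_{t\in[0,1]}\mathbb E[A^t]>\frac1b,\qquad\text{and}\qquad \mathbb E\Big[\Big(\sum_{i=1}^bA_{\varrho i}\Big)^{-p}\Big]<\infty\ \text{ for some } p>2,$$ where $A$ is a generic entry of the weight vector, $\mathbb E[A^t]:=\frac1b\sum_{i=1}^b\mathbb E[A_{\varrho i}^t]\in[0,\infty]$ (which is $\mathbb E[A_{\varrho 1}^t]$ when the entries are identically distributed). Then $\mathbf E[\tau_1^2]<\infty$ and $\mathbf E[(\tau_2-\tau_1)^2]<\infty$. -/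

import Mathlib

open MeasureTheory ProbabilityTheory
open scoped ENNReal

namespace TreeRWRE

/-! ### The augmented `b`-regular tree -/

/-- Vertices of the infinite `b`-regular tree augmented by a parent of the root.
`node w` is the tree vertex with address `w`; the root is `node []`, and the `b` offspring of
`node w` are the vertices `node (i :: w)`, `i : Fin b`. -/
inductive Vertex (b : ℕ) : Type
  | rootParent : Vertex b
  | node : List (Fin b) → Vertex b

namespace Vertex

variable {b : ℕ}

/-- The root of the tree. -/
def root : Vertex b := node []

/-- The parent of `node w`; the parent of the root is the adjoined vertex. -/
def parentOfNode : List (Fin b) → Vertex b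
  | [] => rootParent
  | _ :: w => node w

/-- The level `|ν|`: the distance to the root, and `-1` for the adjoined parent of the root. -/
def level : Vertex b → ℤ
  | rootParent => -1
  | node w => w.length

instance : Countable (Vertex b) :=
  Function.Injective.countable
    (f := fun v : Vertex b => match v with
      | rootParent => (none : Option (List (Fin b)))
      | node w => some w)
    (by rintro (_ | _) (_ | _) h <;> simp_all)

instance : MeasurableSpace (Vertex b) := ⊤

instance : DiscreteMeasurableSpace (Vertex b) := ⟨fun _ => trivial⟩

end Vertex

/-! ### Environments -/

/-- A vector `(A_{ν1}, …, A_{νb})` of (finite, positive) weights. -/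
abbrev Weights (b : ℕ) : Type := Fin b → Set.Ioi (0 : ℝ)

/-- An environment: a vector of weights `A_ν` at every tree vertex `ν = node w`. -/
abbrev Env (b : ℕ) : Type := List (Fin b) → Weights b

/-- `∑_{1 ≤ i ≤ b} A_{νi}`. -/
noncomputable def totalWeight {b : ℕ} (a : Weights b) : ℝ := ∑ i, (a i : ℝ)

lemma totalWeight_nonneg {b : ℕ} (a : Weights b) : 0 ≤ totalWeight a :=
  Finset.sum_nonneg fun i _ => (a i).2.le

/-- The law of the environment when the vectors `A_ν` are i.i.d. with law `μ`. -/
noncomputable def envLaw {b : ℕ} (μ : Measure (Weights b)) : Measure (Env b) :=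
  Measure.infinitePi fun _ : List (Fin b) => μ

/-! ### The quenched walk -/

/-- The law of one step of the walk from a vertex in the environment `ω`: from `node w` the walk
jumps to the `i`-th offspring with probability `A_{wi} / (1 + ∑ⱼ A_{wj})` and to the parent with
probability `1 / (1 + ∑ⱼ A_{wj})`; from the parent of the root it jumps to the root. -/
noncomputable def stepLaw {b : ℕ} (ω : Env b) : Vertex b → Measure (Vertex b)
  | .rootParent => Measure.dirac Vertex.root
  | .node w =>
      ENNReal.ofReal (1 / (1 + totalWeight (ω w))) • Measure.dirac (Vertex.parentOfNode w) +
      ∑ i, ENNReal.ofReal ((ω w i : ℝ) / (1 + totalWeight (ω w))) •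
        Measure.dirac (Vertex.node (i :: w))

instance {b : ℕ} (ω : Env b) (v : Vertex b) : IsProbabilityMeasure (stepLaw ω v) := by
  cases v with
  | rootParent => unfold stepLaw; infer_instance
  | node w =>
    constructor
    have h := totalWeight_nonneg (ω w)
    simp only [stepLaw, Measure.add_apply, Measure.smul_apply, Measure.finsetSum_apply,
      measure_univ, smul_eq_mul, mul_one]
    rw [← ENNReal.ofReal_sum_of_nonneg, ← ENNReal.ofReal_add, ← Finset.sum_div, ← add_div]
    · have : (1 + ∑ i, (ω w i : ℝ)) / (1 + totalWeight (ω w)) = 1 :=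
        div_self (by positivity)
      rw [this, ENNReal.ofReal_one]
    · positivity
    · exact Finset.sum_nonneg fun i _ => div_nonneg (ω w i).2.le (by positivity)
    · exact fun i _ => div_nonneg (ω w i).2.le (by positivity)

/-- The transition kernel of the walk in the environment `ω`. -/
noncomputable def stepKernel {b : ℕ} (ω : Env b) : Kernel (Vertex b) (Vertex b) where
  toFun := stepLaw ω
  measurable' := measurable_of_countable _

instance {b : ℕ} (ω : Env b) : IsMarkovKernel (stepKernel ω) :=
  ⟨fun v => inferInstanceAs (IsProbabilityMeasure (stepLaw ω v))⟩

/-- The law of the next position given the positions up to time `n`: it depends only on the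
position at time `n`. -/
noncomputable def historyKernel {b : ℕ} (ω : Env b) (n : ℕ) :
    Kernel (Finset.Iic n → Vertex b) (Vertex b) :=
  (stepKernel ω).comap (fun h => h ⟨n, Finset.mem_Iic.2 le_rfl⟩) (measurable_pi_apply _)

instance {b : ℕ} (ω : Env b) (n : ℕ) : IsMarkovKernel (historyKernel ω n) := by
  unfold historyKernel; infer_instance

/-- The quenched law `𝐏_ω^x`: the law of the Markov chain `(X_n)_{n ≥ 0}` that starts at `x` and
has the transition probabilities given by `ω`. -/
noncomputable def quenchedLaw {b : ℕ} (x : Vertex b) (ω : Env b) : Measure (ℕ → Vertex b) :=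
  Kernel.trajMeasure (X := fun _ => Vertex b) (Measure.dirac x) (historyKernel ω)

instance {b : ℕ} (x : Vertex b) (ω : Env b) : IsProbabilityMeasure (quenchedLaw x ω) := by
  unfold quenchedLaw; infer_instance

lemma quenchedLaw_start {b : ℕ} (x : Vertex b) (ω : Env b) :
    (quenchedLaw x ω).map (fun X => X 0) = Measure.dirac x := by
  have h0 : (fun X : ℕ → Vertex b => X 0) =
      (fun h : Finset.Iic 0 → Vertex b => h ⟨0, Finset.mem_Iic.2 le_rfl⟩) ∘
        Preorder.frestrictLe 0 := rfl
  rw [h0, ← Measure.map_map (measurable_pi_apply _) (by fun_prop), quenchedLaw,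
    Kernel.trajMeasure, Measure.map_comp _ _ (by fun_prop), Kernel.traj_map_frestrictLe,
    Kernel.partialTraj_self, Measure.id_comp, Measure.map_map (measurable_pi_apply _) (by fun_prop)]
  exact Measure.map_id

lemma measurableSet_path {b : ℕ} (y : ℕ → Vertex b) (n : ℕ) :
    MeasurableSet {X : ℕ → Vertex b | ∀ i ≤ n, X i = y i} := by
  have : {X : ℕ → Vertex b | ∀ i ≤ n, X i = y i} = ⋂ i, ⋂ (_ : i ≤ n), {X | X i = y i} := by
    ext; simp
  rw [this]
  exact .iInter fun i => .iInter fun _ => measurable_pi_apply i (.singleton _)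

/-- The probability that the quenched walk follows a given path. -/
lemma quenchedLaw_cylinder {b : ℕ} (x : Vertex b) (ω : Env b) (y : ℕ → Vertex b) (n : ℕ) :
    quenchedLaw x ω {X | ∀ i ≤ n, X i = y i} =
      Measure.dirac x {y 0} * ∏ i ∈ Finset.range n, stepLaw ω (y i) {y (i + 1)} := by
  induction n with
  | zero =>
    rw [← quenchedLaw_start x ω, Measure.map_apply (measurable_pi_apply _) (.singleton _)]
    simp; rfl
  | succ n ih =>
    rw [Finset.prod_range_succ, ← mul_assoc, ← ih]
    have h := Kernel.map_frestrictLe_trajMeasure_compProd_eq_map_trajMeasure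
      (X := fun _ => Vertex b) (μ₀ := Measure.dirac x) (κ := historyKernel ω) (a := n)
    have h2 := congrArg (fun m => m
      (({fun i : Finset.Iic n => y i} : Set (Finset.Iic n → Vertex b)) ×ˢ {y (n + 1)})) h
    rw [Measure.compProd_apply_prod (.singleton _) (.singleton _), lintegral_singleton,
      Measure.map_apply (by fun_prop) (.singleton _),
      Measure.map_apply (by fun_prop) ((MeasurableSet.singleton _).prod (.singleton _))] at h2
    change _ * quenchedLaw x ω _ = quenchedLaw x ω _ at h2
    have e1 : ((Preorder.frestrictLe n : (ℕ → Vertex b) → Finset.Iic n → Vertex b) ⁻¹'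
        {fun i : Finset.Iic n => y i}) =
        {X | ∀ i ≤ n, X i = y i} := by
      ext X
      simp [funext_iff]
    have e2 : ((fun X : ℕ → Vertex b => (Preorder.frestrictLe n X, X (n + 1))) ⁻¹'
        (({fun i : Finset.Iic n => y i} : Set (Finset.Iic n → Vertex b)) ×ˢ {y (n + 1)})) =
        {X | ∀ i ≤ n + 1, X i = y i} := by
      ext X
      simp [funext_iff, Nat.le_succ_iff, or_imp, forall_and]
    erw [e1, e2] at h2
    rw [← h2, mul_comm]
    rfl

lemma measurable_stepLaw_singleton {b : ℕ} (v w : Vertex b) :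
    Measurable fun ω : Env b => stepLaw ω v {w} := by
  cases v with
  | rootParent => exact measurable_const
  | node u =>
    have h1 : Measurable fun ω : Env b => totalWeight (ω u) := by
      unfold totalWeight; fun_prop
    simp only [stepLaw, Measure.add_apply, Measure.smul_apply, Measure.finsetSum_apply,
      smul_eq_mul]
    fun_prop

lemma measurable_quenchedLaw {b : ℕ} (x : Vertex b) :
    Measurable (quenchedLaw x : Env b → Measure (ℕ → Vertex b)) := by
  refine .measure_of_isPiSystem_of_isProbabilityMeasure
    generateFrom_measurableCylinders.symm isPiSystem_measurableCylinders fun s hs => ?_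
  obtain ⟨N, S, mS, rfl⟩ : ∃ N S, MeasurableSet S ∧ s = cylinder (Finset.Iic N) S := by
    simpa [measurableCylinders_nat] using hs
  have key : ∀ ω : Env b, quenchedLaw x ω (cylinder (Finset.Iic N) S) =
      ∑' h : S, quenchedLaw x ω {X | ∀ i ≤ N, X i =
        if hi : i ≤ N then h.1 ⟨i, Finset.mem_Iic.2 hi⟩ else Vertex.root} := by
    intro ω
    rw [← measure_iUnion]
    · congr 1
      ext X
      simp only [mem_cylinder, Set.mem_iUnion, Set.mem_ofPred_eq]
      constructor
      · intro h
        exact ⟨⟨_, h⟩, fun i hi => by simp [hi]⟩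
      · rintro ⟨⟨h, hS⟩, hh⟩
        convert! hS
        ext ⟨i, hi⟩
        have := hh i (Finset.mem_Iic.1 hi)
        simpa [Finset.mem_Iic.1 hi] using this
    · rintro ⟨h, hS⟩ ⟨h', hS'⟩ hne
      refine Set.disjoint_left.2 fun X hX hX' => hne (Subtype.ext (funext fun i => ?_))
      have hi := Finset.mem_Iic.1 i.2
      have e1 := hX i hi
      have e2 := hX' i hi
      simp only [hi, dite_true] at e1 e2
      exact e1.symm.trans e2
    · intro h
      exact measurableSet_path _ _
  simp_rw [key, quenchedLaw_cylinder]
  refine .tsum fun h => .const_mul (Finset.measurable_prod _ fun i _ => ?_) _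
  exact measurable_stepLaw_singleton _ _

/-- The quenched laws as a Markov kernel from environments to trajectories. -/
noncomputable def quenchedKernel {b : ℕ} (x : Vertex b) : Kernel (Env b) (ℕ → Vertex b) where
  toFun := quenchedLaw x
  measurable' := measurable_quenchedLaw x

instance {b : ℕ} (x : Vertex b) : IsMarkovKernel (quenchedKernel x) :=
  ⟨fun ω => inferInstanceAs (IsProbabilityMeasure (quenchedLaw x ω))⟩

/-- The annealed measure `𝐏^x`: the semi-direct product of the law of the environment and the
quenched law of the walk started at `x`, a measure on pairs (environment, trajectory). -/
noncomputable def annealed {b : ℕ} (μ : Measure (Weights b)) (x : Vertex b) :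
    Measure (Env b × (ℕ → Vertex b)) :=
  envLaw μ ⊗ₘ quenchedKernel x

instance {b : ℕ} (μ : Measure (Weights b)) [IsProbabilityMeasure μ] :
    IsProbabilityMeasure (envLaw μ) := by
  unfold envLaw; infer_instance

instance {b : ℕ} (μ : Measure (Weights b)) [IsProbabilityMeasure μ] (x : Vertex b) :
    IsProbabilityMeasure (annealed μ x) := by
  unfold annealed; infer_instance

/-! ### Regeneration times -/

/-- `sup_{j < k} |X_j| < |X_k| ≤ inf_{j ≥ k} |X_j|`. -/
def IsCutTime {b : ℕ} (X : ℕ → Vertex b) (k : ℕ) : Prop :=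
  (∀ j < k, (X j).level < (X k).level) ∧ ∀ j ≥ k, (X k).level ≤ (X j).level

/-- The regenerative times: `τ_0 = 0` and `τ_m` is the first cut time after `τ_{m-1}`
(`⊤` if there is none). -/
noncomputable def regenTime {b : ℕ} (X : ℕ → Vertex b) : ℕ → ℕ∞
  | 0 => 0
  | m + 1 => ⨅ (k : ℕ) (_ : regenTime X m < k ∧ IsCutTime X k), (k : ℕ∞)

lemma measurableSet_isCutTime {b : ℕ} (k : ℕ) :
    MeasurableSet {X : ℕ → Vertex b | IsCutTime X k} := by
  have hm : ∀ i, Measurable fun X : ℕ → Vertex b => (X i).level := fun i =>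
    (measurable_of_countable Vertex.level).comp (measurable_pi_apply i)
  have he : {X : ℕ → Vertex b | IsCutTime X k} =
      (⋂ j, ⋂ (_ : j < k), {X | (X j).level < (X k).level}) ∩
        ⋂ j, ⋂ (_ : j ≥ k), {X | (X k).level ≤ (X j).level} := by
    ext; simp [IsCutTime]
  rw [he]
  refine MeasurableSet.inter ?_ ?_
  · exact .iInter fun j => .iInter fun _ => measurableSet_lt (hm j) (hm k)
  · exact .iInter fun j => .iInter fun _ => measurableSet_le (hm k) (hm j)

lemma measurable_regenTime {b : ℕ} (m : ℕ) :
    Measurable fun X : ℕ → Vertex b => regenTime X m := by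
  have : BorelSpace ℕ∞ := ⟨borel_eq_top_of_countable.symm⟩
  induction m with
  | zero => exact measurable_const
  | succ m ih =>
    simp only [regenTime]
    refine .iInf fun k => ?_
    have hs : MeasurableSet {X : ℕ → Vertex b | regenTime X m < k ∧ IsCutTime X k} :=
      (measurableSet_lt ih measurable_const).inter (measurableSet_isCutTime k)
    classical
    have he : (fun X : ℕ → Vertex b => ⨅ (_ : regenTime X m < k ∧ IsCutTime X k), (k : ℕ∞)) =
        fun X => if regenTime X m < k ∧ IsCutTime X k then (k : ℕ∞) else ⊤ := by
      ext X
      split_ifs with h <;> simp [h]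
    rw [he]
    exact Measurable.ite hs measurable_const measurable_const

/-! ### The hypotheses on the weights -/

/-- `𝔼[A^t]` for a generic entry `A` of the weight vector, i.e. a uniformly chosen coordinate:
`(1/b) ∑_i 𝔼[A_{ϱi}^t]`. When the coordinates have the same law, this is `𝔼[A_{ϱi}^t]`
for each `i`. The value may be `∞`. -/
noncomputable def entryMoment {b : ℕ} (μ : Measure (Weights b)) (t : ℝ) : ℝ≥0∞ :=
  (b : ℝ≥0∞)⁻¹ * ∑ i, ∫⁻ a, ENNReal.ofReal ((a i : ℝ) ^ t) ∂μ

end TreeRWRE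

/-!
The proof controls the walk by its quenched escape probabilities and by the visits to each level.

*Escape.* Let `β = escLim` be the quenched probability that the walk from the root never visits the
parent of the root. It satisfies `β = x / (1 + x)` with `x = ∑ᵢ Aᵢ βᵢ`, where `βᵢ` belongs to the
environment seen from the `i`-th offspring. The moment condition on `A` makes `β` positive: the
exponent `t ∈ [0, 1]` with the least moment tilts the (truncated) law of `log A` such that the
branching random walk of the log-weights keeps more than one expected descendant along which the
products of the weights are not too small. If `β` vanished, the truncated expectations `eₖ` of the
level-`k` escape probabilities would tend to `0` and at the same time satisfy
`e (n + k) ≥ θ e k - B (e k)²` with `θ > 1` (`exists_successProb_ge`, `not_ae_escLim_eq_zero`).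
The recursion for `β` and a zero-one law give `ae_escLim_pos`.

*Inverse moments.* A large value of `1 / β` requires a child of large weight with a large `1 / βᵢ`,
and in addition an independent sibling with a small weight or a large `1 / βⱼ`, which is unlikely.
Absorbing the resulting contraction bounds the `q`-th moment of `1 / β` by that of the inverse total
weight (`lintegral_invEsc_rpow_lt_top`). The same recursion shows that the probability of returning
to a vertex from `m` levels below it decays exponentially in `m`
(`exists_lintegral_retSum_le`).

*Fresh vertices.* When the walk stops at a vertex whose subtree it has not seen before, the
environment in this subtree is independent of the past, so that annealed expectations factorize
(`IsFresh.lintegral_le`). In particular, leaving the subtree again costs a factor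
`ρ = 1 - 𝔼[β] < 1`. The walk discovers a `j`-th new vertex of level `k` with probability at most
`ρ ^ j`, and the number of visits to each of them has a `q`-th moment, `q ∈ (2, 3]`; by Minkowski's
inequality the number of visits to level `k` has a `q`-th moment that is bounded in `k`
(`exists_lintegral_levelVisits_le`). Likewise, `J` consecutive blocks of `m` levels contain no cut
time with probability at most `ρ ^ J + J θ ^ m`, `θ < 1` (`pathLaw_noCut_le`), because without a
cut time the walk has to go back from the first vertex of each block, either before it crosses the
block or from depth `m`.

*Conclusion.* At a time before `τ₂`, at most one positive cut time has a level not above the level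
`k` of the walk, an event of probability exponentially small in `√k`. So `τ₂` is bounded by a sum
over `k` of the visits to level `k` on this event, and Hölder's and Minkowski's inequalities bound
its second moment (`lintegral_regenTime_two_sq_lt_top`). Both `τ₁` and `τ₂ - τ₁` are at most `τ₂`.
-/


namespace TreeRWRE

/-! ### Independence in the environment -/

/-- The environment seen from the vertex with address `w`: the weights on the subtree of `w`,
with addresses read relative to `w`. -/
def shiftEnv {b : ℕ} (w : List (Fin b)) (ω : Env b) : Env b := fun u => ω (u ++ w)

lemma shiftEnv_shiftEnv {b : ℕ} (u w : List (Fin b)) (ω : Env b) :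
    shiftEnv u (shiftEnv w ω) = shiftEnv (u ++ w) ω := by
  ext v : 1; simp [shiftEnv]

@[fun_prop]
lemma measurable_shiftEnv {b : ℕ} (w : List (Fin b)) :
    Measurable (shiftEnv w : Env b → Env b) :=
  measurable_pi_lambda _ fun _ => measurable_pi_apply _

/-- Replace the weights of `ω₁` on the subtree of `w` (the addresses with suffix `w`) by `ω₂`. -/
def glueEnv {b : ℕ} (w : List (Fin b)) (ω₁ ω₂ : Env b) : Env b :=
  fun v => if w <:+ v then ω₂ (v.take (v.length - w.length)) else ω₁ v

lemma shiftEnv_glueEnv {b : ℕ} (w : List (Fin b)) (ω₁ ω₂ : Env b) :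
    shiftEnv w (glueEnv w ω₁ ω₂) = ω₂ := by
  ext u : 1; simp [shiftEnv, glueEnv]

lemma glueEnv_of_not_suffix {b : ℕ} {w v : List (Fin b)} (h : ¬ w <:+ v) (ω₁ ω₂ : Env b) :
    glueEnv w ω₁ ω₂ v = ω₁ v := by
  simp [glueEnv, h]

lemma measurable_glueEnv {b : ℕ} (w : List (Fin b)) :
    Measurable fun p : Env b × Env b => glueEnv w p.1 p.2 := by
  refine measurable_pi_lambda _ fun v => ?_
  unfold glueEnv
  split_ifs
  · exact (measurable_pi_apply _).comp measurable_snd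
  · exact (measurable_pi_apply _).comp measurable_fst

/-- The subtree of `w` carries an independent copy of the environment. -/
lemma map_glueEnv_envLaw {b : ℕ} (μ : Measure (Weights b)) [IsProbabilityMeasure μ]
    (w : List (Fin b)) :
    ((envLaw μ).prod (envLaw μ)).map (fun p => glueEnv w p.1 p.2) = envLaw μ := by
  classical
  refine Measure.eq_infinitePi _ fun s t ht => ?_
  rw [Measure.map_apply (measurable_glueEnv w)
    (.pi s.countable_toSet fun i _ => ht i)]
  set f : List (Fin b) → List (Fin b) := fun v => v.take (v.length - w.length) with hf
  have hfu : ∀ u : List (Fin b), f (u ++ w) = u := by intro u; simp [hf]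
  have hset : (fun p : Env b × Env b => glueEnv w p.1 p.2) ⁻¹' (Set.pi (s : Set _) t) =
      (Set.pi ((s.filter fun v => ¬ w <:+ v : Finset _) : Set (List (Fin b))) t) ×ˢ
        (Set.pi (((s.filter fun v => w <:+ v).image f : Finset _) : Set (List (Fin b)))
          fun u => t (u ++ w)) := by
    ext p
    simp only [Set.mem_preimage, Set.mem_pi, Set.mem_prod, Finset.coe_filter, Finset.coe_image,
      Set.mem_image, SetLike.mem_coe, Set.mem_ofPred_eq]
    constructor
    · intro h
      refine ⟨fun v hv => ?_, ?_⟩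
      · have := h v hv.1
        rwa [glueEnv_of_not_suffix hv.2] at this
      · rintro _ ⟨v, ⟨hv, ⟨u, rfl⟩⟩, rfl⟩
        have := h _ hv
        rw [hfu]
        simpa [glueEnv] using this
    · rintro ⟨h1, h2⟩ v hv
      by_cases hw : w <:+ v
      · obtain ⟨u, rfl⟩ := hw
        have := h2 (f (u ++ w)) ⟨u ++ w, ⟨hv, ⟨u, rfl⟩⟩, rfl⟩
        rw [hfu] at this
        simpa [glueEnv] using this
      · rw [glueEnv_of_not_suffix hw]
        exact h1 v ⟨hv, hw⟩
  rw [hset, Measure.prod_prod, envLaw, Measure.infinitePi_pi _ (fun i _ => ht i),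
    Measure.infinitePi_pi _ (fun i _ => ht _), Finset.prod_image, mul_comm,
    ← Finset.prod_filter_mul_prod_filter_not s (fun v => w <:+ v)]
  · congr 1
    refine Finset.prod_congr rfl fun v hv => ?_
    obtain ⟨u, rfl⟩ := (Finset.mem_filter.1 hv).2
    rw [hfu]
  · intro v hv v' hv' h
    obtain ⟨u, rfl⟩ := (Finset.mem_filter.1 hv).2
    obtain ⟨u', rfl⟩ := (Finset.mem_filter.1 hv').2
    simp only [hfu] at h
    rw [h]

/-- `ω` and `ω'` have the same weights outside the subtree of `w`. -/
def AgreeOff {b : ℕ} (w : List (Fin b)) (ω ω' : Env b) : Prop :=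
  ∀ v, ¬ w <:+ v → ω v = ω' v

lemma agreeOff_glueEnv {b : ℕ} (w : List (Fin b)) (ω₁ ω₂ : Env b) :
    AgreeOff w (glueEnv w ω₁ ω₂) ω₁ := fun _ hv => glueEnv_of_not_suffix hv _ _

/-- Independence of the environments inside and outside the subtree of `w`. -/
lemma lintegral_envLaw_shiftEnv {b : ℕ} (μ : Measure (Weights b)) [IsProbabilityMeasure μ]
    (w : List (Fin b)) {Φ : Env b → Env b → ℝ≥0∞} (hΦ : Measurable (Function.uncurry Φ))
    (hoff : ∀ ω ω' η, AgreeOff w ω ω' → Φ ω η = Φ ω' η) :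
    ∫⁻ ω, Φ ω (shiftEnv w ω) ∂(envLaw μ) = ∫⁻ ω, ∫⁻ η, Φ ω η ∂(envLaw μ) ∂(envLaw μ) := by
  have hm : Measurable fun ω => Φ ω (shiftEnv w ω) :=
    hΦ.comp (measurable_id.prodMk (measurable_shiftEnv w))
  conv_lhs => rw [← map_glueEnv_envLaw μ w]
  rw [lintegral_map hm (measurable_glueEnv w), lintegral_prod]
  · refine lintegral_congr fun ω => lintegral_congr fun η => ?_
    rw [shiftEnv_glueEnv]
    exact hoff _ _ _ (agreeOff_glueEnv w ω η)
  · exact (hm.comp (measurable_glueEnv w)).aemeasurable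

lemma lintegral_envLaw_mul_shiftEnv {b : ℕ} (μ : Measure (Weights b)) [IsProbabilityMeasure μ]
    (w : List (Fin b)) {F g : Env b → ℝ≥0∞} (hF : Measurable F) (hg : Measurable g)
    (hoff : ∀ ω ω', AgreeOff w ω ω' → F ω = F ω') :
    ∫⁻ ω, F ω * g (shiftEnv w ω) ∂(envLaw μ) =
      (∫⁻ ω, F ω ∂(envLaw μ)) * ∫⁻ ω, g ω ∂(envLaw μ) := by
  rw [lintegral_envLaw_shiftEnv μ w (Φ := fun ω η => F ω * g η) (by fun_prop)
    (fun ω ω' η h => by simp only [hoff ω ω' h]), ← lintegral_mul_const _ hF]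
  exact lintegral_congr fun ω => lintegral_const_mul _ hg

lemma lintegral_envLaw_root {b : ℕ} (μ : Measure (Weights b)) [IsProbabilityMeasure μ]
    {k : Weights b → ℝ≥0∞} (hk : Measurable k) :
    ∫⁻ ω, k (ω []) ∂(envLaw μ) = ∫⁻ a, k a ∂μ := by
  rw [envLaw]
  conv_rhs => rw [← Measure.infinitePi_map_eval (fun _ : List (Fin b) => μ) []]
  rw [lintegral_map hk (by fun_prop)]

lemma suffix_singleton_of_append {b : ℕ} {i j : Fin b} {u : List (Fin b)}
    (h : [i] <:+ u ++ [j]) : i = j := by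
  obtain ⟨t, ht⟩ := h
  exact (List.append_inj' ht rfl).2 |> fun h => by simpa using h

/-- The branching property: the weights at the root and the environments on the subtrees of its
offspring are independent, and the latter have the law of the whole environment. -/
lemma lintegral_envLaw_prod {b : ℕ} (μ : Measure (Weights b)) [IsProbabilityMeasure μ]
    {h : Fin b → Weights b → Env b → ℝ≥0∞} (hh : ∀ i, Measurable (Function.uncurry (h i)))
    (s : Finset (Fin b)) {k : Weights b → ℝ≥0∞} (hk : Measurable k) :
    ∫⁻ ω, k (ω []) * ∏ i ∈ s, h i (ω []) (shiftEnv [i] ω) ∂(envLaw μ) =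
      ∫⁻ a, k a * ∏ i ∈ s, ∫⁻ ω, h i a ω ∂(envLaw μ) ∂μ := by
  classical
  induction s using Finset.induction_on generalizing k with
  | empty => simpa using lintegral_envLaw_root μ hk
  | insert i s hi ih =>
    have hroot : Measurable fun ω : Env b => ω [] := measurable_pi_apply _
    have hmi : ∀ j, Measurable fun ω : Env b => h j (ω []) (shiftEnv [j] ω) := fun j =>
      (hh j).comp (hroot.prodMk (measurable_shiftEnv [j]))
    have hI : Measurable fun a => ∫⁻ ω, h i a ω ∂(envLaw μ) := (hh i).lintegral_prod_right'
    have hm1 : Measurable fun p : Env b × Env b => h i (p.1 []) p.2 :=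
      (hh i).comp ((hroot.comp measurable_fst).prodMk measurable_snd)
    have hm2 : Measurable fun ω : Env b =>
        k (ω []) * ∏ j ∈ s, h j (ω []) (shiftEnv [j] ω) :=
      (hk.comp hroot).mul (Finset.measurable_prod _ fun j _ => hmi j)
    have e1 := lintegral_envLaw_shiftEnv μ [i]
      (Φ := fun ω η => (k (ω []) * ∏ j ∈ s, h j (ω []) (shiftEnv [j] ω)) * h i (ω []) η)
      ((hm2.comp measurable_fst).mul hm1) (fun ω ω' η hag => by
        have h0 : ω [] = ω' [] := hag [] (by simp)
        have hs : ∀ j ∈ s, shiftEnv [j] ω = shiftEnv [j] ω' := fun j hj => by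
          ext u : 1
          refine hag _ fun hsuf => hi ?_
          rwa [suffix_singleton_of_append hsuf]
        simp only [h0]
        rw [Finset.prod_congr rfl fun j hj => by rw [hs j hj]])
    calc _ = ∫⁻ ω, (k (ω []) * ∏ j ∈ s, h j (ω []) (shiftEnv [j] ω)) *
          h i (ω []) (shiftEnv [i] ω) ∂(envLaw μ) := by
          refine lintegral_congr fun ω => ?_
          rw [Finset.prod_insert hi]; ring
      _ = ∫⁻ ω, (k (ω []) * ∫⁻ η, h i (ω []) η ∂(envLaw μ)) *
          ∏ j ∈ s, h j (ω []) (shiftEnv [j] ω) ∂(envLaw μ) := by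
          rw [e1]
          refine lintegral_congr fun ω => ?_
          have hmη : Measurable (h i (ω [])) := (hh i).comp measurable_prodMk_left
          rw [lintegral_const_mul _ hmη]; ring
      _ = _ := by
          rw [ih (k := fun a => k a * ∫⁻ η, h i a η ∂(envLaw μ)) (hk.mul hI)]
          refine lintegral_congr fun a => ?_
          rw [Finset.prod_insert hi]; ring

/-! ### The Markov property of the quenched walk -/

/-- The trajectory after time `n`. -/
def shiftPath {b : ℕ} (n : ℕ) (X : ℕ → Vertex b) : ℕ → Vertex b := fun k => X (n + k)

@[fun_prop]
lemma measurable_shiftPath {b : ℕ} (n : ℕ) :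
    Measurable (shiftPath n : (ℕ → Vertex b) → ℕ → Vertex b) :=
  measurable_pi_lambda _ fun _ => measurable_pi_apply _

/-- The event `S` is decided by the positions up to time `n`. -/
def DeterminedBy {b : ℕ} (n : ℕ) (S : Set (ℕ → Vertex b)) : Prop :=
  ∀ X Y : ℕ → Vertex b, (∀ i ≤ n, X i = Y i) → X ∈ S → Y ∈ S

/-- The trajectories that agree with `y` up to time `n`. -/
def pathCyl {b : ℕ} (n : ℕ) (y : ℕ → Vertex b) : Set (ℕ → Vertex b) := {X | ∀ i ≤ n, X i = y i}

lemma measurableSet_pathCyl {b : ℕ} (n : ℕ) (y : ℕ → Vertex b) :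
    MeasurableSet (pathCyl n y) := measurableSet_path y n

/-- A trajectory with a given beginning, constant after time `n`. -/
def extendPath {b : ℕ} (n : ℕ) (h : Finset.Iic n → Vertex b) : ℕ → Vertex b :=
  fun i => if hi : i ≤ n then h ⟨i, Finset.mem_Iic.2 hi⟩ else Vertex.root

lemma DeterminedBy.eq_iUnion {b : ℕ} {n : ℕ} {S : Set (ℕ → Vertex b)} (hS : DeterminedBy n S) :
    S = ⋃ h : {h : Finset.Iic n → Vertex b // extendPath n h ∈ S}, pathCyl n (extendPath n h.1) := by
  ext X
  simp only [Set.mem_iUnion, Subtype.exists]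
  have hX : ∀ i ≤ n, X i = extendPath n (fun j => X j) i := fun i hi => by simp [extendPath, hi]
  constructor
  · exact fun h => ⟨fun j => X j, hS X _ hX h, hX⟩
  · rintro ⟨h, hh, hX'⟩
    exact hS _ X (fun i hi => (hX' i hi).symm) hh

lemma disjoint_pathCyl_extendPath {b : ℕ} {n : ℕ} (h h' : Finset.Iic n → Vertex b) (hne : h ≠ h') :
    Disjoint (pathCyl n (extendPath n h)) (pathCyl n (extendPath n h')) := by
  refine Set.disjoint_left.2 fun X hX hX' => hne (funext fun i => ?_)
  have hi := Finset.mem_Iic.1 i.2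
  have := (hX i hi).symm.trans (hX' i hi)
  simpa [extendPath, hi] using this

lemma DeterminedBy.measurableSet {b : ℕ} {n : ℕ} {S : Set (ℕ → Vertex b)}
    (hS : DeterminedBy n S) : MeasurableSet S := by
  rw [hS.eq_iUnion]
  exact .iUnion fun _ => measurableSet_pathCyl _ _

lemma DeterminedBy.measure_eq {b : ℕ} {n : ℕ} {S : Set (ℕ → Vertex b)} (hS : DeterminedBy n S)
    (m : Measure (ℕ → Vertex b)) :
    m S = ∑' h : {h : Finset.Iic n → Vertex b // extendPath n h ∈ S},
      m (pathCyl n (extendPath n h.1)) := by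
  conv_lhs => rw [hS.eq_iUnion]
  exact measure_iUnion (fun h h' hne => disjoint_pathCyl_extendPath _ _
    fun he => hne (Subtype.ext he)) fun _ => measurableSet_pathCyl _ _

/-- Finite measures on trajectories that agree on all path cylinders are equal. -/
lemma ext_of_pathCyl {b : ℕ} {m m' : Measure (ℕ → Vertex b)} [IsFiniteMeasure m]
    (h : ∀ n y, m (pathCyl n y) = m' (pathCyl n y)) : m = m' := by
  have key : ∀ n S, DeterminedBy n S → m S = m' S := fun n S hS => by
    rw [hS.measure_eq, hS.measure_eq]; simp_rw [h]
  refine ext_of_generate_finite _ generateFrom_measurableCylinders.symm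
    isPiSystem_measurableCylinders (fun s hs => ?_) (key 0 _ fun _ _ _ _ => trivial)
  obtain ⟨N, S, mS, rfl⟩ : ∃ N S, MeasurableSet S ∧ s = cylinder (Finset.Iic N) S := by
    simpa [measurableCylinders_nat] using hs
  refine key N _ fun X Y hXY hX => ?_
  rw [mem_cylinder] at hX ⊢
  convert hX using 1
  ext ⟨i, hi⟩
  exact (hXY i (Finset.mem_Iic.1 hi)).symm

lemma quenchedLaw_pathCyl {b : ℕ} (x : Vertex b) (ω : Env b) (y : ℕ → Vertex b) (n : ℕ) :
    quenchedLaw x ω (pathCyl n y) =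
      Measure.dirac x {y 0} * ∏ i ∈ Finset.range n, stepLaw ω (y i) {y (i + 1)} :=
  quenchedLaw_cylinder x ω y n

lemma restrict_pathCyl_map_shiftPath {b : ℕ} (x : Vertex b) (ω : Env b) (y : ℕ → Vertex b)
    (n : ℕ) :
    ((quenchedLaw x ω).restrict (pathCyl n y)).map (shiftPath n) =
      quenchedLaw x ω (pathCyl n y) • quenchedLaw (y n) ω := by
  refine ext_of_pathCyl fun k z => ?_
  rw [Measure.map_apply (measurable_shiftPath n) (measurableSet_pathCyl _ _),
    Measure.restrict_apply ((measurable_shiftPath n) (measurableSet_pathCyl _ _)),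
    Measure.smul_apply, smul_eq_mul, quenchedLaw_pathCyl (y n)]
  by_cases h0 : z 0 = y n
  · have : shiftPath n ⁻¹' pathCyl k z ∩ pathCyl n y =
        pathCyl (n + k) (fun i => if i ≤ n then y i else z (i - n)) := by
      ext X
      simp only [Set.mem_inter_iff, Set.mem_preimage, pathCyl, Set.mem_ofPred_eq, shiftPath]
      constructor
      · rintro ⟨h1, h2⟩ i hi
        split_ifs with hin
        · exact h2 i hin
        · have := h1 (i - n) (by omega)
          rwa [Nat.add_sub_cancel' (by omega)] at this
      · intro h
        refine ⟨fun i hi => ?_, fun i hi => ?_⟩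
        · have := h (n + i) (by omega)
          rcases Nat.eq_zero_or_pos i with rfl | hpos
          · simpa [h0] using this
          · simpa [show ¬ (n + i ≤ n) by omega] using this
        · simpa [hi] using h i (by omega)
    rw [this, quenchedLaw_pathCyl, quenchedLaw_pathCyl, Finset.prod_range_add, h0]
    simp only [Nat.zero_le, if_true, Measure.dirac_apply_of_mem (Set.mem_singleton _), one_mul]
    rw [mul_assoc]
    congr 2
    · refine Finset.prod_congr rfl fun i hi => ?_
      have := Finset.mem_range.1 hi
      simp [this.le, Nat.succ_le_of_lt this]
    · refine Finset.prod_congr rfl fun i hi => ?_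
      rcases Nat.eq_zero_or_pos i with rfl | hpos
      · simp [h0]
      · simp [show i ≠ 0 by omega, show ¬ (n + i + 1 ≤ n) by omega,
          show n + i + 1 - n = i + 1 by omega]
  · have : shiftPath n ⁻¹' pathCyl k z ∩ pathCyl n y = ∅ := by
      ext X
      simp only [Set.mem_inter_iff, Set.mem_preimage, pathCyl, Set.mem_ofPred_eq, shiftPath,
        Set.mem_empty_iff_false, iff_false]
      rintro ⟨h1, h2⟩
      exact h0 ((h1 0 (by omega)).symm.trans (h2 n le_rfl))
    rw [this, measure_empty, Measure.dirac_apply' _ (.singleton _)]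
    simp [Set.indicator, Ne.symm h0]

/-- The Markov property at a deterministic time. -/
lemma restrict_map_shiftPath {b : ℕ} (x : Vertex b) (ω : Env b) {n : ℕ} {v : Vertex b}
    {S : Set (ℕ → Vertex b)} (hS : DeterminedBy n S) (hv : ∀ X ∈ S, X n = v) :
    ((quenchedLaw x ω).restrict S).map (shiftPath n) =
      quenchedLaw x ω S • quenchedLaw v ω := by
  have hy : ∀ h : {h : Finset.Iic n → Vertex b // extendPath n h ∈ S}, extendPath n h.1 n = v :=
    fun h => hv _ h.2
  conv_lhs => rw [hS.eq_iUnion]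
  rw [Measure.restrict_iUnion (fun h h' hne => disjoint_pathCyl_extendPath _ _
    fun he => hne (Subtype.ext he)) fun _ => measurableSet_pathCyl _ _,
    Measure.map_sum (measurable_shiftPath n).aemeasurable]
  ext B hB
  rw [Measure.sum_apply _ hB, Measure.smul_apply, hS.measure_eq, smul_eq_mul,
    ← ENNReal.tsum_mul_right]
  refine tsum_congr fun h => ?_
  rw [restrict_pathCyl_map_shiftPath, Measure.smul_apply, smul_eq_mul, hy]

lemma setLIntegral_shiftPath {b : ℕ} (x : Vertex b) (ω : Env b) {n : ℕ} {v : Vertex b}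
    {S : Set (ℕ → Vertex b)} (hS : DeterminedBy n S) (hv : ∀ X ∈ S, X n = v)
    {Φ : (ℕ → Vertex b) → ℝ≥0∞} (hΦ : Measurable Φ) :
    ∫⁻ X in S, Φ (shiftPath n X) ∂(quenchedLaw x ω) =
      quenchedLaw x ω S * ∫⁻ X, Φ X ∂(quenchedLaw v ω) := by
  rw [← lintegral_map hΦ (measurable_shiftPath n), restrict_map_shiftPath x ω hS hv,
    lintegral_smul_measure, smul_eq_mul]

lemma quenchedLaw_inter_shiftPath {b : ℕ} (x : Vertex b) (ω : Env b) {n : ℕ} {v : Vertex b}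
    {S : Set (ℕ → Vertex b)} (hS : DeterminedBy n S) (hv : ∀ X ∈ S, X n = v)
    {B : Set (ℕ → Vertex b)} (hB : MeasurableSet B) :
    quenchedLaw x ω (S ∩ shiftPath n ⁻¹' B) = quenchedLaw x ω S * quenchedLaw v ω B := by
  have := congrArg (fun m => m B) (restrict_map_shiftPath x ω hS hv)
  rwa [Measure.map_apply (measurable_shiftPath n) hB,
    Measure.restrict_apply (measurable_shiftPath n hB), Measure.smul_apply, smul_eq_mul,
    Set.inter_comm] at this

lemma quenchedLaw_start_ae {b : ℕ} (x : Vertex b) (ω : Env b) :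
    ∀ᵐ X ∂(quenchedLaw x ω), X 0 = x := by
  have h : ∀ᵐ v ∂((quenchedLaw x ω).map fun X => X 0), v = x := by
    rw [quenchedLaw_start, ae_dirac_iff (.of_discrete)]
  exact ae_of_ae_map (measurable_pi_apply 0).aemeasurable h

lemma quenchedLaw_zero_one {b : ℕ} (x v : Vertex b) (ω : Env b) :
    quenchedLaw x ω {X | X 0 = x ∧ X 1 = v} = stepLaw ω x {v} := by
  have : {X : ℕ → Vertex b | X 0 = x ∧ X 1 = v} = pathCyl 1 (fun i => if i = 0 then x else v) := by
    ext X
    simp [pathCyl, Nat.le_one_iff_eq_zero_or_eq_one]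
  rw [this, quenchedLaw_pathCyl]
  simp

/-- One-step analysis of the quenched walk. -/
lemma quenchedLaw_shiftPath_one {b : ℕ} (x : Vertex b) (ω : Env b) {B : Set (ℕ → Vertex b)}
    (hB : MeasurableSet B) :
    quenchedLaw x ω (shiftPath 1 ⁻¹' B) = ∫⁻ v, quenchedLaw v ω B ∂(stepLaw ω x) := by
  rw [lintegral_countable']
  have hd : ∀ v, DeterminedBy 1 {X : ℕ → Vertex b | X 0 = x ∧ X 1 = v} := by
    intro v X Y h hX
    simp only [Set.mem_ofPred_eq] at hX ⊢
    rw [← h 0 (by omega), ← h 1 (by omega)]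
    exact hX
  have e1 : quenchedLaw x ω (shiftPath 1 ⁻¹' B) =
      quenchedLaw x ω (⋃ v, {X | X 0 = x ∧ X 1 = v} ∩ shiftPath 1 ⁻¹' B) := by
    refine measure_congr ?_
    filter_upwards [quenchedLaw_start_ae x ω] with X hX
    have : X ∈ (shiftPath 1 ⁻¹' B) ↔ X ∈ (⋃ v, {X | X 0 = x ∧ X 1 = v} ∩ shiftPath 1 ⁻¹' B) := by
      simp [hX]
    exact propext this
  rw [e1, measure_iUnion]
  · refine tsum_congr fun v => ?_
    rw [quenchedLaw_inter_shiftPath x ω (hd v) (fun X hX => hX.2) hB, quenchedLaw_zero_one,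
      mul_comm]
  · intro v v' hne
    refine Set.disjoint_left.2 fun X hX hX' => hne ?_
    exact hX.1.2.symm.trans hX'.1.2
  · exact fun v => (hd v).measurableSet.inter (measurable_shiftPath 1 hB)

lemma measurableSet_exists_mem {b : ℕ} (G : Set (Vertex b)) :
    MeasurableSet {X : ℕ → Vertex b | ∃ n, X n ∈ G} := by
  have : {X : ℕ → Vertex b | ∃ n, X n ∈ G} = ⋃ n, (fun X => X n) ⁻¹' G := by ext; simp
  rw [this]
  exact .iUnion fun n => measurable_pi_apply n .of_discrete

/-- A nonnegative function that is at least `1` on `G` and superharmonic off `G` bounds the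
probability of hitting `G`. -/
lemma quenchedLaw_hit_le {b : ℕ} (ω : Env b) (G : Set (Vertex b)) (h : Vertex b → ℝ≥0∞)
    (hG : ∀ v ∈ G, 1 ≤ h v) (hh : ∀ v ∉ G, ∫⁻ u, h u ∂(stepLaw ω v) ≤ h v) (v : Vertex b) :
    quenchedLaw v ω {X | ∃ n, X n ∈ G} ≤ h v := by
  have hmeas : ∀ N, MeasurableSet {X : ℕ → Vertex b | ∃ n ≤ N, X n ∈ G} := fun N =>
    DeterminedBy.measurableSet (n := N) fun X Y hXY ⟨n, hn, hX⟩ => ⟨n, hn, hXY n hn ▸ hX⟩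
  have key : ∀ N v, quenchedLaw v ω {X | ∃ n ≤ N, X n ∈ G} ≤ h v := by
    intro N
    induction N with
    | zero =>
      intro v
      by_cases hv : v ∈ G
      · exact prob_le_one.trans (hG v hv)
      · refine le_of_eq_of_le ?_ zero_le
        rw [← nonpos_iff_eq_zero]
        refine (measure_mono_ae (t := ∅) ?_).trans_eq measure_empty
        filter_upwards [quenchedLaw_start_ae v ω] with X hX
        rintro ⟨n, hn, hXn⟩
        obtain rfl := Nat.le_zero.1 hn
        exact hv (hX ▸ hXn)
    | succ N ih =>
      intro v
      by_cases hv : v ∈ G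
      · exact prob_le_one.trans (hG v hv)
      · refine le_trans ?_ (hh v hv)
        refine le_trans ?_ (lintegral_mono fun u => ih u)
        rw [← quenchedLaw_shiftPath_one v ω (hmeas N)]
        refine measure_mono_ae ?_
        filter_upwards [quenchedLaw_start_ae v ω] with X hX
        rintro ⟨n, hn, hXn⟩
        rcases n with _ | n
        · exact absurd (hX ▸ hXn) hv
        · exact ⟨n, by omega, by rwa [shiftPath, add_comm]⟩
  have hU : {X : ℕ → Vertex b | ∃ n, X n ∈ G} = ⋃ N, {X | ∃ n ≤ N, X n ∈ G} := by
    ext X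
    simp only [Set.mem_ofPred_eq, Set.mem_iUnion]
    exact ⟨fun ⟨n, hn⟩ => ⟨n, n, le_rfl, hn⟩, fun ⟨_, n, _, hn⟩ => ⟨n, hn⟩⟩
  rw [hU, Monotone.measure_iUnion]
  · exact iSup_le fun N => key N v
  · exact fun N M hNM X ⟨n, hn, hX⟩ => ⟨n, hn.trans hNM, hX⟩

/-- A disjoint family of events that stop the walk: on `S n v` the walk is stopped at time `n` at the
vertex `v`. -/
structure IsStopping {b : ℕ} (S : ℕ → Vertex b → Set (ℕ → Vertex b)) : Prop where
  determined : ∀ n v, DeterminedBy n (S n v)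
  at_vertex : ∀ n v, ∀ X ∈ S n v, X n = v
  disjoint : ∀ n v n' v' X, X ∈ S n v → X ∈ S n' v' → n = n'

lemma IsStopping.pairwise {b : ℕ} {S : ℕ → Vertex b → Set (ℕ → Vertex b)} (hS : IsStopping S) :
    Pairwise (Function.onFun Disjoint fun p : ℕ × Vertex b => S p.1 p.2) := by
  rintro ⟨n, v⟩ ⟨n', v'⟩ hne
  refine Set.disjoint_left.2 fun X hX hX' => hne ?_
  obtain rfl := hS.disjoint _ _ _ _ _ hX hX'
  exact Prod.ext rfl ((hS.at_vertex _ _ _ hX).symm.trans (hS.at_vertex _ _ _ hX'))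

lemma IsStopping.tsum_le_one {b : ℕ} {S : ℕ → Vertex b → Set (ℕ → Vertex b)}
    (hS : IsStopping S) (x : Vertex b) (ω : Env b) :
    ∑' p : ℕ × Vertex b, quenchedLaw x ω (S p.1 p.2) ≤ 1 := by
  rw [← measure_iUnion hS.pairwise fun p => (hS.determined p.1 p.2).measurableSet]
  exact prob_le_one

/-- Hitting `G` after `D` is at most as likely as hitting `G` from the worst vertex of `D`. -/
lemma quenchedLaw_hit_hit_le {b : ℕ} (ω : Env b) (D G : Set (Vertex b)) (c : ℝ≥0∞)
    (hc : ∀ v ∈ D, quenchedLaw v ω {X | ∃ n, X n ∈ G} ≤ c) (x : Vertex b) :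
    quenchedLaw x ω {X | ∃ n m, X n ∈ D ∧ X (n + m) ∈ G} ≤ c := by
  classical
  set S : ℕ → Vertex b → Set (ℕ → Vertex b) := fun n v =>
    {X | X n = v ∧ v ∈ D ∧ ∀ i < n, X i ∉ D} with hSdef
  have hS : IsStopping S := by
    refine ⟨fun n v X Y h hX => ?_, fun n v X hX => hX.1, fun n v n' v' X hX hX' => ?_⟩
    · exact ⟨h n le_rfl ▸ hX.1, hX.2.1, fun i hi => h i hi.le ▸ hX.2.2 i hi⟩
    · obtain ⟨h1, h2, h3⟩ := hX
      obtain ⟨h1', h2', h3'⟩ := hX'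
      rcases lt_trichotomy n n' with h | h | h
      · exact absurd (h1 ▸ h2) (h3' n h)
      · exact h
      · exact absurd (h1' ▸ h2') (h3 n' h)
  have hsub : {X : ℕ → Vertex b | ∃ n m, X n ∈ D ∧ X (n + m) ∈ G} ⊆
      ⋃ p : ℕ × Vertex b, S p.1 p.2 ∩ shiftPath p.1 ⁻¹' {X | ∃ n, X n ∈ G} := by
    rintro X ⟨n, m, hn, hm⟩
    have hex : ∃ n, X n ∈ D := ⟨n, hn⟩
    have hle : Nat.find hex ≤ n := Nat.find_min' hex hn
    refine Set.mem_iUnion.2 ⟨(Nat.find hex, X (Nat.find hex)),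
      ⟨rfl, Nat.find_spec hex, fun i hi => Nat.find_min hex hi⟩, n - Nat.find hex + m, ?_⟩
    simp only [shiftPath]
    rwa [show Nat.find hex + (n - Nat.find hex + m) = n + m by omega]
  refine (measure_mono hsub).trans ((measure_iUnion_le _).trans ?_)
  calc ∑' p : ℕ × Vertex b, quenchedLaw x ω
        (S p.1 p.2 ∩ shiftPath p.1 ⁻¹' {X | ∃ n, X n ∈ G})
      ≤ ∑' p : ℕ × Vertex b, quenchedLaw x ω (S p.1 p.2) * c := by
        refine ENNReal.tsum_le_tsum fun p => ?_
        rw [quenchedLaw_inter_shiftPath x ω (hS.determined _ _) (hS.at_vertex _ _)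
          (measurableSet_exists_mem G)]
        by_cases hp : p.2 ∈ D
        · gcongr; exact hc _ hp
        · have : S p.1 p.2 = ∅ := by ext X; simp [hSdef, hp]
          simp [this]
    _ ≤ 1 * c := by rw [ENNReal.tsum_mul_right]; gcongr; exact hS.tsum_le_one x ω
    _ = c := one_mul c

/-! ### Escape probabilities -/

/-- `∑ᵢ Aᵢ f(ωᵢ)`, where `ωᵢ` is the environment seen from the `i`-th offspring of the root. -/
noncomputable def childSum {b : ℕ} (f : Env b → ℝ) (ω : Env b) : ℝ :=
  ∑ i, (ω [] i : ℝ) * f (shiftEnv [i] ω)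

/-- The quenched probability that the walk started at the root reaches level `n` before the
parent of the root, through its recursion in `n`. -/
noncomputable def esc {b : ℕ} : ℕ → Env b → ℝ
  | 0, _ => 1
  | n + 1, ω => childSum (esc n) ω / (1 + childSum (esc n) ω)

lemma childSum_mono {b : ℕ} {f g : Env b → ℝ} (h : ∀ ω, f ω ≤ g ω) (ω : Env b) :
    childSum f ω ≤ childSum g ω :=
  Finset.sum_le_sum fun i _ => mul_le_mul_of_nonneg_left (h _) (ω [] i).2.le

lemma childSum_nonneg {b : ℕ} {f : Env b → ℝ} (h : ∀ ω, 0 ≤ f ω) (ω : Env b) :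
    0 ≤ childSum f ω :=
  Finset.sum_nonneg fun i _ => mul_nonneg (ω [] i).2.le (h _)

lemma childSum_pos {b : ℕ} (hb : 0 < b) {f : Env b → ℝ} (h : ∀ ω, 0 < f ω) (ω : Env b) :
    0 < childSum f ω := by
  have : Nonempty (Fin b) := ⟨⟨0, hb⟩⟩
  exact Finset.sum_pos (fun i _ => mul_pos (ω [] i).2 (h _)) Finset.univ_nonempty

@[fun_prop]
lemma measurable_childSum {b : ℕ} {f : Env b → ℝ} (hf : Measurable f) :
    Measurable (childSum f) := by
  unfold childSum
  have hr : ∀ i, Measurable fun ω : Env b => (ω [] i : ℝ) := fun i => by fun_prop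
  exact Finset.measurable_sum _ fun i _ => (hr i).mul (hf.comp (measurable_shiftEnv _))

lemma div_one_add_mono {x y : ℝ} (hx : 0 ≤ x) (h : x ≤ y) : x / (1 + x) ≤ y / (1 + y) := by
  rw [div_le_div_iff₀ (by linarith) (by linarith)]
  nlinarith

lemma esc_nonneg {b : ℕ} (n : ℕ) (ω : Env b) : 0 ≤ esc n ω := by
  induction n generalizing ω with
  | zero => simp [esc]
  | succ n ih =>
    have := childSum_nonneg (ih ·) ω
    simp only [esc]; positivity

lemma esc_pos {b : ℕ} (hb : 0 < b) (n : ℕ) (ω : Env b) : 0 < esc n ω := by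
  induction n generalizing ω with
  | zero => simp [esc]
  | succ n ih =>
    have := childSum_pos hb (ih ·) ω
    simp only [esc]; positivity

lemma esc_le_one {b : ℕ} (n : ℕ) (ω : Env b) : esc n ω ≤ 1 := by
  cases n with
  | zero => simp [esc]
  | succ n =>
    have := childSum_nonneg (f := esc n) (esc_nonneg n) ω
    simp only [esc]
    rw [div_le_one (by linarith)]; linarith

lemma esc_succ_le {b : ℕ} (n : ℕ) (ω : Env b) : esc (n + 1) ω ≤ esc n ω := by
  induction n generalizing ω with
  | zero => exact esc_le_one 1 ω
  | succ n ih =>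
    exact div_one_add_mono (childSum_nonneg (esc_nonneg _) ω) (childSum_mono ih ω)

lemma antitone_esc {b : ℕ} (ω : Env b) : Antitone fun n => esc n ω :=
  antitone_nat_of_succ_le fun n => esc_succ_le n ω

@[fun_prop]
lemma measurable_esc {b : ℕ} (n : ℕ) : Measurable (esc n : Env b → ℝ) := by
  induction n with
  | zero => exact measurable_const
  | succ n ih =>
    have := measurable_childSum ih
    simp only [esc]
    fun_prop

/-- The quenched probability `β` that the walk started at the root never visits the parent of the
root, as the limit of the decreasing sequence `esc`. -/
noncomputable def escLim {b : ℕ} (ω : Env b) : ℝ := ⨅ n, esc n ω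

lemma tendsto_esc {b : ℕ} (ω : Env b) :
    Filter.Tendsto (fun n => esc n ω) Filter.atTop (nhds (escLim ω)) :=
  tendsto_atTop_ciInf (antitone_esc ω) ⟨0, by rintro _ ⟨n, rfl⟩; exact esc_nonneg n ω⟩

lemma escLim_nonneg {b : ℕ} (ω : Env b) : 0 ≤ escLim ω := le_ciInf fun n => esc_nonneg n ω

lemma escLim_le_esc {b : ℕ} (n : ℕ) (ω : Env b) : escLim ω ≤ esc n ω :=
  ciInf_le ⟨0, by rintro _ ⟨n, rfl⟩; exact esc_nonneg n ω⟩ n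

lemma escLim_le_one {b : ℕ} (ω : Env b) : escLim ω ≤ 1 := escLim_le_esc 0 ω

@[fun_prop]
lemma measurable_escLim {b : ℕ} : Measurable (escLim : Env b → ℝ) :=
  measurable_of_tendsto_metrizable (fun n => measurable_esc n)
    (tendsto_pi_nhds.2 fun ω => tendsto_esc ω)

lemma escLim_eq {b : ℕ} (ω : Env b) :
    escLim ω = childSum escLim ω / (1 + childSum escLim ω) := by
  have h1 : Filter.Tendsto (fun n => childSum (esc n) ω) Filter.atTop
      (nhds (childSum escLim ω)) :=
    tendsto_finsetSum _ fun i _ => (tendsto_esc _).const_mul _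
  have h0 := childSum_nonneg escLim_nonneg ω
  exact tendsto_nhds_unique ((tendsto_esc ω).comp (Filter.tendsto_add_atTop_nat 1))
    (h1.div (h1.const_add 1) (by linarith))

lemma one_sub_escLim {b : ℕ} (ω : Env b) : 1 - escLim ω = 1 / (1 + childSum escLim ω) := by
  have h0 := childSum_nonneg escLim_nonneg ω
  rw [escLim_eq]; field_simp; ring

/-- The product of `1 - β` over the vertices on the path from the root to `u`: the quenched
probability that the walk started at `u` ever visits the parent of the root. -/
noncomputable def ret {b : ℕ} (ω : Env b) : List (Fin b) → ℝ
  | [] => 1 - escLim ω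
  | i :: u => (1 - escLim (shiftEnv (i :: u) ω)) * ret ω u

lemma ret_nonneg {b : ℕ} (ω : Env b) (u : List (Fin b)) : 0 ≤ ret ω u := by
  induction u with
  | nil => simpa [ret] using escLim_le_one ω
  | cons i u ih => exact mul_nonneg (sub_nonneg.2 (escLim_le_one _)) ih

lemma ret_append_singleton {b : ℕ} (ω : Env b) (u : List (Fin b)) (i : Fin b) :
    ret ω (u ++ [i]) = ret (shiftEnv [i] ω) u * (1 - escLim ω) := by
  induction u with
  | nil => simp [ret]
  | cons j u ih =>
    simp only [List.cons_append, ret, ih, shiftEnv_shiftEnv]; ring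

/-- The subtree of the vertex with address `w`. -/
def subtree {b : ℕ} (w : List (Fin b)) : Set (Vertex b) := {v | ∃ u, v = .node (u ++ w)}

lemma node_mem_subtree {b : ℕ} {v w : List (Fin b)} :
    Vertex.node v ∈ subtree w ↔ w <:+ v := by
  simp only [subtree, Set.mem_ofPred_eq, Vertex.node.injEq]
  exact ⟨fun ⟨u, hu⟩ => ⟨u, hu.symm⟩, fun ⟨u, hu⟩ => ⟨u, hu.symm⟩⟩

lemma rootParent_notMem_subtree {b : ℕ} (w : List (Fin b)) :
    Vertex.rootParent ∉ subtree w := by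
  rintro ⟨u, hu⟩; cases hu

lemma lintegral_stepLaw_node {b : ℕ} (ω : Env b) (w : List (Fin b)) (f : Vertex b → ℝ≥0∞) :
    ∫⁻ v, f v ∂(stepLaw ω (.node w)) =
      ENNReal.ofReal (1 / (1 + totalWeight (ω w))) * f (Vertex.parentOfNode w) +
      ∑ i, ENNReal.ofReal ((ω w i : ℝ) / (1 + totalWeight (ω w))) * f (.node (i :: w)) := by
  simp [stepLaw, lintegral_add_measure, lintegral_smul_measure]

/-- The walk started at the vertex `u` of the subtree of `w` leaves this subtree with probability
at most `ret`, since `ret` extended by `1` is superharmonic. -/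
lemma quenchedLaw_exit_subtree_le {b : ℕ} (ω : Env b) (u w : List (Fin b)) :
    quenchedLaw (.node (u ++ w)) ω {X | ∃ n, X n ∈ (subtree w)ᶜ} ≤
      ENNReal.ofReal (ret (shiftEnv w ω) u) := by
  set h : Vertex b → ℝ≥0∞ := fun v => match v with
    | .rootParent => 1
    | .node v => if w <:+ v then
        ENNReal.ofReal (ret (shiftEnv w ω) (v.take (v.length - w.length))) else 1 with hdef
  have hin : ∀ u, h (.node (u ++ w)) = ENNReal.ofReal (ret (shiftEnv w ω) u) := by
    intro u; simp [hdef]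
  have hout : ∀ v ∉ subtree w, h v = 1 := by
    rintro (_ | v) hv
    · rfl
    · simp only [hdef]; rw [if_neg (fun hs => hv (node_mem_subtree.2 hs))]
  rw [← hin]
  refine quenchedLaw_hit_le ω _ h (fun v hv => (hout v hv).ge) (fun v hv => ?_) _
  obtain ⟨u, rfl⟩ := not_not.1 hv
  obtain ⟨r, hr0, hpar, hret⟩ : ∃ r : ℝ, 0 ≤ r ∧
      h (Vertex.parentOfNode (u ++ w)) = ENNReal.ofReal r ∧
      ret (shiftEnv w ω) u = (1 - escLim (shiftEnv (u ++ w) ω)) * r := by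
    rcases u with _ | ⟨i, u⟩
    · refine ⟨1, zero_le_one, ?_, by simp [ret]⟩
      rw [ENNReal.ofReal_one]
      refine hout _ fun ⟨u, hu⟩ => ?_
      rcases w with _ | ⟨i, w⟩
      · cases hu
      · simp only [Vertex.parentOfNode, List.nil_append, Vertex.node.injEq] at hu
        have := congrArg List.length hu
        simp at this
        omega
    · exact ⟨ret (shiftEnv w ω) u, ret_nonneg _ _, hin u, by
        simp only [ret, shiftEnv_shiftEnv]⟩
  have hS := totalWeight_nonneg (ω (u ++ w))
  have hch : ∀ i, h (.node (i :: (u ++ w))) =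
      ENNReal.ofReal ((1 - escLim (shiftEnv [i] (shiftEnv (u ++ w) ω))) *
        ret (shiftEnv w ω) u) := fun i => by
    have := hin (i :: u)
    simp only [List.cons_append, ret, shiftEnv_shiftEnv] at this
    simpa only [shiftEnv_shiftEnv, List.singleton_append] using this
  have hβ : ∀ i, 0 ≤ 1 - escLim (shiftEnv [i] (shiftEnv (u ++ w) ω)) := fun i =>
    sub_nonneg.2 (escLim_le_one _)
  have hA : ∀ i, 0 ≤ (ω (u ++ w) i : ℝ) := fun i => (ω (u ++ w) i).2.le
  rw [lintegral_stepLaw_node, hpar, hin]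
  simp only [hch]
  have hr := ret_nonneg (shiftEnv w ω) u
  rw [← ENNReal.ofReal_mul (by positivity)]
  have hterm : ∀ i, ENNReal.ofReal ((ω (u ++ w) i : ℝ) / (1 + totalWeight (ω (u ++ w)))) *
      ENNReal.ofReal ((1 - escLim (shiftEnv [i] (shiftEnv (u ++ w) ω))) *
        ret (shiftEnv w ω) u) =
      ENNReal.ofReal ((ω (u ++ w) i : ℝ) / (1 + totalWeight (ω (u ++ w))) *
      ((1 - escLim (shiftEnv [i] (shiftEnv (u ++ w) ω))) * ret (shiftEnv w ω) u)) :=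
    fun i => (ENNReal.ofReal_mul (div_nonneg (hA i) (by positivity))).symm
  simp only [hterm]
  have hnn : ∀ i, 0 ≤ (ω (u ++ w) i : ℝ) / (1 + totalWeight (ω (u ++ w))) *
      ((1 - escLim (shiftEnv [i] (shiftEnv (u ++ w) ω))) * ret (shiftEnv w ω) u) := fun i =>
    mul_nonneg (div_nonneg (hA i) (by positivity)) (mul_nonneg (hβ i) hr)
  rw [← ENNReal.ofReal_sum_of_nonneg fun i _ => hnn i,
    ← ENNReal.ofReal_add (by positivity) (Finset.sum_nonneg fun i _ => hnn i)]
  refine ENNReal.ofReal_le_ofReal (le_of_eq ?_)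
  have hc : childSum escLim (shiftEnv (u ++ w) ω) =
      ∑ i, (ω (u ++ w) i : ℝ) * escLim (shiftEnv [i] (shiftEnv (u ++ w) ω)) := by
    simp [childSum, shiftEnv]
  have hsum : ∑ i, (ω (u ++ w) i : ℝ) / (1 + totalWeight (ω (u ++ w))) *
      ((1 - escLim (shiftEnv [i] (shiftEnv (u ++ w) ω))) * ret (shiftEnv w ω) u) =
      ret (shiftEnv w ω) u / (1 + totalWeight (ω (u ++ w))) *
        (totalWeight (ω (u ++ w)) - childSum escLim (shiftEnv (u ++ w) ω)) := by
    rw [hc, totalWeight, ← Finset.sum_sub_distrib, Finset.mul_sum]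
    refine Finset.sum_congr rfl fun i _ => ?_
    ring
  rw [hsum, hret, one_sub_escLim]
  have hc0 := childSum_nonneg escLim_nonneg (shiftEnv (u ++ w) ω)
  field_simp
  ring

lemma quenchedLaw_exit_subtree_self_le {b : ℕ} (ω : Env b) (w : List (Fin b)) :
    quenchedLaw (.node w) ω {X | ∃ n, X n ∈ (subtree w)ᶜ} ≤
      ENNReal.ofReal (1 - escLim (shiftEnv w ω)) :=
  quenchedLaw_exit_subtree_le ω [] w

/-! ### The number of visits to a vertex -/

/-- The probability that the walk started at the root jumps to an offspring from which it never
returns. -/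
noncomputable def neverBack {b : ℕ} (ω : Env b) : ℝ :=
  childSum escLim ω / (1 + totalWeight (ω []))

lemma childSum_escLim_le {b : ℕ} (ω : Env b) : childSum escLim ω ≤ totalWeight (ω []) :=
  Finset.sum_le_sum fun i _ => mul_le_of_le_one_right (ω [] i).2.le (escLim_le_one _)

lemma neverBack_nonneg {b : ℕ} (ω : Env b) : 0 ≤ neverBack ω :=
  div_nonneg (childSum_nonneg escLim_nonneg ω) (by have := totalWeight_nonneg (ω []); positivity)

lemma neverBack_le_one {b : ℕ} (ω : Env b) : neverBack ω ≤ 1 := by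
  have := totalWeight_nonneg (ω [])
  have := childSum_escLim_le ω
  rw [neverBack, div_le_one (by positivity)]; linarith

lemma measurable_totalWeight {b : ℕ} : Measurable (totalWeight : Weights b → ℝ) := by
  unfold totalWeight; fun_prop

@[fun_prop]
lemma measurable_neverBack {b : ℕ} : Measurable (neverBack : Env b → ℝ) := by
  have h : Measurable fun ω : Env b => totalWeight (ω []) :=
    measurable_totalWeight.comp (measurable_pi_apply _)
  unfold neverBack
  exact (measurable_childSum measurable_escLim).div (h.const_add 1)

/-- The number of visits to `v` after time `0`. -/
noncomputable def returns {b : ℕ} (v : Vertex b) (X : ℕ → Vertex b) : ℝ≥0∞ :=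
  ∑' n, ({v} : Set (Vertex b)).indicator 1 (X (n + 1))

/-- The number of visits to `v`. -/
noncomputable def visits {b : ℕ} (v : Vertex b) (X : ℕ → Vertex b) : ℝ≥0∞ :=
  ∑' n, ({v} : Set (Vertex b)).indicator 1 (X n)

lemma measurable_returns {b : ℕ} (v : Vertex b) : Measurable (returns v) :=
  .tsum fun _ => (measurable_of_countable (({v} : Set (Vertex b)).indicator 1)).comp
    (measurable_pi_apply _)

lemma measurable_visits {b : ℕ} (v : Vertex b) : Measurable (visits v) :=
  .tsum fun _ => (measurable_of_countable (({v} : Set (Vertex b)).indicator 1)).comp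
    (measurable_pi_apply _)

lemma visits_eq {b : ℕ} (v : Vertex b) (X : ℕ → Vertex b) (h : X 0 = v) :
    visits v X = 1 + returns v X := by
  rw [visits, tsum_eq_zero_add' ENNReal.summable, returns, h]
  simp

lemma quenchedLaw_return_le {b : ℕ} (ω : Env b) (w : List (Fin b)) :
    quenchedLaw (.node w) ω {X | ∃ n, X (n + 1) = .node w} ≤
      ENNReal.ofReal (1 - neverBack (shiftEnv w ω)) := by
  have e : {X : ℕ → Vertex b | ∃ n, X (n + 1) = .node w} =
      shiftPath 1 ⁻¹' {X | ∃ n, X n ∈ ({.node w} : Set (Vertex b))} := by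
    ext X; simp [shiftPath, add_comm]
  rw [e, quenchedLaw_shiftPath_one _ _ (measurableSet_exists_mem _), lintegral_stepLaw_node]
  have hS := totalWeight_nonneg (ω w)
  have hch : ∀ i, quenchedLaw (.node (i :: w)) ω {X | ∃ n, X n ∈ ({.node w} : Set (Vertex b))} ≤
      ENNReal.ofReal (1 - escLim (shiftEnv [i] (shiftEnv w ω))) := fun i => by
    rw [shiftEnv_shiftEnv]
    refine le_trans (measure_mono ?_) (quenchedLaw_exit_subtree_self_le ω (i :: w))
    rintro X ⟨n, hn⟩
    refine ⟨n, fun hs => ?_⟩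
    rw [Set.mem_singleton_iff.1 hn, node_mem_subtree] at hs
    simpa using hs.length_le
  have hA : ∀ i, 0 ≤ (ω w i : ℝ) := fun i => (ω w i).2.le
  have hβ : ∀ i, 0 ≤ 1 - escLim (shiftEnv [i] (shiftEnv w ω)) := fun i =>
    sub_nonneg.2 (escLim_le_one _)
  refine (add_le_add (mul_le_mul_right prob_le_one _) (Finset.sum_le_sum fun i _ =>
    mul_le_mul_right (hch i) _)).trans ?_
  have hterm : ∀ i, ENNReal.ofReal ((ω w i : ℝ) / (1 + totalWeight (ω w))) *
      ENNReal.ofReal (1 - escLim (shiftEnv [i] (shiftEnv w ω))) =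
      ENNReal.ofReal ((ω w i : ℝ) / (1 + totalWeight (ω w)) *
      (1 - escLim (shiftEnv [i] (shiftEnv w ω)))) :=
    fun i => (ENNReal.ofReal_mul (div_nonneg (hA i) (by positivity))).symm
  have hnn : ∀ i, 0 ≤ (ω w i : ℝ) / (1 + totalWeight (ω w)) *
      (1 - escLim (shiftEnv [i] (shiftEnv w ω))) := fun i =>
    mul_nonneg (div_nonneg (hA i) (by positivity)) (hβ i)
  simp only [hterm, mul_one]
  rw [← ENNReal.ofReal_sum_of_nonneg fun i _ => hnn i,
    ← ENNReal.ofReal_add (by positivity) (Finset.sum_nonneg fun i _ => hnn i)]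
  refine ENNReal.ofReal_le_ofReal (le_of_eq ?_)
  have hc : childSum escLim (shiftEnv w ω) =
      ∑ i, (ω w i : ℝ) * escLim (shiftEnv [i] (shiftEnv w ω)) := by
    simp [childSum, shiftEnv]
  have hsum : ∑ i, (ω w i : ℝ) / (1 + totalWeight (ω w)) *
      (1 - escLim (shiftEnv [i] (shiftEnv w ω))) =
      (totalWeight (ω w) - childSum escLim (shiftEnv w ω)) / (1 + totalWeight (ω w)) := by
    rw [hc, totalWeight, ← Finset.sum_sub_distrib, Finset.sum_div]
    refine Finset.sum_congr rfl fun i _ => ?_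
    ring
  have h0 : shiftEnv w ω [] = ω w := by simp [shiftEnv]
  rw [hsum, neverBack, h0]
  field_simp
  ring

lemma quenchedLaw_returns_ge_le {b : ℕ} (ω : Env b) (w : List (Fin b)) (m : ℕ) :
    quenchedLaw (.node w) ω {X | (m : ℝ≥0∞) ≤ returns (.node w) X} ≤
      ENNReal.ofReal (1 - neverBack (shiftEnv w ω)) ^ m := by
  classical
  induction m with
  | zero => simp
  | succ m ih =>
    set S : ℕ → Vertex b → Set (ℕ → Vertex b) := fun n v =>
      {X | X n = v ∧ v = .node w ∧ 0 < n ∧ ∀ i < n, 0 < i → X i ≠ .node w} with hSdef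
    have hS : IsStopping S := by
      refine ⟨fun n v X Y h hX => ?_, fun n v X hX => hX.1, fun n v n' v' X hX hX' => ?_⟩
      · exact ⟨h n le_rfl ▸ hX.1, hX.2.1, hX.2.2.1, fun i hi => h i hi.le ▸ hX.2.2.2 i hi⟩
      · obtain ⟨h1, h2, h3, h4⟩ := hX
        obtain ⟨h1', h2', h3', h4'⟩ := hX'
        rcases lt_trichotomy n n' with h | h | h
        · exact absurd (h1.trans h2) (h4' n h h3)
        · exact h
        · exact absurd (h1'.trans h2') (h4 n' h h3')
    have hmeas : MeasurableSet {X : ℕ → Vertex b | (m : ℝ≥0∞) ≤ returns (.node w) X} :=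
      measurableSet_le measurable_const (measurable_returns _)
    have hsub : {X : ℕ → Vertex b | ((m + 1 : ℕ) : ℝ≥0∞) ≤ returns (.node w) X} ⊆
        ⋃ p : ℕ × Vertex b, S p.1 p.2 ∩ shiftPath p.1 ⁻¹'
          {X | (m : ℝ≥0∞) ≤ returns (.node w) X} := by
      intro X hX
      have hX' : ((m + 1 : ℕ) : ℝ≥0∞) ≤ returns (.node w) X := hX
      have hex : ∃ n, X (n + 1) = .node w := by
        by_contra! hno
        have : returns (.node w) X = 0 := by
          simp [returns, hno]
        rw [this] at hX'
        simp at hX'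
      refine Set.mem_iUnion.2 ⟨(Nat.find hex + 1, .node w),
        ⟨Nat.find_spec hex, rfl, by omega, fun i hi h0 hXi => ?_⟩, ?_⟩
      · refine Nat.find_min hex (m := i - 1) (by omega) ?_
        rwa [Nat.sub_add_cancel h0]
      · have e : returns (.node w) X =
            1 + returns (.node w) (shiftPath (Nat.find hex + 1) X) := by
          rw [returns, ← (ENNReal.summable).sum_add_tsum_nat_add' (k := Nat.find hex),
            Finset.sum_eq_zero, zero_add, tsum_eq_zero_add' ENNReal.summable]
          · simp only [zero_add]
            rw [Nat.find_spec hex]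
            simp only [Set.mem_singleton_iff, Set.indicator_of_mem, Pi.one_apply, returns]
            congr 1
            refine tsum_congr fun n => ?_
            rw [shiftPath]
            congr 2
            omega
          · intro i hi
            have := Nat.find_min hex (Finset.mem_range.1 hi)
            simp [this]
        rw [e, Nat.cast_add, Nat.cast_one, add_comm] at hX'
        exact (ENNReal.add_le_add_iff_left ENNReal.one_ne_top).1 hX'
    refine (measure_mono hsub).trans ((measure_iUnion_le _).trans ?_)
    calc ∑' p : ℕ × Vertex b, quenchedLaw (.node w) ω
          (S p.1 p.2 ∩ shiftPath p.1 ⁻¹' {X | (m : ℝ≥0∞) ≤ returns (.node w) X})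
        ≤ ∑' p : ℕ × Vertex b, quenchedLaw (.node w) ω (S p.1 p.2) *
            ENNReal.ofReal (1 - neverBack (shiftEnv w ω)) ^ m := by
          refine ENNReal.tsum_le_tsum fun p => ?_
          rw [quenchedLaw_inter_shiftPath _ ω (hS.determined _ _) (hS.at_vertex _ _) hmeas]
          by_cases hp : p.2 = .node w
          · rw [hp]; gcongr
          · have : S p.1 p.2 = ∅ := by ext X; simp [hSdef, hp]
            simp [this]
      _ ≤ ENNReal.ofReal (1 - neverBack (shiftEnv w ω)) *
            ENNReal.ofReal (1 - neverBack (shiftEnv w ω)) ^ m := by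
          rw [ENNReal.tsum_mul_right]
          gcongr
          rw [← measure_iUnion hS.pairwise fun p => (hS.determined p.1 p.2).measurableSet]
          refine (measure_mono ?_).trans (quenchedLaw_return_le ω w)
          intro X hX
          obtain ⟨p, h1, h2, h3, -⟩ := Set.mem_iUnion.1 hX
          exact ⟨p.1 - 1, by rw [Nat.sub_add_cancel h3, h1, h2]⟩
      _ = _ := by rw [pow_succ']

lemma one_add_pow_three_le (s : Set ℕ) :
    (1 + (s.encard : ℝ≥0∞)) ^ 3 ≤
      6 * ∑' m : ℕ, ((m + 2).choose 2 : ℝ≥0∞) * if (m : ℝ≥0∞) ≤ s.encard then 1 else 0 := by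
  rcases eq_or_ne s.encard ⊤ with h | h
  · have : ∑' m : ℕ, ((m + 2).choose 2 : ℝ≥0∞) * (if (m : ℝ≥0∞) ≤ s.encard then 1 else 0) = ⊤ := by
      rw [← top_le_iff, ← ENNReal.tsum_const_eq_top_of_ne_zero (α := ℕ) (one_ne_zero (α := ℝ≥0∞))]
      refine ENNReal.tsum_le_tsum fun m => ?_
      simp only [h, ENat.toENNReal_top, le_top, if_true, mul_one]
      exact_mod_cast Nat.choose_pos (by omega)
    rw [this]; simp
  · obtain ⟨N, hN⟩ := ENat.ne_top_iff_exists.1 h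
    rw [← hN]
    simp only [ENat.toENNReal_coe, Nat.cast_le]
    calc (1 + (N : ℝ≥0∞)) ^ 3 ≤ 6 * ((N + 3).choose 3 : ℝ≥0∞) := by
          have h6 := Nat.descFactorial_eq_factorial_mul_choose (N + 3) 3
          simp only [Nat.descFactorial, Nat.factorial] at h6
          norm_num at h6
          have : (1 + N) ^ 3 ≤ 6 * (N + 3).choose 3 := by
            rw [← h6, show N + 3 - 2 = N + 1 by omega]
            ring_nf; nlinarith
          exact_mod_cast this
      _ = 6 * ∑ m ∈ Finset.range (N + 1), ((m + 2).choose 2 : ℝ≥0∞) *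
            (if m ≤ N then 1 else 0) := by
          rw [← Nat.sum_range_add_choose N 2]
          push_cast
          congr 1
          refine Finset.sum_congr rfl fun m hm => ?_
          rw [if_pos (Nat.lt_succ_iff.1 (Finset.mem_range.1 hm)), mul_one]
      _ ≤ _ := by gcongr; exact ENNReal.sum_le_tsum _

lemma returns_eq_encard {b : ℕ} (v : Vertex b) (X : ℕ → Vertex b) :
    returns v X = ({n | X (n + 1) = v} : Set ℕ).encard := by
  rw [← ENNReal.tsum_set_one, tsum_subtype (s := {n | X (n + 1) = v}) (fun _ => (1 : ℝ≥0∞))]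
  rfl

lemma tsum_choose_two_mul_pow {γ : ℝ} (h0 : 0 < γ) (h1 : γ ≤ 1) :
    ∑' m : ℕ, ((m + 2).choose 2 : ℝ≥0∞) * ENNReal.ofReal (1 - γ) ^ m =
      (ENNReal.ofReal γ)⁻¹ ^ 3 := by
  have hr : ‖1 - γ‖ < 1 := by rw [Real.norm_eq_abs, abs_lt]; constructor <;> linarith
  have e := tsum_choose_mul_geometric_of_norm_lt_one 2 hr
  have hs := (hasSum_choose_mul_geometric_of_norm_lt_one 2 hr).summable
  have : ∀ m : ℕ, ((m + 2).choose 2 : ℝ≥0∞) * ENNReal.ofReal (1 - γ) ^ m =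
      ENNReal.ofReal (((m + 2).choose 2 : ℝ) * (1 - γ) ^ m) := fun m => by
    rw [ENNReal.ofReal_mul (by positivity), ENNReal.ofReal_pow (by linarith),
      ENNReal.ofReal_natCast]
  simp_rw [this]
  rw [← ENNReal.ofReal_tsum_of_nonneg _ hs, e, ← ENNReal.ofReal_inv_of_pos h0,
    ← ENNReal.ofReal_pow (by positivity)]
  · congr 1
    rw [sub_sub_cancel]; field_simp
  · intro m
    have : 0 ≤ 1 - γ := by linarith
    positivity

/-- The number of visits to the starting vertex is dominated by a geometric variable. -/
lemma lintegral_visits_pow_three_le {b : ℕ} (ω : Env b) (w : List (Fin b)) :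
    ∫⁻ X, visits (.node w) X ^ 3 ∂(quenchedLaw (.node w) ω) ≤
      6 * (ENNReal.ofReal (neverBack (shiftEnv w ω)))⁻¹ ^ 3 := by
  rcases (neverBack_nonneg (shiftEnv w ω)).eq_or_lt with h0 | h0
  · simp [← h0]
  · calc _ ≤ ∫⁻ X, 6 * ∑' m : ℕ, ((m + 2).choose 2 : ℝ≥0∞) *
            ({X | (m : ℝ≥0∞) ≤ returns (.node w) X}.indicator 1 X)
            ∂(quenchedLaw (.node w) ω) := by
          refine lintegral_mono_ae ?_
          filter_upwards [quenchedLaw_start_ae (.node w) ω] with X hX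
          rw [visits_eq _ _ hX]
          simp only [Set.indicator, Set.mem_ofPred_eq, Pi.one_apply, returns_eq_encard]
          exact one_add_pow_three_le _
      _ = 6 * ∑' m : ℕ, ((m + 2).choose 2 : ℝ≥0∞) *
            quenchedLaw (.node w) ω {X | (m : ℝ≥0∞) ≤ returns (.node w) X} := by
          have hm : ∀ m : ℕ, MeasurableSet {X : ℕ → Vertex b |
              (m : ℝ≥0∞) ≤ returns (.node w) X} := fun m =>
            measurableSet_le measurable_const (measurable_returns _)
          have hm' : ∀ m : ℕ, Measurable fun X => ((m + 2).choose 2 : ℝ≥0∞) *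
              ({X | (m : ℝ≥0∞) ≤ returns (.node w) X}.indicator 1 X) := fun m =>
            (measurable_one.indicator (hm m)).const_mul _
          rw [lintegral_const_mul _ (.tsum hm'), lintegral_tsum fun m => (hm' m).aemeasurable]
          congr 1
          refine tsum_congr fun m => ?_
          rw [lintegral_const_mul _ (measurable_one.indicator (hm m)), lintegral_indicator_one (hm m)]
      _ ≤ 6 * ∑' m : ℕ, ((m + 2).choose 2 : ℝ≥0∞) *
            ENNReal.ofReal (1 - neverBack (shiftEnv w ω)) ^ m := by
          gcongr with m
          exact quenchedLaw_returns_ge_le ω w m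
      _ = _ := by rw [tsum_choose_two_mul_pow h0 (neverBack_le_one _)]

/-! ### Transience: the tilted law of the log-weights -/

/-- The intensity of the point process `∑ᵢ δ_{log Aᵢ}`, restricted to `[-L, L]`. -/
noncomputable def logIntensity {b : ℕ} (μ : Measure (Weights b)) (L : ℝ) : Measure ℝ :=
  (Measure.sum fun i => μ.map fun a => Real.log (a i)).restrict (Set.Icc (-L) L)

lemma measurable_log_weight {b : ℕ} (i : Fin b) :
    Measurable fun a : Weights b => Real.log (a i) :=
  Real.measurable_log.comp (by fun_prop)

lemma lintegral_logIntensity {b : ℕ} (μ : Measure (Weights b)) (L : ℝ) {f : ℝ → ℝ≥0∞}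
    (hf : Measurable f) :
    ∫⁻ z, f z ∂(logIntensity μ L) =
      ∑ i, ∫⁻ a, (if |Real.log (a i)| ≤ L then f (Real.log (a i)) else 0) ∂μ := by
  rw [logIntensity, ← lintegral_indicator measurableSet_Icc, lintegral_sum_measure,
    tsum_fintype]
  refine Finset.sum_congr rfl fun i _ => ?_
  rw [lintegral_map (hf.indicator measurableSet_Icc) (measurable_log_weight i)]
  refine lintegral_congr fun a => ?_
  simp only [Set.indicator, Set.mem_Icc, abs_le]

instance {b : ℕ} (μ : Measure (Weights b)) [IsProbabilityMeasure μ] (L : ℝ) :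
    IsFiniteMeasure (logIntensity μ L) := by
  have : IsFiniteMeasure (Measure.sum fun i => μ.map fun a => Real.log (a i)) := by
    constructor
    rw [Measure.sum_apply _ .univ, tsum_fintype]
    exact ENNReal.sum_lt_top.2 fun i _ => by
      rw [Measure.map_apply (measurable_log_weight i) .univ]; exact measure_lt_top _ _
  unfold logIntensity; infer_instance

lemma logIntensity_univ_le {b : ℕ} (μ : Measure (Weights b)) [IsProbabilityMeasure μ] (L : ℝ) :
    (logIntensity μ L).real Set.univ ≤ b := by
  refine ENNReal.toReal_le_of_le_ofReal (by positivity) ?_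
  rw [ENNReal.ofReal_natCast, ← lintegral_one, lintegral_logIntensity μ L (f := fun _ => 1) measurable_const]
  refine (Finset.sum_le_sum (g := fun _ => (1 : ℝ≥0∞)) fun i _ => ?_).trans (by simp)
  refine (lintegral_mono (g := fun _ => (1 : ℝ≥0∞)) fun a => ?_).trans (by simp)
  split_ifs <;> simp

lemma ae_logIntensity {b : ℕ} (μ : Measure (Weights b)) (L : ℝ) :
    ∀ᵐ z ∂(logIntensity μ L), |z| ≤ L := by
  filter_upwards [ae_restrict_mem measurableSet_Icc] with z hz
  exact abs_le.2 hz

/-- Continuous functions are integrable against a finite measure on a bounded interval. -/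
lemma integrable_of_bounded_support {π : Measure ℝ} [IsFiniteMeasure π] {L : ℝ}
    (hL : ∀ᵐ z ∂π, |z| ≤ L) {f : ℝ → ℝ} (hf : Continuous f) : Integrable f π := by
  obtain ⟨C, hC⟩ := (isCompact_Icc (a := -L) (b := L)).exists_bound_of_continuousOn hf.continuousOn
  refine Integrable.of_bound hf.aestronglyMeasurable C ?_
  filter_upwards [hL] with z hz
  exact hC z (abs_le.1 hz)

lemma integrableExpSet_of_bounded_support {π : Measure ℝ} [IsFiniteMeasure π] {L : ℝ}
    (hL : ∀ᵐ z ∂π, |z| ≤ L) : integrableExpSet id π = Set.univ :=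
  Set.eq_univ_of_forall fun t => integrable_of_bounded_support hL (by fun_prop)

/-- If all exponential moments with exponent in `[0, 1]` exceed `1`, the exponent with the least
moment gives a tilted law whose mean `m` satisfies `t m = min m 0`. -/
lemma exists_tilt {π : Measure ℝ} [IsFiniteMeasure π] {L : ℝ} (hL : ∀ᵐ z ∂π, |z| ≤ L)
    (h1 : ∀ t ∈ Set.Icc (0 : ℝ) 1, 1 < ∫ z, Real.exp (t * z) ∂π) :
    ∃ t m lam : ℝ, 0 ≤ t ∧ t * m ≤ min m 0 ∧ 1 < lam ∧
      ∫ z, Real.exp (t * z) ∂π = lam ∧ ∫ z, z * Real.exp (t * z) ∂π = lam * m := by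
  have hint : ∀ t, t ∈ interior (integrableExpSet id π) := fun t => by
    rw [integrableExpSet_of_bounded_support hL]; simp
  have hcont : Continuous (mgf id π) :=
    continuous_mgf fun t => integrable_of_bounded_support hL (by fun_prop)
  obtain ⟨t, ht, hmin⟩ := (isCompact_Icc (a := (0 : ℝ)) (b := 1)).exists_isMinOn
    ⟨0, by simp⟩ hcont.continuousOn
  have hd : HasDerivAt (mgf id π) (∫ z, z * Real.exp (t * z) ∂π) t := hasDerivAt_mgf (hint t)
  set M := ∫ z, z * Real.exp (t * z) ∂π with hM
  set lam := ∫ z, Real.exp (t * z) ∂π with hlam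
  have hl1 : 1 < lam := h1 t ht
  have hsl := hasDerivAt_iff_tendsto_slope.1 hd
  have hright : t < 1 → 0 ≤ M := fun h => by
    refine ge_of_tendsto (hsl.mono_left (nhdsWithin_mono t (s := Set.Ioi t) ?_)) ?_
    · exact fun s hs => ne_of_gt hs
    · filter_upwards [Ioo_mem_nhdsGT h] with s hs
      rw [slope_def_field]
      exact div_nonneg (sub_nonneg.2 (hmin ⟨ht.1.trans hs.1.le, hs.2.le⟩)) (sub_nonneg.2 hs.1.le)
  have hleft : 0 < t → M ≤ 0 := fun h => by
    refine le_of_tendsto (hsl.mono_left (nhdsWithin_mono t (s := Set.Iio t) ?_)) ?_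
    · exact fun s hs => ne_of_lt hs
    · filter_upwards [Ioo_mem_nhdsLT h] with s hs
      rw [slope_def_field]
      exact div_nonpos_of_nonneg_of_nonpos (sub_nonneg.2 (hmin ⟨hs.1.le, hs.2.le.trans ht.2⟩))
        (sub_nonpos.2 hs.2.le)
  refine ⟨t, M / lam, lam, ht.1, ?_, hl1, rfl,
    (mul_div_cancel₀ M (by linarith)).symm⟩
  rcases lt_trichotomy M 0 with h | h | h
  · have : t = 1 := le_antisymm ht.2 (not_lt.1 fun h' => absurd (hright h') (not_le.2 h))
    have hm : M / lam < 0 := div_neg_of_neg_of_pos h (by linarith)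
    simp [this, hm.le]
  · simp [h]
  · have : t = 0 := le_antisymm (not_lt.1 fun h' => absurd (hleft h') (not_le.2 h)) ht.1
    have hm : 0 < M / lam := div_pos h (by linarith)
    simp [this, hm.le]

/-- Truncation of the log-weights preserves the moment condition, by compactness of `[0, 1]`. -/
lemma exists_logIntensity {b : ℕ} (μ : Measure (Weights b)) [IsProbabilityMeasure μ]
    (hA : ∀ t ∈ Set.Icc (0 : ℝ) 1, 1 < ∑ i, ∫⁻ a, ENNReal.ofReal ((a i : ℝ) ^ t) ∂μ) :
    ∃ L : ℝ, 0 ≤ L ∧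
      ∀ t ∈ Set.Icc (0 : ℝ) 1, 1 < ∫ z, Real.exp (t * z) ∂(logIntensity μ L) := by
  have hval : ∀ (n : ℕ) (t : ℝ), ENNReal.ofReal (∫ z, Real.exp (t * z) ∂(logIntensity μ n)) =
      ∑ i, ∫⁻ a, (if |Real.log (a i)| ≤ n then ENNReal.ofReal ((a i : ℝ) ^ t) else 0) ∂μ := by
    intro n t
    rw [ofReal_integral_eq_lintegral_ofReal
      (integrable_of_bounded_support (ae_logIntensity μ n) (by fun_prop))
      (.of_forall fun _ => (Real.exp_pos _).le), lintegral_logIntensity μ n (by fun_prop)]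
    refine Finset.sum_congr rfl fun i _ => lintegral_congr fun a => ?_
    rw [mul_comm t, ← Real.rpow_def_of_pos (a i).2]
  have hmono : Monotone fun (n : ℕ) => {t : ℝ | 1 < ∫ z, Real.exp (t * z) ∂(logIntensity μ n)} := by
    intro n k hnk t ht
    simp only [Set.mem_ofPred_eq] at ht ⊢
    refine ht.trans_le ?_
    refine (ENNReal.ofReal_le_ofReal_iff (integral_nonneg fun _ => (Real.exp_pos _).le)).1 ?_
    rw [hval, hval]
    refine Finset.sum_le_sum fun i _ => lintegral_mono fun a => ?_
    have : (n : ℝ) ≤ k := by exact_mod_cast hnk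
    split_ifs with h h'
    · exact le_rfl
    · exact absurd (h.trans this) h'
    · exact zero_le
    · exact le_rfl
  have hcont : ∀ n : ℕ, Continuous fun t => ∫ z, Real.exp (t * z) ∂(logIntensity μ n) := fun n =>
    continuous_mgf (X := id) fun t =>
      integrable_of_bounded_support (ae_logIntensity μ n) (by fun_prop)
  have hcov : Set.Icc (0 : ℝ) 1 ⊆
      ⋃ n : ℕ, {t : ℝ | 1 < ∫ z, Real.exp (t * z) ∂(logIntensity μ n)} := by
    intro t ht
    by_contra hno
    simp only [Set.mem_iUnion, Set.mem_ofPred_eq, not_exists, not_lt] at hno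
    refine absurd (hA t ht) (not_lt.2 ?_)
    have hm : ∀ i (n : ℕ), Measurable fun a : Weights b =>
        (if |Real.log (a i)| ≤ n then ENNReal.ofReal ((a i : ℝ) ^ t) else 0) := fun i n =>
      Measurable.ite (measurableSet_le (measurable_log_weight i).abs measurable_const)
        (by fun_prop) measurable_const
    have hmon : ∀ i, Monotone fun (n : ℕ) (a : Weights b) =>
        (if |Real.log (a i)| ≤ n then ENNReal.ofReal ((a i : ℝ) ^ t) else 0) := by
      intro i n k hnk a
      have : (n : ℝ) ≤ k := by exact_mod_cast hnk
      dsimp only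
      split_ifs with h h'
      · exact le_rfl
      · exact absurd (h.trans this) h'
      · exact zero_le
      · exact le_rfl
    have hsup : ∀ i (a : Weights b), ⨆ n : ℕ,
        (if |Real.log (a i)| ≤ n then ENNReal.ofReal ((a i : ℝ) ^ t) else 0) =
          ENNReal.ofReal ((a i : ℝ) ^ t) := by
      intro i a
      refine le_antisymm (iSup_le fun n => by split_ifs <;> simp) ?_
      obtain ⟨n, hn⟩ := exists_nat_ge |Real.log (a i)|
      exact le_iSup_of_le n (by rw [if_pos hn])
    have : ∀ i, ∫⁻ a, ENNReal.ofReal ((a i : ℝ) ^ t) ∂μ = ⨆ n : ℕ, ∫⁻ a,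
        (if |Real.log (a i)| ≤ n then ENNReal.ofReal ((a i : ℝ) ^ t) else 0) ∂μ := fun i => by
      rw [← lintegral_iSup (hm i) (hmon i)]
      exact lintegral_congr fun a => (hsup i a).symm
    simp_rw [this]
    rw [ENNReal.finsetSum_iSup_of_monotone fun i n k hnk => lintegral_mono (hmon i hnk)]
    refine iSup_le fun n => ?_
    rw [← hval]
    exact ENNReal.ofReal_le_one.2 (hno n)
  obtain ⟨n, hn⟩ := (isCompact_Icc (a := (0 : ℝ)) (b := 1)).elim_directed_cover
    (fun n : ℕ => {t : ℝ | 1 < ∫ z, Real.exp (t * z) ∂(logIntensity μ n)})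
    (fun n => isOpen_lt continuous_const (hcont n)) hcov (directed_of_isDirected_le hmono)
  exact ⟨n, by positivity, fun t ht => hn ht⟩

/-! ### Transience: a lower bound by a branching process -/

/-- Children with untypical weights contribute `0`; the others contribute `f` of the environment
they see, at log-conductance increased by the log-weight. -/
noncomputable def goodChild {b : ℕ} (L : ℝ) (f : Env b → ℝ → ℝ) (y : ℝ) (a : Weights b) (i : Fin b)
    (ω : Env b) : ℝ :=
  if |Real.log (a i)| ≤ L then f ω (y + Real.log (a i)) else 0

/-- The conditional probability that some vertex at depth `j` succeeds, when such a vertex, seen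
from the environment `ω`, succeeds independently of the others with probability `exp c * g ω`,
provided that the log-weights on the path to it are at most `L` in absolute value and that their
sum, added to `y`, is at least `c`. -/
noncomputable def someSuccess {b : ℕ} (L c : ℝ) (g : Env b → ℝ) : ℕ → Env b → ℝ → ℝ
  | 0, ω, y => if c ≤ y then Real.exp c * g ω else 0
  | j + 1, ω, y => 1 - ∏ i, (1 - goodChild L (someSuccess L c g j) y (ω []) i (shiftEnv [i] ω))

lemma one_sub_prod_le_sum {ι : Type*} (s : Finset ι) (x : ι → ℝ) (h0 : ∀ i, 0 ≤ x i)
    (h1 : ∀ i, x i ≤ 1) : 1 - ∏ i ∈ s, (1 - x i) ≤ ∑ i ∈ s, x i := by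
  classical
  induction s using Finset.induction_on with
  | empty => simp
  | insert i s hi ih =>
    rw [Finset.prod_insert hi, Finset.sum_insert hi]
    have hp : ∏ j ∈ s, (1 - x j) ≤ 1 :=
      Finset.prod_le_one (fun j _ => by linarith [h1 j]) fun j _ => by linarith [h0 j]
    have := mul_le_mul_of_nonneg_left hp (h0 i)
    linarith

lemma prod_one_sub_le {ι : Type*} (s : Finset ι) (x : ι → ℝ) (h0 : ∀ i, 0 ≤ x i)
    (h1 : ∀ i, x i ≤ 1) :
    ∏ i ∈ s, (1 - x i) ≤ 1 - ∑ i ∈ s, x i + (∑ i ∈ s, x i) ^ 2 := by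
  set S := ∑ i ∈ s, x i with hS
  have hS0 : 0 ≤ S := Finset.sum_nonneg fun i _ => h0 i
  calc ∏ i ∈ s, (1 - x i) ≤ ∏ i ∈ s, Real.exp (-x i) :=
        Finset.prod_le_prod (fun i _ => by linarith [h1 i])
          fun i _ => Real.one_sub_le_exp_neg (x i)
    _ = Real.exp (-S) := by rw [← Real.exp_sum, Finset.sum_neg_distrib]
    _ ≤ 1 / (1 + S) := by
        rw [Real.exp_neg, ← one_div]
        exact one_div_le_one_div_of_le (by linarith) (by linarith [Real.add_one_le_exp S])
    _ ≤ 1 - S + S ^ 2 := by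
        rw [div_le_iff₀ (by linarith)]
        nlinarith [pow_nonneg hS0 3]

lemma min_sum_le_sum_min {ι : Type*} (s : Finset ι) (x : ι → ℝ) (h0 : ∀ i, 0 ≤ x i) {a : ℝ}
    (ha : 0 ≤ a) : min a (∑ i ∈ s, x i) ≤ ∑ i ∈ s, min a (x i) := by
  classical
  induction s using Finset.induction_on with
  | empty => simp [ha]
  | insert i s hi ih =>
    rw [Finset.sum_insert hi, Finset.sum_insert hi]
    have hs : 0 ≤ ∑ j ∈ s, min a (x j) := Finset.sum_nonneg fun j _ => le_min ha (h0 j)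
    rcases le_total a (x i) with h | h
    · rw [min_eq_left h]
      exact (min_le_left _ _).trans (by linarith)
    · rw [min_eq_right h]
      refine le_trans ?_ (add_le_add le_rfl ih)
      rw [← min_add_add_left]
      exact min_le_min (by linarith [h0 i]) le_rfl

section
variable {b : ℕ} {L c : ℝ} {g : Env b → ℝ}

lemma goodChild_mem {f : Env b → ℝ → ℝ} {C : ℝ} (hC : 0 ≤ C) (hf : ∀ ω y, f ω y ∈ Set.Icc 0 C)
    (y : ℝ) (a : Weights b) (i : Fin b) (ω : Env b) : goodChild L f y a i ω ∈ Set.Icc 0 C := by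
  unfold goodChild
  split_ifs
  · exact hf _ _
  · exact ⟨le_rfl, hC⟩

lemma someSuccess_mem (hc : c ≤ 0) (hg : ∀ ω, g ω ∈ Set.Icc 0 1) (j : ℕ) (ω : Env b) (y : ℝ) :
    someSuccess L c g j ω y ∈ Set.Icc 0 1 := by
  induction j generalizing ω y with
  | zero =>
    simp only [someSuccess]
    split_ifs
    · exact ⟨mul_nonneg (Real.exp_pos _).le (hg ω).1,
        mul_le_one₀ (Real.exp_le_one_iff.2 hc) (hg ω).1 (hg ω).2⟩
    · simp
  | succ j ih =>
    have hm := fun i => goodChild_mem (L := L) zero_le_one ih y (ω []) i (shiftEnv [i] ω)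
    simp only [someSuccess]
    have h1 := Finset.prod_le_one (s := Finset.univ)
      (fun i _ => sub_nonneg.2 (hm i).2) fun i _ => sub_le_self _ (hm i).1
    have h2 := Finset.prod_nonneg (s := Finset.univ) (fun i _ => sub_nonneg.2 (hm i).2)
    exact ⟨by linarith, by linarith⟩

lemma measurable_goodChild {f : Env b → ℝ → ℝ} (hf : Measurable (Function.uncurry f))
    (i : Fin b) :
    Measurable fun p : (Weights b × Env b) × ℝ => goodChild L f p.2 p.1.1 i p.1.2 := by
  unfold goodChild
  have hl : Measurable fun p : (Weights b × Env b) × ℝ => Real.log (p.1.1 i) :=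
    (measurable_log_weight i).comp (measurable_fst.comp measurable_fst)
  refine Measurable.ite (measurableSet_le hl.abs measurable_const) ?_ measurable_const
  exact hf.comp ((measurable_snd.comp measurable_fst).prodMk (measurable_snd.add hl))

lemma measurable_someSuccess (hg : Measurable g) (j : ℕ) :
    Measurable (Function.uncurry (someSuccess L c g j)) := by
  induction j with
  | zero =>
    simp only [Function.uncurry_def, someSuccess]
    exact Measurable.ite (measurableSet_le measurable_const measurable_snd)
      ((hg.comp measurable_fst).const_mul _) measurable_const
  | succ j ih =>
    simp only [Function.uncurry_def, someSuccess]
    refine Measurable.const_sub (Finset.measurable_prod _ fun i _ => Measurable.const_sub ?_ _) _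
    have hr : Measurable fun ω : Env b => ω [] := measurable_pi_apply _
    exact (measurable_goodChild ih i).comp
      (((hr.comp measurable_fst).prodMk ((measurable_shiftEnv [i]).comp measurable_fst)).prodMk
        measurable_snd)

lemma measurable_someSuccess_left (hg : Measurable g) (j : ℕ) (y : ℝ) :
    Measurable fun ω => someSuccess L c g j ω y := by
  have := (measurable_someSuccess (L := L) (c := c) hg j).comp
    (measurable_id.prodMk (measurable_const (a := y)))
  exact this

/-- The escape probability is bounded below by the success probability, up to constants. -/
lemma min_someSuccess_le_esc (hc : c ≤ 0) (hL : 0 ≤ L) {η δ : ℝ} (hη : 0 < η) (hδ : 0 < δ) (k : ℕ)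
    (j : ℕ) (ω : Env b) (y : ℝ) :
    ((1 + η) ^ j)⁻¹ * min (Real.exp y * η * Real.exp (-L * j))
      (δ * someSuccess L c (fun ω => min (esc k ω) δ / δ) j ω y) ≤
      Real.exp y * esc (j + k) ω := by
  set g : Env b → ℝ := fun ω => min (esc k ω) δ / δ with hg
  have hg01 : ∀ ω, g ω ∈ Set.Icc 0 1 := fun ω =>
    ⟨div_nonneg (le_min (esc_nonneg k ω) hδ.le) hδ.le, (div_le_one hδ).2 (min_le_right _ _)⟩
  induction j generalizing ω y with
  | zero =>
    simp only [pow_zero, inv_one, one_mul, zero_add, someSuccess]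
    refine (min_le_right _ _).trans ?_
    split_ifs with h
    · have e : δ * (Real.exp c * g ω) = Real.exp c * min (esc k ω) δ := by
        simp only [hg]; field_simp
      rw [e]
      exact mul_le_mul (Real.exp_le_exp.2 h) (min_le_left _ _)
        (le_min (esc_nonneg k ω) hδ.le) (Real.exp_pos _).le
    · rw [mul_zero]
      exact mul_nonneg (Real.exp_pos _).le (esc_nonneg _ _)
  | succ j ih =>
    set x : Fin b → ℝ := fun i =>
      goodChild L (someSuccess L c g j) y (ω []) i (shiftEnv [i] ω) with hx
    have hx01 : ∀ i, x i ∈ Set.Icc 0 1 := fun i =>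
      goodChild_mem zero_le_one (someSuccess_mem hc hg01 j) y _ i _
    set K := Real.exp y * η * Real.exp (-L * (j + 1)) with hK
    have hK0 : 0 < K := by positivity
    set z := childSum (esc (j + k)) ω with hz
    have hz0 : 0 ≤ z := childSum_nonneg (esc_nonneg _) ω
    have hpow : 0 < ((1 + η) ^ j)⁻¹ := by positivity
    -- the contribution of one child
    have hchild : ∀ i, ((1 + η) ^ j)⁻¹ * min K (δ * x i) ≤
        Real.exp y * ((ω [] i : ℝ) * esc (j + k) (shiftEnv [i] ω)) := by
      intro i
      simp only [hx, goodChild]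
      split_ifs with h
      · have hi := ih (shiftEnv [i] ω) (y + Real.log (ω [] i))
        rw [Real.exp_add, Real.exp_log (ω [] i).2, mul_assoc (Real.exp y) (ω [] i : ℝ)] at hi
        refine le_trans ?_ (hi.trans_eq (by ring))
        refine mul_le_mul_of_nonneg_left (min_le_min ?_ le_rfl) hpow.le
        have hA : Real.exp (-L) ≤ (ω [] i : ℝ) := by
          rw [← Real.exp_log (ω [] i).2]
          exact Real.exp_le_exp.2 (abs_le.1 h).1
        have : K = Real.exp y * η * Real.exp (-L * j) * Real.exp (-L) := by
          rw [hK, mul_assoc, mul_assoc, mul_assoc, ← Real.exp_add, mul_add, mul_one]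
        rw [this]
        have := mul_le_mul_of_nonneg_left hA (a := Real.exp y * η * Real.exp (-L * j))
          (by positivity)
        linarith
      · rw [mul_zero, min_eq_right hK0.le, mul_zero]
        exact mul_nonneg (Real.exp_pos _).le (mul_nonneg (ω [] i).2.le (esc_nonneg _ _))
    have hsum : ((1 + η) ^ j)⁻¹ * min K (δ * someSuccess L c g (j + 1) ω y) ≤ Real.exp y * z := by
      have e : Real.exp y * z =
          ∑ i, Real.exp y * ((ω [] i : ℝ) * esc (j + k) (shiftEnv [i] ω)) := by
        rw [hz, childSum, Finset.mul_sum]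
      rw [e]
      refine le_trans ?_ (Finset.sum_le_sum fun i _ => hchild i)
      rw [← Finset.mul_sum]
      refine mul_le_mul_of_nonneg_left (le_trans (min_le_min le_rfl ?_)
        (min_sum_le_sum_min _ _ (fun i => mul_nonneg hδ.le (hx01 i).1) hK0.le)) hpow.le
      rw [← Finset.mul_sum]
      exact mul_le_mul_of_nonneg_left (one_sub_prod_le_sum _ _ (fun i => (hx01 i).1)
        fun i => (hx01 i).2) hδ.le
    have hesc : min z η / (1 + η) ≤ esc (j + 1 + k) ω := by
      rw [show j + 1 + k = (j + k) + 1 by ring, esc, ← hz]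
      rcases le_total z η with h | h
      · rw [min_eq_left h]
        exact div_le_div_of_nonneg_left hz0 (by linarith) (by linarith)
      · rw [min_eq_right h]
        exact div_one_add_mono hη.le h
    refine le_trans ?_ (mul_le_mul_of_nonneg_left hesc (Real.exp_pos y).le)
    rw [← mul_div_assoc, mul_min_of_nonneg _ _ (Real.exp_pos y).le, le_div_iff₀ (by linarith),
      pow_succ, mul_inv, Nat.cast_add, Nat.cast_one]
    have e1 : ((1 + η) ^ j)⁻¹ * (1 + η)⁻¹ * min K (δ * someSuccess L c g (j + 1) ω y) * (1 + η) =
        ((1 + η) ^ j)⁻¹ * min K (δ * someSuccess L c g (j + 1) ω y) := by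
      field_simp
    rw [e1]
    refine le_min hsum ?_
    have h1 : ((1 + η) ^ j)⁻¹ ≤ 1 := inv_le_one_of_one_le₀ (one_le_pow₀ (by linarith))
    have h2 : K ≤ Real.exp y * η := by
      rw [hK]
      refine mul_le_of_le_one_right (by positivity) (Real.exp_le_one_iff.2 ?_)
      have : 0 ≤ L * (j + 1) := by positivity
      linarith
    calc _ ≤ 1 * min K (δ * someSuccess L c g (j + 1) ω y) := by
          refine mul_le_mul_of_nonneg_right h1 (le_min hK0.le ?_)
          exact mul_nonneg hδ.le (someSuccess_mem hc hg01 _ _ _).1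
      _ ≤ K := by rw [one_mul]; exact min_le_left _ _
      _ ≤ _ := h2

lemma integrable_of_mem_Icc {α : Type*} [MeasurableSpace α] {m : Measure α} [IsFiniteMeasure m]
    {f : α → ℝ} (hf : Measurable f) {C : ℝ} (h : ∀ x, f x ∈ Set.Icc 0 C) : Integrable f m :=
  .of_bound hf.aestronglyMeasurable C (.of_forall fun x => by
    rw [Real.norm_of_nonneg (h x).1]; exact (h x).2)

variable (μ : Measure (Weights b))

/-- The probability of success at depth `j` in a random environment. -/
noncomputable def successProb (L c : ℝ) (g : Env b → ℝ) (j : ℕ) (y : ℝ) : ℝ :=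
  ∫ ω, someSuccess L c g j ω y ∂(envLaw μ)

lemma successProb_nonneg (hc : c ≤ 0) (hg01 : ∀ ω, g ω ∈ Set.Icc 0 1) (j : ℕ) (y : ℝ) :
    0 ≤ successProb μ L c g j y :=
  integral_nonneg fun ω => (someSuccess_mem hc hg01 j ω y).1

variable [IsProbabilityMeasure μ]

lemma measurable_successProb (hg : Measurable g) (j : ℕ) :
    Measurable (successProb μ L c g j) :=
  ((measurable_someSuccess hg j).stronglyMeasurable.integral_prod_left').measurable

lemma successProb_le_one (hc : c ≤ 0) (hg : Measurable g) (hg01 : ∀ ω, g ω ∈ Set.Icc 0 1) (j : ℕ)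
    (y : ℝ) : successProb μ L c g j y ≤ 1 := by
  have hm : Measurable fun ω => someSuccess L c g j ω y := measurable_someSuccess_left hg j y
  have := integral_mono (integrable_of_mem_Icc hm fun ω => someSuccess_mem hc hg01 j ω y)
    (integrable_const (1 : ℝ)) (fun ω => (someSuccess_mem (L := L) hc hg01 j ω y).2)
    (μ := envLaw μ)
  simpa [successProb] using this

lemma integral_goodChild (hc : c ≤ 0) (hg : Measurable g) (hg01 : ∀ ω, g ω ∈ Set.Icc 0 1) (j : ℕ)
    (y : ℝ) (a : Weights b) (i : Fin b) :
    ∫⁻ ω, ENNReal.ofReal (1 - goodChild L (someSuccess L c g j) y a i ω) ∂(envLaw μ) =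
      ENNReal.ofReal (1 - if |Real.log (a i)| ≤ L
        then successProb μ L c g j (y + Real.log (a i)) else 0) := by
  unfold goodChild
  split_ifs with h
  · have hm : Measurable fun ω => someSuccess L c g j ω (y + Real.log (a i)) :=
      (measurable_someSuccess hg j).comp (measurable_id.prodMk measurable_const)
    have hi : Integrable (fun ω => someSuccess L c g j ω (y + Real.log (a i))) (envLaw μ) :=
      integrable_of_mem_Icc hm fun ω => someSuccess_mem hc hg01 j ω _
    have hi1 : Integrable (fun ω => 1 - someSuccess L c g j ω (y + Real.log (a i))) (envLaw μ) :=
      (integrable_const 1).sub hi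
    rw [← ofReal_integral_eq_lintegral_ofReal hi1
      (.of_forall fun ω => sub_nonneg.2 (someSuccess_mem hc hg01 j ω _).2),
      integral_sub (integrable_const 1) hi]
    simp [successProb]
  · simp

/-- The recursion for the success probabilities. -/
lemma successProb_succ (hc : c ≤ 0) (hg : Measurable g) (hg01 : ∀ ω, g ω ∈ Set.Icc 0 1) (j : ℕ)
    (y : ℝ) :
    successProb μ L c g (j + 1) y =
      1 - ∫ a, ∏ i, (1 - if |Real.log (a i)| ≤ L
        then successProb μ L c g j (y + Real.log (a i)) else 0) ∂μ := by
  have hgc01 : ∀ (a : Weights b) i ω,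
      goodChild L (someSuccess L c g j) y a i ω ∈ Set.Icc 0 1 := fun a i ω =>
    goodChild_mem zero_le_one (someSuccess_mem hc hg01 j) y a i ω
  have hH := measurable_successProb (L := L) (c := c) μ hg j
  have hmH : ∀ i, Measurable fun a : Weights b => if |Real.log (a i)| ≤ L
      then successProb μ L c g j (y + Real.log (a i)) else 0 := fun i =>
    Measurable.ite (measurableSet_le (measurable_log_weight i).abs measurable_const)
      (hH.comp ((measurable_log_weight i).const_add y)) measurable_const
  have hH01 : ∀ (a : Weights b) i, (if |Real.log (a i)| ≤ L
      then successProb μ L c g j (y + Real.log (a i)) else 0) ∈ Set.Icc (0 : ℝ) 1 := fun a i => by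
    split_ifs
    · exact ⟨successProb_nonneg μ hc hg01 j _, successProb_le_one μ hc hg hg01 j _⟩
    · simp
  have hprod := lintegral_envLaw_prod μ
    (h := fun i a ω => ENNReal.ofReal (1 - goodChild L (someSuccess L c g j) y a i ω))
    (fun i => ENNReal.measurable_ofReal.comp (((measurable_goodChild (L := L)
      (measurable_someSuccess (L := L) (c := c) hg j) i).comp
        (measurable_id.prodMk measurable_const)).const_sub 1))
    Finset.univ (k := fun _ => 1) measurable_const
  simp only [one_mul, integral_goodChild μ hc hg hg01] at hprod
  have hm : Measurable fun ω => someSuccess L c g (j + 1) ω y :=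
    measurable_someSuccess_left hg (j + 1) y
  have hi : Integrable (fun ω => someSuccess L c g (j + 1) ω y) (envLaw μ) :=
    integrable_of_mem_Icc hm fun ω => someSuccess_mem hc hg01 _ ω _
  have e1 : ∫ ω, (1 - someSuccess L c g (j + 1) ω y) ∂(envLaw μ) =
      1 - successProb μ L c g (j + 1) y := by
    rw [integral_sub (integrable_const 1) hi]; simp [successProb]
  have e2 : ∫ ω, (1 - someSuccess L c g (j + 1) ω y) ∂(envLaw μ) =
      ∫ a, ∏ i, (1 - if |Real.log (a i)| ≤ L
        then successProb μ L c g j (y + Real.log (a i)) else 0) ∂μ := by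
    rw [integral_eq_lintegral_of_nonneg_ae
      (.of_forall fun ω => sub_nonneg.2 (someSuccess_mem hc hg01 _ ω _).2)
      (hm.const_sub 1).aestronglyMeasurable, integral_eq_lintegral_of_nonneg_ae
      (.of_forall fun a => Finset.prod_nonneg fun i _ => sub_nonneg.2 (hH01 a i).2)
      (Finset.measurable_prod _ fun i _ => (hmH i).const_sub 1).aestronglyMeasurable]
    congr 1
    simp only [someSuccess, sub_sub_cancel]
    simp_rw [ENNReal.ofReal_prod_of_nonneg
      (fun i (_ : i ∈ Finset.univ) => sub_nonneg.2 (hgc01 _ i _).2),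
      ENNReal.ofReal_prod_of_nonneg (fun i (_ : i ∈ Finset.univ) => sub_nonneg.2 (hH01 _ i).2)]
    exact hprod
  linarith [e1.symm.trans e2]

lemma integral_logIntensity {f : ℝ → ℝ} (hf : Measurable f) (h0 : ∀ y, 0 ≤ f y) {C : ℝ}
    (hC : ∀ y, f y ≤ C) :
    ∫ z, f z ∂(logIntensity μ L) =
      ∫ a, ∑ i, (if |Real.log (a i)| ≤ L then f (Real.log (a i)) else 0) ∂μ := by
  have hC0 : 0 ≤ C := (h0 0).trans (hC 0)
  have hm : ∀ i, Measurable fun a : Weights b =>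
      if |Real.log (a i)| ≤ L then f (Real.log (a i)) else 0 := fun i =>
    Measurable.ite (measurableSet_le (measurable_log_weight i).abs measurable_const)
      (hf.comp (measurable_log_weight i)) measurable_const
  have h01 : ∀ (a : Weights b) i,
      (if |Real.log (a i)| ≤ L then f (Real.log (a i)) else 0) ∈ Set.Icc (0 : ℝ) C := by
    intro a i
    split_ifs
    · exact ⟨h0 _, hC _⟩
    · exact ⟨le_rfl, hC0⟩
  rw [integral_finsetSum _ fun i _ => integrable_of_mem_Icc (hm i) fun a => h01 a i,
    integral_eq_lintegral_of_nonneg_ae (.of_forall h0) hf.aestronglyMeasurable,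
    lintegral_logIntensity μ L hf.ennreal_ofReal, ENNReal.toReal_sum]
  · refine Finset.sum_congr rfl fun i _ => ?_
    rw [integral_eq_lintegral_of_nonneg_ae (.of_forall fun a => (h01 a i).1)
      (hm i).aestronglyMeasurable]
    congr 1
    refine lintegral_congr fun a => ?_
    split_ifs <;> simp
  · intro i _
    refine ne_of_lt (lt_of_le_of_lt (lintegral_mono (g := fun _ => ENNReal.ofReal C) fun a => ?_)
      (by simp))
    split_ifs
    · exact ENNReal.ofReal_le_ofReal (hC _)
    · exact zero_le

lemma successProb_bounds (hc : c ≤ 0) (hg : Measurable g) (hg01 : ∀ ω, g ω ∈ Set.Icc 0 1) (j : ℕ)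
    {K : ℝ} (hK : ∀ y, successProb μ L c g j y ≤ K) (y : ℝ) :
    successProb μ L c g (j + 1) y ≤ b * K ∧
    ∫ z, successProb μ L c g j (y + z) ∂(logIntensity μ L) - (b * K) ^ 2 ≤
      successProb μ L c g (j + 1) y := by
  have hK0 : 0 ≤ K := (successProb_nonneg μ hc hg01 j 0).trans (hK 0)
  have hH := measurable_successProb (L := L) (c := c) μ hg j
  set p : Weights b → Fin b → ℝ := fun a i => if |Real.log (a i)| ≤ L
      then successProb μ L c g j (y + Real.log (a i)) else 0 with hp
  have hmp : ∀ i, Measurable fun a => p a i := fun i =>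
    Measurable.ite (measurableSet_le (measurable_log_weight i).abs measurable_const)
      (hH.comp ((measurable_log_weight i).const_add y)) measurable_const
  have hp0 : ∀ a i, 0 ≤ p a i := fun a i => by
    simp only [hp]; split_ifs
    · exact successProb_nonneg μ hc hg01 j _
    · exact le_rfl
  have hp1 : ∀ a i, p a i ≤ 1 := fun a i => by
    simp only [hp]; split_ifs
    · exact successProb_le_one μ hc hg hg01 j _
    · exact zero_le_one
  have hpK : ∀ a i, p a i ≤ K := fun a i => by
    simp only [hp]; split_ifs
    · exact hK _
    · exact hK0
  have hsK : ∀ a, ∑ i, p a i ≤ b * K := fun a =>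
    (Finset.sum_le_sum fun i _ => hpK a i).trans (by simp)
  have hs0 : ∀ a, 0 ≤ ∑ i, p a i := fun a => Finset.sum_nonneg fun i _ => hp0 a i
  have hms : Measurable fun a => ∑ i, p a i := Finset.measurable_sum _ fun i _ => hmp i
  have his : Integrable (fun a => ∑ i, p a i) μ :=
    integrable_of_mem_Icc hms fun a => ⟨hs0 a, hsK a⟩
  have hmP : Measurable fun a => ∏ i, (1 - p a i) :=
    Finset.measurable_prod _ fun i _ => (hmp i).const_sub 1
  have hiP : Integrable (fun a => ∏ i, (1 - p a i)) μ :=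
    integrable_of_mem_Icc hmP (C := 1) fun a =>
      ⟨Finset.prod_nonneg fun i _ => sub_nonneg.2 (hp1 a i),
        Finset.prod_le_one (fun i _ => sub_nonneg.2 (hp1 a i)) fun i _ => by linarith [hp0 a i]⟩
  have hE : ∫ z, successProb μ L c g j (y + z) ∂(logIntensity μ L) = ∫ a, ∑ i, p a i ∂μ :=
    integral_logIntensity μ (f := fun z => successProb μ L c g j (y + z))
      (hH.comp (measurable_id.const_add y)) (fun z => successProb_nonneg μ hc hg01 j _)
      (fun z => hK _)
  have hrec := successProb_succ (L := L) μ hc hg hg01 j y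
  change _ = 1 - ∫ a, ∏ i, (1 - p a i) ∂μ at hrec
  rw [hrec, hE]
  constructor
  · have h := integral_mono (μ := μ) ((integrable_const (1 : ℝ)).sub (integrable_const (b * K))) hiP
      (fun a => by
        have := one_sub_prod_le_sum Finset.univ (p a) (hp0 a) (hp1 a)
        have := hsK a
        simp only [Pi.sub_apply]
        linarith)
    simp only [Pi.sub_apply, integral_const, probReal_univ, one_smul] at h
    linarith
  · have h := integral_mono (μ := μ) hiP
      (((integrable_const (1 : ℝ)).sub his).add (integrable_const ((b * K) ^ 2)))
      (fun a => by
        have h1 := prod_one_sub_le Finset.univ (p a) (hp0 a) (hp1 a)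
        have h2 := pow_le_pow_left₀ (hs0 a) (hsK a) 2
        simp only [Pi.sub_apply, Pi.add_apply]
        linarith)
    simp only [Pi.add_apply, Pi.sub_apply] at h
    have his' : Integrable (fun a => 1 - ∑ i, p a i) μ := (integrable_const 1).sub his
    rw [integral_add his' (integrable_const _), integral_sub (integrable_const _) his] at h
    simp only [integral_const, probReal_univ, one_smul] at h
    linarith

end

/-! ### Transience: positivity of the escape probability -/

/-- The quadratic test functions that the tilted random walk maps to each other. -/
lemma integral_tilted_quadratic {π : Measure ℝ} [IsFiniteMeasure π] {L : ℝ}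
    (hL : ∀ᵐ z ∂π, |z| ≤ L) {t m lam s : ℝ} (h0 : ∫ z, Real.exp (t * z) ∂π = lam)
    (h1 : ∫ z, z * Real.exp (t * z) ∂π = lam * m)
    (h2 : ∫ z, z ^ 2 * Real.exp (t * z) ∂π = lam * (s + m ^ 2)) (α κ a y : ℝ) :
    ∫ z, Real.exp (t * (y + z)) * (α - κ * (y + z - a) ^ 2) ∂π =
      lam * Real.exp (t * y) * ((α - κ * s) - κ * (y - (a - m)) ^ 2) := by
  have e : ∀ z, Real.exp (t * (y + z)) * (α - κ * (y + z - a) ^ 2) =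
      Real.exp (t * y) * (α - κ * (y - a) ^ 2) * Real.exp (t * z) +
      (Real.exp (t * y) * (-2 * κ * (y - a)) * (z * Real.exp (t * z)) +
      Real.exp (t * y) * (-κ) * (z ^ 2 * Real.exp (t * z))) := by
    intro z
    rw [mul_add, Real.exp_add]; ring
  simp_rw [e]
  have i0 : Integrable (fun z => Real.exp (t * y) * (α - κ * (y - a) ^ 2) * Real.exp (t * z)) π :=
    integrable_of_bounded_support hL (by fun_prop)
  have i1 : Integrable (fun z => Real.exp (t * y) * (-2 * κ * (y - a)) * (z * Real.exp (t * z))) π :=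
    integrable_of_bounded_support hL (by fun_prop)
  have i2 : Integrable (fun z => Real.exp (t * y) * (-κ) * (z ^ 2 * Real.exp (t * z))) π :=
    integrable_of_bounded_support hL (by fun_prop)
  have i12 : Integrable (fun z => Real.exp (t * y) * (-2 * κ * (y - a)) * (z * Real.exp (t * z)) +
      Real.exp (t * y) * (-κ) * (z ^ 2 * Real.exp (t * z))) π := i1.add i2
  rw [integral_add i0 i12, integral_add i1 i2, integral_const_mul, integral_const_mul,
    integral_const_mul, h0, h1, h2]
  ring

/-- The success probability of some generation dominates a multiple larger than one of the success
probability of a single vertex, up to a quadratic error. -/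
lemma exists_successProb_ge {b : ℕ} (μ : Measure (Weights b)) [IsProbabilityMeasure μ]
    (hA : ∀ t ∈ Set.Icc (0 : ℝ) 1, 1 < ∑ i, ∫⁻ a, ENNReal.ofReal ((a i : ℝ) ^ t) ∂μ) :
    ∃ (n : ℕ) (L c θ B : ℝ), 0 ≤ L ∧ c ≤ 0 ∧ 1 < θ ∧ 0 ≤ B ∧
      ∀ g : Env b → ℝ, Measurable g → (∀ ω, g ω ∈ Set.Icc 0 1) →
        θ * (∫ ω, g ω ∂(envLaw μ)) - B * (∫ ω, g ω ∂(envLaw μ)) ^ 2 ≤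
          successProb μ L c g n 0 := by
  obtain ⟨L, hL0, hL1⟩ := exists_logIntensity μ hA
  have hLae := ae_logIntensity μ L
  obtain ⟨t, m, lam, ht0, htm, hlam, h0, h1⟩ := exists_tilt hLae hL1
  set π := logIntensity μ L with hπ
  have hlam0 : 0 < lam := by linarith
  obtain ⟨s, h2⟩ : ∃ s : ℝ, ∫ z, z ^ 2 * Real.exp (t * z) ∂π = lam * (s + m ^ 2) :=
    ⟨(∫ z, z ^ 2 * Real.exp (t * z) ∂π) / lam - m ^ 2,
      by rw [sub_add_cancel, mul_div_cancel₀ _ hlam0.ne']⟩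
  -- a window of width `2 δ n` around the mean `n m` of the tilted walk, with `δ` small compared to
  -- the exponential growth rate `log lam`
  have hlog : 0 < Real.log lam := Real.log_pos hlam
  set δ := Real.log lam / (2 * (1 + t)) / 2 with hδ
  have hδ0 : 0 < δ := by positivity
  obtain ⟨n, hn⟩ := exists_nat_gt (max 1 (max (2 * s / δ ^ 2) (2 * Real.log 2 / Real.log lam)))
  have hn1 : 1 < (n : ℝ) := (le_max_left _ _).trans_lt hn
  have hn2 : 2 * s / δ ^ 2 < n := ((le_max_left _ _).trans (le_max_right _ _)).trans_lt hn
  have hn3 : 2 * Real.log 2 / Real.log lam < n :=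
    ((le_max_right _ _).trans (le_max_right _ _)).trans_lt hn
  have hn0 : 0 < (n : ℝ) := by linarith
  set c := min 0 (n * (m - δ)) with hc
  have hc0 : c ≤ 0 := min_le_left _ _
  set κ := 1 / (δ * n) ^ 2 with hκ
  have hκ0 : 0 < κ := by positivity
  set D := Real.exp c * Real.exp (-(t * (n * (m + δ)))) with hD
  have hD0 : 0 < D := by positivity
  -- the induction over generations
  have key : ∀ j : ℕ, ∃ B : ℝ, 0 ≤ B ∧ ∀ g : Env b → ℝ, Measurable g →
      (∀ ω, g ω ∈ Set.Icc 0 1) → ∀ y,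
        successProb μ L c g j y ≤ b ^ j * ∫ ω, g ω ∂(envLaw μ) ∧
        (∫ ω, g ω ∂(envLaw μ)) * (D * lam ^ j) * Real.exp (t * y) *
          ((1 - j * (κ * s)) - κ * (y - (n * m - j * m)) ^ 2) -
          B * (∫ ω, g ω ∂(envLaw μ)) ^ 2 ≤ successProb μ L c g j y := by
    intro j
    induction j with
    | zero =>
      refine ⟨0, le_rfl, fun g hg hg01 y => ?_⟩
      have he0 : 0 ≤ ∫ ω, g ω ∂(envLaw μ) := integral_nonneg fun ω => (hg01 ω).1
      set e := ∫ ω, g ω ∂(envLaw μ) with he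
      have hH : successProb μ L c g 0 y = if c ≤ y then Real.exp c * e else 0 := by
        simp only [successProb, someSuccess]
        split_ifs with h
        · rw [integral_const_mul]
        · simp
      rw [hH]
      constructor
      · split_ifs
        · have := mul_le_mul_of_nonneg_right (Real.exp_le_one_iff.2 hc0) he0
          simpa using this
        · simpa using he0
      · simp only [pow_zero, mul_one, Nat.cast_zero, zero_mul, sub_zero]
        by_cases hw : (y - n * m) ^ 2 ≤ (δ * n) ^ 2
        · have hab := abs_le.1 (sq_le_sq.1 hw |>.trans_eq (abs_of_pos (by positivity)))
          have hcy : c ≤ y := (min_le_right _ _).trans (by rw [mul_sub]; linarith [hab.1])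
          rw [if_pos hcy]
          have h3 : Real.exp (t * y) ≤ Real.exp (t * (n * (m + δ))) := by
            refine Real.exp_le_exp.2 (mul_le_mul_of_nonneg_left ?_ ht0)
            rw [mul_add]; linarith [hab.2]
          have h4 : 1 - κ * (y - n * m) ^ 2 ≤ 1 := by
            have : 0 ≤ κ * (y - n * m) ^ 2 := by positivity
            linarith
          have hD' : D * Real.exp (t * (n * (m + δ))) = Real.exp c := by
            rw [hD, mul_assoc, ← Real.exp_add]; simp
          calc e * D * Real.exp (t * y) * (1 - κ * (y - n * m) ^ 2)
              ≤ e * D * Real.exp (t * y) * 1 := by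
                refine mul_le_mul_of_nonneg_left h4 (by positivity)
            _ ≤ e * D * Real.exp (t * (n * (m + δ))) := by
                rw [mul_one]; exact mul_le_mul_of_nonneg_left h3 (by positivity)
            _ = Real.exp c * e := by rw [mul_assoc, hD']; ring
        · have h4 : 1 - κ * (y - n * m) ^ 2 ≤ 0 := by
            have : 1 ≤ κ * (y - n * m) ^ 2 := by
              rw [hκ, one_div, inv_mul_eq_div, le_div_iff₀ (by positivity)]
              linarith [not_le.1 hw]
            linarith
          refine le_trans (mul_nonpos_of_nonneg_of_nonpos (by positivity) h4) ?_
          split_ifs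
          · positivity
          · exact le_rfl
    | succ j ih =>
      obtain ⟨B, hB0, ih⟩ := ih
      refine ⟨b * B + (b * b ^ j) ^ 2, by positivity, fun g hg hg01 y => ?_⟩
      have ih := ih g hg hg01
      set e := ∫ ω, g ω ∂(envLaw μ) with he
      have hb := successProb_bounds (L := L) μ hc0 hg hg01 j (fun y => (ih y).1) y
      refine ⟨hb.1.trans_eq (by ring), le_trans ?_ hb.2⟩
      have hint : ∫ z, (e * (D * lam ^ j) * (Real.exp (t * (y + z)) *
          ((1 - j * (κ * s)) - κ * (y + z - (n * m - j * m)) ^ 2)) - B * e ^ 2) ∂π ≤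
          ∫ z, successProb μ L c g j (y + z) ∂π := by
        refine integral_mono (integrable_of_bounded_support hLae (by fun_prop)) ?_ fun z => ?_
        · exact integrable_of_mem_Icc ((measurable_successProb μ hg j).comp
            (measurable_id.const_add y)) (C := b ^ j * e)
            fun z => ⟨successProb_nonneg μ hc0 hg01 j _, (ih _).1⟩
        · have := (ih (y + z)).2
          simp only at this ⊢
          linarith
      rw [integral_sub (integrable_of_bounded_support hLae (by fun_prop)) (integrable_const _),
        integral_const_mul, integral_tilted_quadratic hLae h0 h1 h2, integral_const,
        smul_eq_mul] at hint
      have hu := mul_le_mul_of_nonneg_right (logIntensity_univ_le μ L)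
        (show 0 ≤ B * e ^ 2 by positivity)
      have e1 : e * (D * lam ^ (j + 1)) * Real.exp (t * y) *
          ((1 - ((j + 1 : ℕ) : ℝ) * (κ * s)) - κ * (y - (n * m - ((j + 1 : ℕ) : ℝ) * m)) ^ 2) =
          e * (D * lam ^ j) * (lam * Real.exp (t * y) *
            ((1 - j * (κ * s) - κ * s) - κ * (y - (n * m - j * m - m)) ^ 2)) := by
        push_cast; ring
      have e2 : (b * B + (b * b ^ j) ^ 2) * e ^ 2 = b * (B * e ^ 2) + (b * (b ^ j * e)) ^ 2 := by
        ring
      rw [e1, e2]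
      linarith [hint, hu]
  obtain ⟨B, hB0, hB⟩ := key n
  refine ⟨n, L, c, D * lam ^ n / 2, B, hL0, hc0, ?_, hB0, fun g hg hg01 => ?_⟩
  · -- `D lam ^ n ≥ exp (- δ n (1 + t)) lam ^ n = lam ^ (3 n / 4)`
    have hlp : lam ^ n = Real.exp (n * Real.log lam) := by
      rw [Real.exp_nat_mul, Real.exp_log hlam0]
    rw [lt_div_iff₀ (by norm_num), one_mul, hD, hlp, ← Real.exp_add, ← Real.exp_add,
      ← Real.log_lt_iff_lt_exp (by norm_num)]
    have h3 : 2 * Real.log 2 < n * Real.log lam := by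
      rwa [div_lt_iff₀ hlog] at hn3
    have h4 : n * min m 0 - n * δ ≤ c := by
      refine le_min ?_ ?_
      · have := mul_nonpos_of_nonneg_of_nonpos hn0.le (min_le_right m 0)
        linarith [mul_pos hn0 hδ0]
      · have := mul_le_mul_of_nonneg_left (min_le_left m 0) hn0.le
        rw [mul_sub]
        linarith
    have h5 : n * (t * m) ≤ n * min m 0 := mul_le_mul_of_nonneg_left htm hn0.le
    have h6 : δ * (1 + t) = Real.log lam / 4 := by
      rw [hδ]; field_simp; norm_num
    have h7 : n * (δ * (1 + t)) = n * (Real.log lam / 4) := by rw [h6]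
    have h8 : t * (n * (m + δ)) = n * (t * m) + n * (δ * (1 + t)) - n * δ := by ring
    have h9 := Real.log_pos (one_lt_two)
    rw [h8]
    linarith
  · have h := (hB g hg hg01 0).2
    have he0 : 0 ≤ ∫ ω, g ω ∂(envLaw μ) := integral_nonneg fun ω => (hg01 ω).1
    refine le_trans ?_ h
    simp only [mul_zero, Real.exp_zero, mul_one, sub_self, ne_eq, OfNat.ofNat_ne_zero,
      not_false_eq_true, zero_pow, sub_zero]
    have h8 : (1 : ℝ) / 2 ≤ 1 - n * (κ * s) := by
      have : n * (κ * s) = (2 * s / δ ^ 2) / n / 2 := by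
        rw [hκ]; field_simp
      have h9 : (2 * s / δ ^ 2) / n ≤ 1 := (div_le_one hn0).2 hn2.le
      linarith
    have h10 : 0 ≤ (∫ ω, g ω ∂(envLaw μ)) * (D * lam ^ n) := by positivity
    have := mul_le_mul_of_nonneg_left h8 h10
    linarith

/-- Transience: the walk escapes with positive probability. -/
lemma not_ae_escLim_eq_zero {b : ℕ} (hb : 0 < b) (μ : Measure (Weights b)) [IsProbabilityMeasure μ]
    (hA : ∀ t ∈ Set.Icc (0 : ℝ) 1, 1 < ∑ i, ∫⁻ a, ENNReal.ofReal ((a i : ℝ) ^ t) ∂μ) :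
    ¬ ∀ᵐ ω ∂(envLaw μ), escLim ω = 0 := by
  intro hzero
  obtain ⟨n, L, c, θ, B, hL, hc, hθ, hB, key⟩ := exists_successProb_ge μ hA
  obtain ⟨η, hη, hηθ⟩ : ∃ η : ℝ, 0 < η ∧ (1 + η) ^ n < θ := by
    have hcont : Filter.Tendsto (fun η : ℝ => (1 + η) ^ n) (nhdsWithin 0 (Set.Ioi 0)) (nhds 1) := by
      have : ContinuousAt (fun η : ℝ => (1 + η) ^ n) 0 := by fun_prop
      have h := this.tendsto.mono_left (nhdsWithin_le_nhds (s := Set.Ioi 0))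
      simpa using h
    obtain ⟨η, h1, h2⟩ := ((hcont.eventually_lt_const hθ).and self_mem_nhdsWithin).exists
    exact ⟨η, h2, h1⟩
  set δ := η * Real.exp (-L * n) with hδ
  have hδ0 : 0 < δ := by positivity
  set g : ℕ → Env b → ℝ := fun k ω => min (esc k ω) δ / δ with hg
  have hgm : ∀ k, Measurable (g k) := fun k =>
    ((measurable_esc k).min measurable_const).div_const δ
  have hg01 : ∀ k ω, g k ω ∈ Set.Icc 0 1 := fun k ω =>
    ⟨div_nonneg (le_min (esc_nonneg k ω) hδ0.le) hδ0.le, (div_le_one hδ0).2 (min_le_right _ _)⟩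
  have hgi : ∀ k, Integrable (g k) (envLaw μ) := fun k => integrable_of_mem_Icc (hgm k) (hg01 k)
  set e : ℕ → ℝ := fun k => ∫ ω, g k ω ∂(envLaw μ) with he
  have hpow : 0 < (1 + η) ^ n := by positivity
  -- comparison of the escape probabilities of the levels `n + k` and `k`
  have hstep : ∀ k, θ * e k - B * e k ^ 2 ≤ (1 + η) ^ n * e (n + k) := by
    intro k
    refine (key (g k) (hgm k) (hg01 k)).trans ?_
    rw [he, ← integral_const_mul]
    refine integral_mono (integrable_of_mem_Icc (measurable_someSuccess_left (hgm k) n 0)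
      fun ω => someSuccess_mem hc (hg01 k) n ω 0) ((hgi _).const_mul _) fun ω => ?_
    have h := min_someSuccess_le_esc hc hL hη hδ0 k n ω 0
    have h01 := someSuccess_mem (L := L) hc (hg01 k) n ω 0
    simp only [Real.exp_zero, one_mul] at h
    rw [← hδ, min_eq_right (mul_le_of_le_one_right hδ0.le h01.2)] at h
    have h' : δ * someSuccess L c (g k) n ω 0 ≤ (1 + η) ^ n * esc (n + k) ω := by
      rwa [inv_mul_le_iff₀ hpow] at h
    have h'' : δ * someSuccess L c (g k) n ω 0 ≤ (1 + η) ^ n * δ := by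
      calc _ ≤ δ * 1 := mul_le_mul_of_nonneg_left h01.2 hδ0.le
        _ ≤ (1 + η) ^ n * δ := by
          rw [mul_one]; exact le_mul_of_one_le_left hδ0.le (one_le_pow₀ (by linarith))
    simp only [hg]
    rw [← mul_div_assoc, le_div_iff₀ hδ0, mul_min_of_nonneg _ _ hpow.le, mul_comm]
    exact le_min h' h''
  have hpos : ∀ k, 0 < e k := by
    intro k
    have hp : ∀ ω, 0 < g k ω := fun ω => div_pos (lt_min (esc_pos hb k ω) hδ0) hδ0
    refine (integral_pos_iff_support_of_nonneg (fun ω => (hp ω).le) (hgi k)).2 ?_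
    have : Function.support (g k) = Set.univ := Set.eq_univ_of_forall fun ω => (hp ω).ne'
    simp [this]
  have hanti : ∀ k, e (n + k) ≤ e k := fun k =>
    integral_mono (hgi _) (hgi _) fun ω =>
      div_le_div_of_nonneg_right (min_le_min (antitone_esc ω (by omega)) le_rfl) hδ0.le
  have hlim : Filter.Tendsto e Filter.atTop (nhds 0) := by
    have : Filter.Tendsto e Filter.atTop (nhds (∫ _, (0 : ℝ) ∂(envLaw μ))) := by
      refine tendsto_integral_of_dominated_convergence (fun _ => 1)
        (fun k => (hgm k).aestronglyMeasurable) (integrable_const _) (fun k => .of_forall fun ω => ?_)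
        ?_
      · rw [Real.norm_of_nonneg (hg01 k ω).1]; exact (hg01 k ω).2
      · filter_upwards [hzero] with ω hω
        have h1 := tendsto_esc ω
        rw [hω] at h1
        have h2 := (h1.min (tendsto_const_nhds (x := δ))).div_const δ
        simpa [min_eq_left hδ0.le] using h2
    simpa using this
  have hlim' : Filter.Tendsto (fun k => B * e k) Filter.atTop (nhds 0) := by
    simpa using hlim.const_mul B
  obtain ⟨k, hk⟩ := (hlim'.eventually_lt_const (sub_pos.2 hηθ)).exists
  have h1 := hstep k
  have h2 := mul_le_mul_of_nonneg_left (hanti k) hpow.le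
  nlinarith [hpos k]

lemma childSum_eq_zero_iff {b : ℕ} (ω : Env b) :
    childSum escLim ω = 0 ↔ ∀ i, escLim (shiftEnv [i] ω) = 0 := by
  rw [childSum, Finset.sum_eq_zero_iff_of_nonneg fun i _ =>
    mul_nonneg (ω [] i).2.le (escLim_nonneg _)]
  have : ∀ i, (ω [] i : ℝ) ≠ 0 := fun i => ne_of_gt (ω [] i).2
  simp [this]

lemma escLim_eq_zero_iff {b : ℕ} (ω : Env b) :
    escLim ω = 0 ↔ ∀ i, escLim (shiftEnv [i] ω) = 0 := by
  rw [← childSum_eq_zero_iff]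
  have h0 := childSum_nonneg escLim_nonneg ω
  constructor
  · intro h
    rw [escLim_eq, div_eq_zero_iff] at h
    rcases h with h | h
    · exact h
    · linarith
  · intro h
    rw [escLim_eq, h]; simp

/-- The zero-one law for transience: the escape probability is almost surely positive. -/
lemma ae_escLim_pos {b : ℕ} (hb : 2 ≤ b) (μ : Measure (Weights b)) [IsProbabilityMeasure μ]
    (hA : ∀ t ∈ Set.Icc (0 : ℝ) 1, 1 < ∑ i, ∫⁻ a, ENNReal.ofReal ((a i : ℝ) ^ t) ∂μ) :
    ∀ᵐ ω ∂(envLaw μ), 0 < escLim ω := by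
  have hms : MeasurableSet {ω : Env b | escLim ω = 0} :=
    measurable_escLim (measurableSet_singleton 0)
  have hind : Measurable ({ω : Env b | escLim ω = 0}.indicator (1 : Env b → ℝ≥0∞)) :=
    measurable_one.indicator hms
  have h := lintegral_envLaw_prod μ
    (h := fun _ _ => {ω : Env b | escLim ω = 0}.indicator (1 : Env b → ℝ≥0∞))
    (fun _ => hind.comp measurable_snd) Finset.univ (k := fun _ => 1) measurable_const
  simp only [one_mul, lintegral_indicator_one hms, Finset.prod_const, Finset.card_univ,
    Fintype.card_fin, lintegral_const, measure_univ, mul_one] at h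
  have e : ∀ ω : Env b, ∏ i, {ω : Env b | escLim ω = 0}.indicator (1 : Env b → ℝ≥0∞)
      (shiftEnv [i] ω) = {ω : Env b | escLim ω = 0}.indicator 1 ω := by
    intro ω
    by_cases hω : escLim ω = 0
    · have h' := (escLim_eq_zero_iff ω).1 hω
      simp [Set.indicator, hω, h']
    · have h' := mt (escLim_eq_zero_iff ω).2 hω
      push Not at h'
      obtain ⟨i, hi⟩ := h'
      rw [Set.indicator_of_notMem (by simpa using hω)]
      exact Finset.prod_eq_zero (Finset.mem_univ i) (by simp [hi])
  simp only [e, lintegral_indicator_one hms] at h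
  set q := envLaw μ {ω : Env b | escLim ω = 0} with hq
  have hq1 : q < 1 := by
    refine lt_of_le_of_ne prob_le_one fun h1 => not_ae_escLim_eq_zero (by omega) μ hA ?_
    exact (prob_compl_eq_zero_iff hms).2 h1
  have hq0 : q = 0 := by
    by_contra hne
    have h2 : q ^ b < q := by
      calc q ^ b ≤ q ^ 2 := pow_le_pow_right_of_le_one' hq1.le hb
        _ = q * q := sq q
        _ < q * 1 := ENNReal.mul_lt_mul_right hne (hq1.trans ENNReal.one_lt_top).ne hq1
        _ = q := mul_one q
    exact absurd h h2.ne'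
  filter_upwards [measure_eq_zero_iff_ae_notMem.1 hq0] with ω hω
  exact lt_of_le_of_ne (escLim_nonneg ω) (Ne.symm hω)

/-! ### Inverse moments of the escape probabilities -/

/-- `1 / β`. -/
noncomputable def invEsc {b : ℕ} (ω : Env b) : ℝ≥0∞ := (ENNReal.ofReal (escLim ω))⁻¹

@[fun_prop]
lemma measurable_invEsc {b : ℕ} : Measurable (invEsc : Env b → ℝ≥0∞) :=
  measurable_escLim.ennreal_ofReal.inv

lemma invEsc_eq {b : ℕ} (ω : Env b) :
    invEsc ω = 1 + (ENNReal.ofReal (childSum escLim ω))⁻¹ := by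
  have h0 := childSum_nonneg escLim_nonneg ω
  rw [invEsc, escLim_eq]
  rcases h0.eq_or_lt with h | h
  · simp [← h]
  · rw [← ENNReal.ofReal_inv_of_pos (by positivity), ← ENNReal.ofReal_inv_of_pos h,
      ← ENNReal.ofReal_one, ← ENNReal.ofReal_add zero_le_one (by positivity)]
    congr 1
    field_simp
    ring

lemma inv_childSum_le {b : ℕ} (ω : Env b) (i : Fin b) :
    (ENNReal.ofReal (childSum escLim ω))⁻¹ ≤
      (ENNReal.ofReal (ω [] i))⁻¹ * invEsc (shiftEnv [i] ω) := by
  rw [invEsc, ← ENNReal.mul_inv (Or.inr (by simp)) (Or.inl (by simp)),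
    ← ENNReal.ofReal_mul (ω [] i).2.le]
  refine ENNReal.inv_le_inv' (ENNReal.ofReal_le_ofReal ?_)
  exact Finset.single_le_sum (f := fun i => (ω [] i : ℝ) * escLim (shiftEnv [i] ω))
    (fun j _ => mul_nonneg (ω [] j).2.le (escLim_nonneg _)) (Finset.mem_univ i)

lemma exists_totalWeight_le {b : ℕ} (hb : 0 < b) (a : Weights b) :
    ∃ i, totalWeight a ≤ b * (a i : ℝ) := by
  by_contra! h
  have : Nonempty (Fin b) := ⟨⟨0, hb⟩⟩
  have h2 := Finset.sum_lt_sum_of_nonempty Finset.univ_nonempty fun i (_ : i ∈ Finset.univ) => h i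
  rw [← Finset.mul_sum, Finset.sum_const, Finset.card_univ, Fintype.card_fin, nsmul_eq_mul] at h2
  exact lt_irrefl _ h2

lemma totalWeight_pos {b : ℕ} (hb : 0 < b) (a : Weights b) : 0 < totalWeight a := by
  have : Nonempty (Fin b) := ⟨⟨0, hb⟩⟩
  exact Finset.sum_pos (fun i _ => (a i).2) Finset.univ_nonempty

/-- The `q`-th power of `1 / min(Aᵢ, 1)` if `Aᵢ` is at least the average weight, and `0`
otherwise. -/
noncomputable def invBigWeight {b : ℕ} (q : ℝ) (i : Fin b) (a : Weights b) : ℝ≥0∞ :=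
  if totalWeight a ≤ b * (a i : ℝ) then (ENNReal.ofReal (min (a i : ℝ) 1))⁻¹ ^ q else 0

lemma measurable_invBigWeight {b : ℕ} (q : ℝ) (i : Fin b) :
    Measurable (invBigWeight q i) := by
  unfold invBigWeight
  refine Measurable.ite (measurableSet_le measurable_totalWeight (by fun_prop)) (by fun_prop)
    measurable_const

lemma invBigWeight_le {b : ℕ} (hb : 0 < b) {q : ℝ} (hq : 0 ≤ q) (i : Fin b) (a : Weights b) :
    invBigWeight q i a ≤ 1 + (b : ℝ≥0∞) ^ q * ENNReal.ofReal (totalWeight a ^ (-q)) := by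
  have hS := totalWeight_pos hb a
  unfold invBigWeight
  split_ifs with h
  · rcases le_total 1 (a i : ℝ) with h1 | h1
    · rw [min_eq_right h1]; simp
    · rw [min_eq_left h1]
      refine le_trans ?_ le_add_self
      have hb' : (0 : ℝ) < b := by exact_mod_cast hb
      rw [Real.rpow_neg hS.le, ← Real.inv_rpow hS.le,
        ← ENNReal.ofReal_rpow_of_nonneg (inv_nonneg.2 hS.le) hq, ← ENNReal.mul_rpow_of_nonneg _ _ hq,
        ← ENNReal.ofReal_natCast, ← ENNReal.ofReal_mul hb'.le,
        ← ENNReal.ofReal_inv_of_pos (a i).2]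
      refine ENNReal.rpow_le_rpow (ENNReal.ofReal_le_ofReal ?_) hq
      rw [← div_eq_mul_inv, inv_le_comm₀ (a i).2 (by positivity), inv_div, div_le_iff₀ hb']
      linarith
  · exact zero_le

lemma lintegral_shiftEnv {b : ℕ} (μ : Measure (Weights b)) [IsProbabilityMeasure μ]
    (w : List (Fin b)) {g : Env b → ℝ≥0∞} (hg : Measurable g) :
    ∫⁻ ω, g (shiftEnv w ω) ∂(envLaw μ) = ∫⁻ ω, g ω ∂(envLaw μ) := by
  simpa using lintegral_envLaw_mul_shiftEnv μ w (F := fun _ => 1) measurable_const hg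
    fun _ _ _ => rfl

lemma exists_ne_map {b : ℕ} (hb : 2 ≤ b) : ∃ σ : Fin b → Fin b, ∀ i, i ≠ σ i := by
  refine ⟨fun i => if i = ⟨0, by omega⟩ then ⟨1, by omega⟩ else ⟨0, by omega⟩, fun i => ?_⟩
  dsimp only
  split_ifs with h
  · rw [h]; simp
  · exact h

/-- The inverse escape probability has as many moments as the inverse total weight. A large value
of `1 / β` forces a child with large weight to have a large `1 / β` as well, and in addition some
other child either to have a tiny weight or to have a large `1 / β`; the additional requirement
has small probability, so that the (truncated) moment can be absorbed. -/
lemma lintegral_invEsc_rpow_lt_top {b : ℕ} (hb : 2 ≤ b) (μ : Measure (Weights b))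
    [IsProbabilityMeasure μ] (hpos : ∀ᵐ ω ∂(envLaw μ), 0 < escLim ω) {q : ℝ} (hq : 1 ≤ q)
    (hS : ∫⁻ a, ENNReal.ofReal (totalWeight a ^ (-q)) ∂μ < ∞) :
    ∫⁻ ω, invEsc ω ^ q ∂(envLaw μ) < ∞ := by
  have hb0 : 0 < b := by omega
  have hq0 : 0 ≤ q := by linarith
  obtain ⟨σ, hσ⟩ := exists_ne_map hb
  set k : Fin b → Weights b → ℝ≥0∞ := invBigWeight q with hk
  have hkm : ∀ i, Measurable (k i) := measurable_invBigWeight q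
  have hkfin : ∀ i, ∫⁻ a, k i a ∂μ < ∞ := by
    intro i
    refine (lintegral_mono (invBigWeight_le hb0 hq0 i)).trans_lt ?_
    rw [lintegral_add_left measurable_const, lintegral_const_mul' _ _
      (ENNReal.rpow_ne_top_of_nonneg hq0 (ENNReal.natCast_ne_top b))]
    simpa using ENNReal.mul_lt_top
      (ENNReal.rpow_lt_top_of_nonneg hq0 (ENNReal.natCast_ne_top b)) hS
  -- the additional requirement on the child `σ i`
  set bad : ℕ → Fin b → Set (Weights b × Env b) := fun n i =>
    {p | (p.1 (σ i) : ℝ) < 1 / (n + 1) ∨ (n : ℝ≥0∞) < invEsc p.2} with hbad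
  have hbadm : ∀ n i, MeasurableSet (bad n i) := fun n i => by
    have h1 : Measurable fun p : Weights b × Env b => (p.1 (σ i) : ℝ) := by fun_prop
    exact MeasurableSet.union (measurableSet_lt h1 measurable_const)
      (measurableSet_lt measurable_const (measurable_invEsc.comp measurable_snd))
  set ind : ℕ → Fin b → Weights b → Env b → ℝ≥0∞ := fun n i a ω =>
    (bad n i).indicator 1 (a, ω) with hind
  have hindm : ∀ n i, Measurable (Function.uncurry (ind n i)) := fun n i =>
    measurable_one.indicator (hbadm n i)
  set κ : ℕ → Fin b → ℝ≥0∞ := fun n i => ∫⁻ a, k i a * ∫⁻ ω, ind n i a ω ∂(envLaw μ) ∂μ with hκ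
  have hκlim : ∀ i, Filter.Tendsto (fun n => κ n i) Filter.atTop (nhds 0) := by
    intro i
    have e : ∀ n, κ n i = ∫⁻ p, k i p.1 * ind n i p.1 p.2 ∂(μ.prod (envLaw μ)) := fun n =>
      ((lintegral_prod _ (((hkm i).comp measurable_fst).mul (hindm n i)).aemeasurable).trans
        (lintegral_congr fun a =>
          have hma : Measurable (ind n i a) := (hindm n i).comp measurable_prodMk_left
          lintegral_const_mul (k i a) hma)).symm
    simp_rw [e]
    rw [← lintegral_zero (μ := μ.prod (envLaw μ))]
    refine tendsto_lintegral_of_dominated_convergence (fun p => k i p.1)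
      (fun n => ((hkm i).comp measurable_fst).mul (hindm n i)) (fun n => .of_forall fun p => ?_) ?_ ?_
    · refine mul_le_of_le_one_right' ?_
      exact Set.indicator_le_self' (fun _ _ => zero_le) _
    · have h := lintegral_prod (μ := μ) (ν := envLaw μ) _
        ((hkm i).comp measurable_fst).aemeasurable
      simp only [Function.comp_apply, lintegral_const, measure_univ, mul_one] at h
      exact h.trans_ne (hkfin i).ne
    · have hae : ∀ᵐ p ∂(μ.prod (envLaw μ)), 0 < escLim p.2 :=
        Measure.quasiMeasurePreserving_snd.ae hpos
      filter_upwards [hae] with p hp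
      have hfin : invEsc p.2 ≠ ⊤ := by
        rw [invEsc, ENNReal.inv_ne_top]; simpa using hp
      obtain ⟨n₁, hn₁⟩ := ENNReal.exists_nat_gt hfin
      obtain ⟨n₂, hn₂⟩ := exists_nat_one_div_lt (show (0 : ℝ) < p.1 (σ i) from (p.1 (σ i)).2)
      refine tendsto_const_nhds.congr' ?_
      filter_upwards [Filter.eventually_ge_atTop (max n₁ n₂)] with n hn
      have h1 : ¬ ((n : ℝ≥0∞) < invEsc p.2) := by
        refine not_lt.2 (hn₁.le.trans ?_)
        exact_mod_cast (le_max_left _ _).trans hn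
      have h2 : ¬ ((p.1 (σ i) : ℝ) < 1 / (n + 1)) := by
        refine not_lt.2 (le_trans ?_ hn₂.le)
        have : (n₂ : ℝ) ≤ n := by exact_mod_cast (le_max_right _ _).trans hn
        exact one_div_le_one_div_of_le (by positivity) (by linarith)
      have : (p.1, p.2) ∉ bad n i := by
        simp only [hbad, Set.mem_ofPred_eq, not_or]
        exact ⟨h2, h1⟩
      simp only [hind, Set.indicator_of_notMem this, mul_zero]
  set Kq : ℝ≥0∞ := 2 ^ (q - 1) with hKq
  have hKq1 : 1 ≤ Kq := by
    simpa using ENNReal.rpow_le_rpow_of_exponent_le (one_le_two (α := ℝ≥0∞)) (sub_nonneg.2 hq)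
  have hKqt : Kq ≠ ∞ := ENNReal.rpow_ne_top_of_nonneg (by linarith) (by norm_num)
  obtain ⟨n, hn⟩ : ∃ n, Kq * ∑ i, κ n i ≤ 2⁻¹ := by
    have h1 : Filter.Tendsto (fun n => Kq * ∑ i, κ n i) Filter.atTop (nhds (Kq * 0)) := by
      refine ENNReal.Tendsto.const_mul ?_ (Or.inr hKqt)
      have := tendsto_finsetSum (Finset.univ : Finset (Fin b)) fun i _ => hκlim i
      simpa using this
    rw [mul_zero] at h1
    exact ((h1.eventually_lt_const (by simp : (0 : ℝ≥0∞) < 2⁻¹)).exists).imp fun n h => h.le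
  set C : ℝ≥0∞ := (1 + (n + 1) * n) ^ q + Kq with hC
  have hCt : C ≠ ∞ := by
    refine ENNReal.add_ne_top.2 ⟨ENNReal.rpow_ne_top_of_nonneg hq0 ?_, hKqt⟩
    exact_mod_cast ENNReal.natCast_ne_top (1 + (n + 1) * n)
  set V : Env b → ℝ≥0∞ := fun ω => invEsc ω ^ q with hV
  have hVm : Measurable V := measurable_invEsc.pow_const q
  -- the truncated pointwise recursion
  have hrec : ∀ (N : ℕ) (ω : Env b), min (V ω) N ≤ C + Kq * ∑ i, k i (ω []) *
      (min (V (shiftEnv [i] ω)) N * ind n i (ω []) (shiftEnv [σ i] ω)) := by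
    intro N ω
    obtain ⟨i, hi⟩ := exists_totalWeight_le hb0 (ω [])
    by_cases hbi : (ω [], shiftEnv [σ i] ω) ∈ bad n i
    · set r := (ENNReal.ofReal (min (ω [] i : ℝ) 1))⁻¹ with hr
      have hr1 : 1 ≤ r := by
        rw [hr, ENNReal.one_le_inv]; exact ENNReal.ofReal_le_one.2 (min_le_right _ _)
      have hki : k i (ω []) = r ^ q := by simp only [hk, invBigWeight, if_pos hi, hr]
      have h1 : V ω ≤ Kq + Kq * (r ^ q * V (shiftEnv [i] ω)) := by
        calc V ω ≤ (1 + r * invEsc (shiftEnv [i] ω)) ^ q := by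
              refine ENNReal.rpow_le_rpow ?_ hq0
              rw [invEsc_eq]
              refine add_le_add le_rfl ((inv_childSum_le ω i).trans ?_)
              gcongr
              exact ENNReal.inv_le_inv' (ENNReal.ofReal_le_ofReal (min_le_left _ _))
          _ ≤ Kq * (1 ^ q + (r * invEsc (shiftEnv [i] ω)) ^ q) :=
              ENNReal.rpow_add_le_mul_rpow_add_rpow _ _ hq
          _ = _ := by rw [ENNReal.one_rpow, ENNReal.mul_rpow_of_nonneg _ _ hq0, mul_add, mul_one]
      have h2 : min (V ω) N ≤ Kq + Kq * (r ^ q * min (V (shiftEnv [i] ω)) N) := by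
        rcases le_total (V (shiftEnv [i] ω)) N with h | h
        · rw [min_eq_left h]; exact (min_le_left _ _).trans h1
        · rw [min_eq_right h]
          refine (min_le_right _ _).trans (le_trans ?_ le_add_self)
          rw [← mul_assoc]
          refine le_mul_of_one_le_left zero_le (one_le_mul hKq1 ?_)
          exact ENNReal.one_le_rpow hr1 (by linarith)
      refine h2.trans (add_le_add le_add_self ?_)
      gcongr
      refine le_trans (le_of_eq ?_) (Finset.single_le_sum (f := fun i => k i (ω []) *
        (min (V (shiftEnv [i] ω)) N * ind n i (ω []) (shiftEnv [σ i] ω)))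
        (fun _ _ => zero_le) (Finset.mem_univ i))
      simp only [hind, Set.indicator_of_mem hbi, Pi.one_apply, mul_one, hki]
    · refine (min_le_left _ _).trans (le_trans ?_ (le_self_add.trans le_self_add))
      refine ENNReal.rpow_le_rpow ?_ hq0
      simp only [hbad, Set.mem_ofPred_eq, not_or, not_lt] at hbi
      rw [invEsc_eq]
      refine add_le_add le_rfl ((inv_childSum_le ω (σ i)).trans (mul_le_mul' ?_ hbi.2))
      rw [← ENNReal.ofReal_inv_of_pos (ω [] (σ i)).2]
      refine (ENNReal.ofReal_le_ofReal (q := (n + 1 : ℕ)) ?_).trans_eq (by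
        rw [ENNReal.ofReal_natCast]; push_cast; rfl)
      rw [inv_le_comm₀ (ω [] (σ i)).2 (by positivity), ← one_div]
      push_cast
      exact hbi.1
  -- the truncated moments are bounded
  have hbound : ∀ N : ℕ, ∫⁻ ω, min (V ω) N ∂(envLaw μ) ≤ 2 * C := by
    intro N
    set M := ∫⁻ ω, min (V ω) N ∂(envLaw μ) with hM
    have hMt : M ≠ ∞ := by
      refine ne_of_lt ((lintegral_mono (g := fun _ => (N : ℝ≥0∞)) fun ω => min_le_right _ _).trans_lt
        ?_)
      simp
    have hVN : Measurable fun ω => min (V ω) (N : ℝ≥0∞) := hVm.min measurable_const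
    have hroot : Measurable fun ω : Env b => ω [] := measurable_pi_apply _
    have hterm : ∀ i, ∫⁻ ω, k i (ω []) *
        (min (V (shiftEnv [i] ω)) N * ind n i (ω []) (shiftEnv [σ i] ω)) ∂(envLaw μ) =
        M * κ n i := by
      intro i
      have h := lintegral_envLaw_prod μ
        (h := fun j a ω => if j = i then min (V ω) N else ind n i a ω)
        (fun j => by
          by_cases hj : j = i
          · simp only [hj, if_true]; exact hVN.comp measurable_snd
          · simp only [hj, if_false]; exact hindm n i) {i, σ i} (hkm i)
      simp only [Finset.prod_pair (hσ i), if_true, if_neg (hσ i).symm] at h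
      rw [h, hκ, ← lintegral_const_mul' _ _ hMt]
      exact lintegral_congr fun a => by ring
    have hmterm : ∀ i, Measurable fun ω => k i (ω []) *
        (min (V (shiftEnv [i] ω)) N * ind n i (ω []) (shiftEnv [σ i] ω)) := fun i =>
      ((hkm i).comp hroot).mul ((hVN.comp (measurable_shiftEnv _)).mul
        ((hindm n i).comp (hroot.prodMk (measurable_shiftEnv _))))
    have h1 : M ≤ C + 2⁻¹ * M := by
      calc M ≤ ∫⁻ ω, (C + Kq * ∑ i, k i (ω []) * (min (V (shiftEnv [i] ω)) N *
              ind n i (ω []) (shiftEnv [σ i] ω))) ∂(envLaw μ) := lintegral_mono (hrec N)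
        _ = C + Kq * ∑ i, M * κ n i := by
            rw [lintegral_add_left measurable_const, lintegral_const_mul' _ _ hKqt,
              lintegral_finsetSum _ fun i _ => hmterm i]
            simp [hterm]
        _ ≤ C + 2⁻¹ * M := by
            refine add_le_add le_rfl ?_
            rw [← Finset.mul_sum, mul_left_comm, mul_comm]
            exact mul_le_mul' hn le_rfl
    have h2 : 2⁻¹ * M + 2⁻¹ * M ≤ C + 2⁻¹ * M := by
      rwa [← add_mul, ENNReal.inv_two_add_inv_two, one_mul]
    have h3 : 2⁻¹ * M ≤ C :=
      (ENNReal.add_le_add_iff_right (ENNReal.mul_ne_top (by simp) hMt)).1 h2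
    calc M = 2 * (2⁻¹ * M) := by
          rw [← mul_assoc, ENNReal.mul_inv_cancel (by simp) (by simp), one_mul]
      _ ≤ 2 * C := by gcongr
  have hsup : ∀ ω, V ω = ⨆ N : ℕ, min (V ω) N := fun ω => by
    rw [← inf_iSup_eq, ENNReal.iSup_natCast, inf_top_eq]
  change ∫⁻ ω, V ω ∂(envLaw μ) < ∞
  rw [lintegral_congr hsup, lintegral_iSup (fun N => hVm.min measurable_const)
    fun N N' h ω => min_le_min le_rfl (by exact_mod_cast h)]
  exact (iSup_le hbound).trans_lt (ENNReal.mul_lt_top (by simp) hCt.lt_top)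

/-- The inverse of the probability of never returning has as many moments as the inverse total
weight. -/
lemma lintegral_inv_neverBack_rpow_lt_top {b : ℕ} (hb : 0 < b) (μ : Measure (Weights b))
    [IsProbabilityMeasure μ] {q : ℝ} (hq : 1 ≤ q)
    (hV : ∫⁻ ω, invEsc ω ^ q ∂(envLaw μ) < ∞) :
    ∫⁻ ω, (ENNReal.ofReal (neverBack ω))⁻¹ ^ q ∂(envLaw μ) < ∞ := by
  have hq0 : 0 ≤ q := by linarith
  set Kq : ℝ≥0∞ := 2 ^ (q - 1) with hKq
  have hKqt : Kq ≠ ∞ := ENNReal.rpow_ne_top_of_nonneg (by linarith) (by norm_num)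
  have hbt : (b : ℝ≥0∞) ^ q ≠ ∞ := ENNReal.rpow_ne_top_of_nonneg hq0 (ENNReal.natCast_ne_top b)
  have hVm : Measurable fun ω : Env b => invEsc ω ^ q := measurable_invEsc.pow_const q
  have hpt : ∀ ω : Env b, (ENNReal.ofReal (neverBack ω))⁻¹ ^ q ≤
      Kq * (invEsc ω ^ q + (b : ℝ≥0∞) ^ q * ∑ i, invEsc (shiftEnv [i] ω) ^ q) := by
    intro ω
    obtain ⟨i, hi⟩ := exists_totalWeight_le hb (ω [])
    have hS := totalWeight_nonneg (ω [])
    have hx := childSum_nonneg escLim_nonneg ω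
    have h1 : (ENNReal.ofReal (neverBack ω))⁻¹ ≤ invEsc ω + b * invEsc (shiftEnv [i] ω) := by
      rw [neverBack, ENNReal.ofReal_div_of_pos (by linarith), ENNReal.inv_div (by simp)
        (Or.inl (by simp; linarith)), div_eq_mul_inv, ENNReal.ofReal_add zero_le_one hS,
        ENNReal.ofReal_one, add_mul, one_mul]
      refine add_le_add (by rw [invEsc_eq]; exact le_add_self) ?_
      have h2 : ENNReal.ofReal (totalWeight (ω [])) ≤ b * ENNReal.ofReal (ω [] i) := by
        rw [← ENNReal.ofReal_natCast, ← ENNReal.ofReal_mul (by positivity)]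
        exact ENNReal.ofReal_le_ofReal hi
      have h0 : ENNReal.ofReal (ω [] i) ≠ 0 :=
        (ENNReal.ofReal_pos.2 (ω [] i).2).ne'
      calc _ ≤ (b * ENNReal.ofReal (ω [] i)) *
            ((ENNReal.ofReal (ω [] i))⁻¹ * invEsc (shiftEnv [i] ω)) :=
            mul_le_mul' h2 (inv_childSum_le ω i)
        _ = b * (ENNReal.ofReal (ω [] i) * (ENNReal.ofReal (ω [] i))⁻¹) *
            invEsc (shiftEnv [i] ω) := by ring
        _ = _ := by rw [ENNReal.mul_inv_cancel h0 (by simp), mul_one]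
    refine (ENNReal.rpow_le_rpow h1 hq0).trans ((ENNReal.rpow_add_le_mul_rpow_add_rpow _ _ hq).trans ?_)
    rw [ENNReal.mul_rpow_of_nonneg _ _ hq0]
    gcongr
    exact Finset.single_le_sum (f := fun i => invEsc (shiftEnv [i] ω) ^ q)
      (fun _ _ => zero_le) (Finset.mem_univ i)
  have hVi : ∀ i : Fin b, Measurable fun ω : Env b => invEsc (shiftEnv [i] ω) ^ q := fun i =>
    hVm.comp (measurable_shiftEnv _)
  refine (lintegral_mono hpt).trans_lt ?_
  rw [lintegral_const_mul' _ _ hKqt, lintegral_add_left hVm, lintegral_const_mul' _ _ hbt,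
    lintegral_finsetSum _ fun i _ => hVi i]
  refine ENNReal.mul_lt_top hKqt.lt_top (ENNReal.add_lt_top.2 ⟨hV, ENNReal.mul_lt_top hbt.lt_top
    (ENNReal.sum_lt_top.2 fun i _ => ?_)⟩)
  exact (lintegral_shiftEnv μ [i] hVm).trans_lt hV

/-! ### Returning from a deep vertex -/

/-- A sum over the paths of length `n` from the root, which bounds the `r`-th powers of the
probabilities of returning to the parent of the root from level `n`. Each factor only involves one
sibling of a vertex on the path, so that the factors along a path are independent. -/
noncomputable def retSum {b : ℕ} (σ : Fin b → Fin b) (r : ℕ) : ℕ → Env b → ℝ≥0∞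
  | 0, _ => 1
  | n + 1, ω => ∑ i, ENNReal.ofReal ((1 + (ω [] (σ i) : ℝ) * escLim (shiftEnv [σ i] ω))⁻¹) ^ r *
      retSum σ r n (shiftEnv [i] ω)

lemma measurable_ofReal_inv {b : ℕ} (j : Fin b) :
    Measurable fun p : Weights b × Env b =>
      ENNReal.ofReal ((1 + (p.1 j : ℝ) * escLim p.2)⁻¹) := by
  have h1 : Measurable fun p : Weights b × Env b => (p.1 j : ℝ) := by fun_prop
  exact (((h1.mul (measurable_escLim.comp measurable_snd)).const_add 1).inv).ennreal_ofReal

lemma measurable_retSum {b : ℕ} (σ : Fin b → Fin b) (r n : ℕ) :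
    Measurable (retSum σ r n) := by
  induction n with
  | zero => exact measurable_const
  | succ n ih =>
    have hroot : Measurable fun ω : Env b => ω [] := measurable_pi_apply _
    exact Finset.measurable_sum _ fun i _ => (((measurable_ofReal_inv (σ i)).comp
      (hroot.prodMk (measurable_shiftEnv _))).pow_const r).mul (ih.comp (measurable_shiftEnv _))

lemma ret_pow_le_retSum {b : ℕ} (σ : Fin b → Fin b) (r : ℕ) (u : List (Fin b)) (ω : Env b) :
    ENNReal.ofReal (ret ω u) ^ r ≤ retSum σ r u.length ω := by
  induction u using List.reverseRecOn generalizing ω with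
  | nil =>
    simp only [ret, List.length_nil, retSum]
    exact pow_le_one₀ zero_le (ENNReal.ofReal_le_one.2 (by linarith [escLim_nonneg ω]))
  | append_singleton u i ih =>
    rw [ret_append_singleton, List.length_append, List.length_singleton, retSum,
      ENNReal.ofReal_mul (ret_nonneg _ _), mul_pow, mul_comm]
    refine le_trans ?_ (Finset.single_le_sum (f := fun i =>
      ENNReal.ofReal ((1 + (ω [] (σ i) : ℝ) * escLim (shiftEnv [σ i] ω))⁻¹) ^ r *
      retSum σ r u.length (shiftEnv [i] ω)) (fun _ _ => zero_le) (Finset.mem_univ i))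
    refine mul_le_mul' (pow_le_pow_left₀ zero_le (ENNReal.ofReal_le_ofReal ?_) r) (ih _)
    have h0 := mul_nonneg (ω [] (σ i)).2.le (escLim_nonneg (shiftEnv [σ i] ω))
    rw [one_sub_escLim, one_div]
    refine inv_anti₀ (by linarith) (add_le_add le_rfl ?_)
    exact Finset.single_le_sum (f := fun i => (ω [] i : ℝ) * escLim (shiftEnv [i] ω))
      (fun j _ => mul_nonneg (ω [] j).2.le (escLim_nonneg _)) (Finset.mem_univ (σ i))

/-- The factors of `retSum` are less than `1`, so that the expectation of their `r`-th powers tends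
to `0`; for large `r` this beats the number of paths. -/
lemma exists_lintegral_retSum_le {b : ℕ} (μ : Measure (Weights b))
    [IsProbabilityMeasure μ] (hpos : ∀ᵐ ω ∂(envLaw μ), 0 < escLim ω)
    (σ : Fin b → Fin b) (hσ : ∀ i, i ≠ σ i) :
    ∃ r : ℕ, 1 ≤ r ∧ ∀ n, ∫⁻ ω, retSum σ r n ω ∂(envLaw μ) ≤ 2⁻¹ ^ n := by
  set f : Fin b → Weights b → Env b → ℝ≥0∞ := fun j a ω =>
    ENNReal.ofReal ((1 + (a j : ℝ) * escLim ω)⁻¹) with hf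
  have hfm : ∀ j, Measurable (Function.uncurry (f j)) := measurable_ofReal_inv
  have hf1 : ∀ j a ω, f j a ω ≤ 1 := fun j a ω => by
    refine ENNReal.ofReal_le_one.2 (inv_le_one_of_one_le₀ ?_)
    have := mul_nonneg (a j).2.le (escLim_nonneg ω)
    linarith
  set ρ : ℕ → Fin b → ℝ≥0∞ := fun r j => ∫⁻ a, ∫⁻ ω, f j a ω ^ r ∂(envLaw μ) ∂μ with hρ
  have hlim : ∀ j, Filter.Tendsto (fun r => ρ r j) Filter.atTop (nhds 0) := by
    intro j
    have e : ∀ r, ρ r j = ∫⁻ p, f j p.1 p.2 ^ r ∂(μ.prod (envLaw μ)) := fun r =>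
      (lintegral_prod _ ((hfm j).pow_const r).aemeasurable).symm
    simp_rw [e]
    rw [← lintegral_zero (μ := μ.prod (envLaw μ))]
    refine tendsto_lintegral_of_dominated_convergence (fun _ => 1)
      (fun r => (hfm j).pow_const r) (fun r => .of_forall fun p => ?_) (by simp) ?_
    · exact pow_le_one₀ zero_le (hf1 j _ _)
    · filter_upwards [Measure.quasiMeasurePreserving_snd.ae hpos] with p hp
      refine ENNReal.tendsto_pow_atTop_nhds_zero_of_lt_one ?_
      have := mul_pos (p.1 j).2 hp
      exact ENNReal.ofReal_lt_one.2 (inv_lt_one_of_one_lt₀ (by linarith))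
  obtain ⟨r, hr1, hr⟩ : ∃ r, 1 ≤ r ∧ ∑ i, ρ r (σ i) ≤ 2⁻¹ := by
    have h1 := tendsto_finsetSum (Finset.univ : Finset (Fin b)) fun i _ => hlim (σ i)
    rw [Finset.sum_const_zero] at h1
    obtain ⟨r, h2, h3⟩ := ((h1.eventually_lt_const (by simp : (0 : ℝ≥0∞) < 2⁻¹)).and
      (Filter.eventually_ge_atTop 1)).exists
    exact ⟨r, h3, h2.le⟩
  refine ⟨r, hr1, fun n => ?_⟩
  induction n with
  | zero => simp [retSum]
  | succ n ih =>
    have hroot : Measurable fun ω : Env b => ω [] := measurable_pi_apply _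
    have hterm : ∀ i, ∫⁻ ω, f (σ i) (ω []) (shiftEnv [σ i] ω) ^ r *
        retSum σ r n (shiftEnv [i] ω) ∂(envLaw μ) =
        ρ r (σ i) * ∫⁻ ω, retSum σ r n ω ∂(envLaw μ) := by
      intro i
      have h := lintegral_envLaw_prod μ
        (h := fun j a ω => if j = i then retSum σ r n ω else f (σ i) a ω ^ r)
        (fun j => by
          by_cases hj : j = i
          · simp only [hj, if_true]; exact (measurable_retSum σ r n).comp measurable_snd
          · simp only [hj, if_false]; exact (hfm (σ i)).pow_const r) {i, σ i}
        (k := fun _ => 1) measurable_const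
      simp only [Finset.prod_pair (hσ i), if_true, if_neg (hσ i).symm, one_mul] at h
      simp_rw [mul_comm (f _ _ _ ^ r)]
      rw [h, mul_comm, lintegral_const_mul]
      exact ((hfm (σ i)).pow_const r).lintegral_prod_right'
    calc ∫⁻ ω, retSum σ r (n + 1) ω ∂(envLaw μ)
        = ∑ i, ρ r (σ i) * ∫⁻ ω, retSum σ r n ω ∂(envLaw μ) := by
          have hm : ∀ i, Measurable fun ω => f (σ i) (ω []) (shiftEnv [σ i] ω) ^ r *
              retSum σ r n (shiftEnv [i] ω) := fun i => (((hfm (σ i)).comp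
            (hroot.prodMk (measurable_shiftEnv _))).pow_const r).mul
              ((measurable_retSum σ r n).comp (measurable_shiftEnv _))
          exact (lintegral_finsetSum _ fun i _ => hm i).trans
            (Finset.sum_congr rfl fun i _ => hterm i)
      _ ≤ 2⁻¹ * 2⁻¹ ^ n := by rw [← Finset.sum_mul]; gcongr
      _ = 2⁻¹ ^ (n + 1) := by rw [pow_succ']

/-! ### Fresh vertices under the annealed law -/

/-- The annealed law of the trajectory of the walk started at the root. -/
noncomputable def pathLaw {b : ℕ} (μ : Measure (Weights b)) : Measure (ℕ → Vertex b) :=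
  (annealed μ Vertex.root).map Prod.snd

instance {b : ℕ} (μ : Measure (Weights b)) [IsProbabilityMeasure μ] :
    IsProbabilityMeasure (pathLaw μ) :=
  Measure.isProbabilityMeasure_map measurable_snd.aemeasurable

lemma lintegral_pathLaw {b : ℕ} (μ : Measure (Weights b)) [IsProbabilityMeasure μ]
    {f : (ℕ → Vertex b) → ℝ≥0∞} (hf : Measurable f) :
    ∫⁻ X, f X ∂(pathLaw μ) =
      ∫⁻ ω, ∫⁻ X, f X ∂(quenchedLaw Vertex.root ω) ∂(envLaw μ) := by
  rw [pathLaw, lintegral_map hf measurable_snd, annealed]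
  exact Measure.lintegral_compProd (f := fun z => f z.2) (hf.comp measurable_snd)

lemma pathLaw_apply {b : ℕ} (μ : Measure (Weights b)) [IsProbabilityMeasure μ]
    {S : Set (ℕ → Vertex b)} (hS : MeasurableSet S) :
    pathLaw μ S = ∫⁻ ω, quenchedLaw Vertex.root ω S ∂(envLaw μ) := by
  rw [← lintegral_indicator_one hS, lintegral_pathLaw μ (measurable_one.indicator hS)]
  simp_rw [lintegral_indicator_one hS]

lemma ae_pathLaw {b : ℕ} (μ : Measure (Weights b)) [IsProbabilityMeasure μ]
    {p : (ℕ → Vertex b) → Prop} (hp : MeasurableSet {X | p X})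
    (h : ∀ ω, ∀ᵐ X ∂(quenchedLaw Vertex.root ω), p X) : ∀ᵐ X ∂(pathLaw μ), p X := by
  rw [ae_iff, show {X | ¬ p X} = {X | p X}ᶜ from rfl, pathLaw_apply μ hp.compl]
  have h0 : ∀ ω, quenchedLaw Vertex.root ω {X | p X}ᶜ = 0 := fun ω => ae_iff.1 (h ω)
  simp [h0]

/-- A family of events that stop the walk at the vertex `w` at time `n`, before which the walk has
not seen the subtree of `w`. The events for different times are disjoint. -/
structure IsFresh {b : ℕ} (S : ℕ → List (Fin b) → Set (ℕ → Vertex b)) : Prop where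
  determined : ∀ n w, DeterminedBy n (S n w)
  at_vertex : ∀ n w, ∀ X ∈ S n w, X n = .node w
  avoids : ∀ n w, ∀ X ∈ S n w, ∀ i < n, X i ∉ subtree w
  disjoint : ∀ n w n' w' X, X ∈ S n w → X ∈ S n' w' → n = n'

/-- The event that the family stops the walk. -/
def stopped {b : ℕ} (S : ℕ → List (Fin b) → Set (ℕ → Vertex b)) : Set (ℕ → Vertex b) :=
  ⋃ p : ℕ × List (Fin b), S p.1 p.2

section
variable {b : ℕ} {S : ℕ → List (Fin b) → Set (ℕ → Vertex b)}

lemma IsFresh.eq_of_mem (hS : IsFresh S) {n n' : ℕ} {w w' : List (Fin b)} {X : ℕ → Vertex b}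
    (h : X ∈ S n w) (h' : X ∈ S n' w') : (n, w) = (n', w') := by
  obtain rfl := hS.disjoint _ _ _ _ _ h h'
  have := (hS.at_vertex _ _ _ h).symm.trans (hS.at_vertex _ _ _ h')
  rw [Vertex.node.injEq] at this
  rw [this]

lemma IsFresh.pairwise (hS : IsFresh S) :
    Pairwise (Function.onFun Disjoint fun p : ℕ × List (Fin b) => S p.1 p.2) :=
  fun _ _ hne => Set.disjoint_left.2 fun _ hX hX' => hne (hS.eq_of_mem hX hX')

lemma IsFresh.measurableSet (hS : IsFresh S) (n : ℕ) (w : List (Fin b)) :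
    MeasurableSet (S n w) := (hS.determined n w).measurableSet

lemma stepLaw_congr {ω ω' : Env b} {w : List (Fin b)} (h : AgreeOff w ω ω') {v : Vertex b}
    (hv : v ∉ subtree w) : stepLaw ω v = stepLaw ω' v := by
  cases v with
  | rootParent => rfl
  | node v => simp only [stepLaw, h v fun hs => hv (node_mem_subtree.2 hs)]

lemma IsFresh.quenchedLaw_congr (hS : IsFresh S) (n : ℕ) (w : List (Fin b)) {ω ω' : Env b}
    (h : AgreeOff w ω ω') (x : Vertex b) : quenchedLaw x ω (S n w) = quenchedLaw x ω' (S n w) := by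
  rw [(hS.determined n w).measure_eq, (hS.determined n w).measure_eq]
  refine tsum_congr fun y => ?_
  rw [quenchedLaw_pathCyl, quenchedLaw_pathCyl]
  congr 1
  refine Finset.prod_congr rfl fun i hi => ?_
  rw [stepLaw_congr h (hS.avoids n w _ y.2 i (Finset.mem_range.1 hi))]

/-- After the walk is stopped at a fresh vertex, a functional whose quenched expectation is bounded
by a function `g` of the environment in the subtree of this vertex has annealed expectation at most
that of `g`, independently of the past. -/
lemma IsFresh.lintegral_le (hS : IsFresh S) (μ : Measure (Weights b)) [IsProbabilityMeasure μ]
    {Φ : List (Fin b) → (ℕ → Vertex b) → ℝ≥0∞} (hΦ : ∀ w, Measurable (Φ w))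
    {g : Env b → ℝ≥0∞} (hg : Measurable g)
    (hle : ∀ ω w, ∫⁻ X, Φ w X ∂(quenchedLaw (.node w) ω) ≤ g (shiftEnv w ω)) :
    ∫⁻ X, ∑' p : ℕ × List (Fin b),
      (S p.1 p.2).indicator (fun X => Φ p.2 (shiftPath p.1 X)) X ∂(pathLaw μ) ≤
      pathLaw μ (stopped S) * ∫⁻ ω, g ω ∂(envLaw μ) := by
  have hm : ∀ p : ℕ × List (Fin b),
      Measurable ((S p.1 p.2).indicator fun X => Φ p.2 (shiftPath p.1 X)) := fun p =>
    ((hΦ _).comp (measurable_shiftPath _)).indicator (hS.measurableSet _ _)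
  have hQ : ∀ n w, Measurable fun ω => quenchedLaw (b := b) Vertex.root ω (S n w) := fun n w =>
    (Measure.measurable_coe (hS.measurableSet n w)).comp (measurable_quenchedLaw Vertex.root)
  rw [lintegral_tsum fun p => (hm p).aemeasurable, stopped,
    measure_iUnion hS.pairwise fun p => hS.measurableSet _ _, ← ENNReal.tsum_mul_right]
  refine ENNReal.tsum_le_tsum fun p => ?_
  rw [lintegral_pathLaw μ (hm p), pathLaw_apply μ (hS.measurableSet _ _),
    ← lintegral_envLaw_mul_shiftEnv μ p.2 (hQ _ _) hg
      fun ω ω' h => hS.quenchedLaw_congr _ _ h _]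
  refine lintegral_mono fun ω => ?_
  rw [lintegral_indicator (hS.measurableSet _ _),
    setLIntegral_shiftPath _ ω (hS.determined _ _) (hS.at_vertex _ _) (hΦ _)]
  exact mul_le_mul' le_rfl (hle ω p.2)

lemma IsFresh.pathLaw_le (hS : IsFresh S) (μ : Measure (Weights b)) [IsProbabilityMeasure μ]
    {B : List (Fin b) → Set (ℕ → Vertex b)} (hB : ∀ w, MeasurableSet (B w))
    {g : Env b → ℝ≥0∞} (hg : Measurable g)
    (hle : ∀ ω w, quenchedLaw (.node w) ω (B w) ≤ g (shiftEnv w ω)) :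
    pathLaw μ (⋃ p : ℕ × List (Fin b), S p.1 p.2 ∩ shiftPath p.1 ⁻¹' B p.2) ≤
      pathLaw μ (stopped S) * ∫⁻ ω, g ω ∂(envLaw μ) := by
  refine le_trans ?_ (hS.lintegral_le μ (Φ := fun w => (B w).indicator 1)
    (fun w => measurable_one.indicator (hB w)) hg
    fun ω w => (lintegral_indicator_one (hB w)).trans_le (hle ω w))
  have hm : ∀ p : ℕ × List (Fin b), MeasurableSet (S p.1 p.2 ∩ shiftPath p.1 ⁻¹' B p.2) := fun p =>
    (hS.measurableSet _ _).inter (measurable_shiftPath _ (hB _))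
  rw [← lintegral_indicator_one (.iUnion hm)]
  refine lintegral_mono fun X => ?_
  by_cases hX : X ∈ ⋃ p : ℕ × List (Fin b), S p.1 p.2 ∩ shiftPath p.1 ⁻¹' B p.2
  · rw [Set.indicator_of_mem hX]
    obtain ⟨p, h1, h2⟩ := Set.mem_iUnion.1 hX
    refine le_trans ?_ (ENNReal.le_tsum p)
    rw [Set.indicator_of_mem h1, Set.indicator_of_mem (show shiftPath p.1 X ∈ B p.2 from h2)]
    rfl
  · rw [Set.indicator_of_notMem hX]; exact zero_le

/-- The annealed probability that the walk ever visits the parent of the root. -/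
noncomputable def failProb (μ : Measure (Weights b)) : ℝ≥0∞ :=
  ∫⁻ ω, ENNReal.ofReal (1 - escLim ω) ∂(envLaw μ)

lemma failProb_lt_one (μ : Measure (Weights b)) [IsProbabilityMeasure μ]
    (hpos : ∀ᵐ ω ∂(envLaw μ), 0 < escLim ω) : failProb μ < 1 := by
  have hm : Measurable fun ω : Env b => ENNReal.ofReal (1 - escLim ω) :=
    (measurable_escLim.const_sub 1).ennreal_ofReal
  have h1 : failProb μ + ∫⁻ ω, ENNReal.ofReal (escLim ω) ∂(envLaw μ) = 1 := by
    rw [failProb, ← lintegral_add_left hm]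
    have : ∀ ω : Env b, ENNReal.ofReal (1 - escLim ω) + ENNReal.ofReal (escLim ω) = 1 := fun ω => by
      rw [← ENNReal.ofReal_add (sub_nonneg.2 (escLim_le_one ω)) (escLim_nonneg ω)]; simp
    simp [this]
  have h2 : 0 < ∫⁻ ω, ENNReal.ofReal (escLim ω) ∂(envLaw μ) := by
    rw [pos_iff_ne_zero, Ne, lintegral_eq_zero_iff (by fun_prop)]
    intro h0
    obtain ⟨ω, h3, h4⟩ := (hpos.and h0).exists
    simp only [Pi.zero_apply, ENNReal.ofReal_eq_zero] at h4
    linarith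
  have hle : failProb μ ≤ 1 := by rw [← h1]; exact le_self_add
  calc failProb μ < failProb μ + ∫⁻ ω, ENNReal.ofReal (escLim ω) ∂(envLaw μ) :=
        ENNReal.lt_add_right (hle.trans_lt ENNReal.one_lt_top).ne h2.ne'
    _ = 1 := h1

lemma IsFresh.pathLaw_exit_le (hS : IsFresh S) (μ : Measure (Weights b)) [IsProbabilityMeasure μ] :
    pathLaw μ (⋃ p : ℕ × List (Fin b), S p.1 p.2 ∩
      shiftPath p.1 ⁻¹' {X | ∃ n, X n ∈ (subtree p.2)ᶜ}) ≤
      pathLaw μ (stopped S) * failProb μ :=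
  hS.pathLaw_le μ (B := fun w => {X | ∃ n, X n ∈ (subtree w)ᶜ})
    (fun _ => measurableSet_exists_mem _)
    (measurable_escLim.const_sub 1).ennreal_ofReal
    fun ω w => quenchedLaw_exit_subtree_self_le ω w

/-! ### Nearest-neighbour trajectories -/

/-- The possible steps of the walk. -/
def Adj : Vertex b → Vertex b → Prop
  | .rootParent, u => u = Vertex.root
  | .node w, u => u = Vertex.parentOfNode w ∨ ∃ i, u = .node (i :: w)

/-- Trajectories that start at the root and make only possible steps. -/
def IsWalk (X : ℕ → Vertex b) : Prop := X 0 = Vertex.root ∧ ∀ n, Adj (X n) (X (n + 1))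

lemma quenchedLaw_first_step (ω : Env b) (v : Vertex b) :
    quenchedLaw v ω {X | ¬ Adj v (X 1)} = 0 := by
  have e : {X : ℕ → Vertex b | ¬ Adj v (X 1)} = shiftPath 1 ⁻¹' {X | ¬ Adj v (X 0)} := rfl
  have hm : MeasurableSet {X : ℕ → Vertex b | ¬ Adj v (X 0)} :=
    (measurable_pi_apply (X := fun _ : ℕ => Vertex b) 0)
      (MeasurableSet.of_discrete (s := {u | ¬ Adj v u}))
  have h0 : ∀ u, Adj v u → quenchedLaw u ω {X | ¬ Adj v (X 0)} = 0 := fun u hu => by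
    refine measure_eq_zero_iff_ae_notMem.2 ?_
    filter_upwards [quenchedLaw_start_ae u ω] with X hX
    simpa [hX] using hu
  rw [e, quenchedLaw_shiftPath_one v ω hm]
  cases v with
  | rootParent =>
    rw [stepLaw, lintegral_dirac]
    exact h0 _ rfl
  | node w =>
    rw [lintegral_stepLaw_node, h0 _ (Or.inl rfl), mul_zero, zero_add]
    exact Finset.sum_eq_zero fun i _ => by rw [h0 _ (Or.inr ⟨i, rfl⟩), mul_zero]

lemma measurableSet_isWalk : MeasurableSet {X : ℕ → Vertex b | IsWalk X} := by
  have : {X : ℕ → Vertex b | IsWalk X} =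
      {X | X 0 = Vertex.root} ∩ ⋂ n, {X | Adj (X n) (X (n + 1))} := by
    ext X; simp [IsWalk]
  rw [this]
  refine ((measurable_pi_apply (X := fun _ : ℕ => Vertex b) 0)
    (MeasurableSet.of_discrete (s := {Vertex.root}))).inter (.iInter fun n => ?_)
  have h : Measurable fun X : ℕ → Vertex b => (X n, X (n + 1)) := by fun_prop
  exact h (MeasurableSet.of_discrete (s := {p : Vertex b × Vertex b | Adj p.1 p.2}))

lemma ae_isWalk (μ : Measure (Weights b)) [IsProbabilityMeasure μ] :
    ∀ᵐ X ∂(pathLaw μ), IsWalk X := by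
  refine ae_pathLaw μ measurableSet_isWalk fun ω => ?_
  have h1 : ∀ n v, ∀ᵐ X ∂(quenchedLaw Vertex.root ω), X n = v → Adj v (X (n + 1)) := by
    intro n v
    have hd : DeterminedBy n {X : ℕ → Vertex b | X n = v} := fun X Y h hX => by
      simp only [Set.mem_ofPred_eq] at hX ⊢; rw [← h n le_rfl, hX]
    have hm : MeasurableSet {X : ℕ → Vertex b | ¬ Adj v (X 1)} :=
      (measurable_pi_apply (X := fun _ : ℕ => Vertex b) 1)
        (MeasurableSet.of_discrete (s := {u | ¬ Adj v u}))
    have h := quenchedLaw_inter_shiftPath Vertex.root ω hd (fun X hX => hX) hm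
    rw [quenchedLaw_first_step, mul_zero] at h
    filter_upwards [measure_eq_zero_iff_ae_notMem.1 h] with X hX hn
    by_contra hno
    exact hX ⟨hn, hno⟩
  filter_upwards [quenchedLaw_start_ae Vertex.root ω,
    ae_all_iff.2 fun n => ae_all_iff.2 fun v => h1 n v] with X h0 h
  exact ⟨h0, fun n => h n _ rfl⟩

lemma level_node (w : List (Fin b)) : (Vertex.node w).level = w.length := rfl

lemma level_parentOfNode (w : List (Fin b)) :
    (Vertex.parentOfNode w).level = (w.length : ℤ) - 1 := by
  cases w with
  | nil => rfl
  | cons i w => simp [Vertex.parentOfNode, Vertex.level]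

lemma Adj.level_le {v u : Vertex b} (h : Adj v u) : u.level ≤ v.level + 1 := by
  cases v with
  | rootParent => rw [show u = Vertex.root from h]; simp [Vertex.root, Vertex.level]
  | node w =>
    rcases h with rfl | ⟨i, rfl⟩
    · rw [level_parentOfNode, level_node]; omega
    · simp [Vertex.level]

lemma subtree_level_le {w : List (Fin b)} {v : Vertex b} (h : v ∈ subtree w) :
    (w.length : ℤ) ≤ v.level := by
  obtain ⟨u, rfl⟩ := h
  simp [Vertex.level]

lemma eq_of_mem_subtree_of_level {w : List (Fin b)} {v : Vertex b} (h : v ∈ subtree w)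
    (hl : v.level ≤ w.length) : v = .node w := by
  obtain ⟨u, rfl⟩ := h
  simp only [level_node, List.length_append, Nat.cast_add] at hl
  have : u = [] := List.length_eq_zero_iff.1 (by omega)
  simp [this]

/-- The subtree of `w` can only be entered at `w`. -/
lemma Adj.eq_of_mem_subtree {v u : Vertex b} {w : List (Fin b)} (h : Adj v u)
    (hv : v ∉ subtree w) (hu : u ∈ subtree w) : u = .node w := by
  cases v with
  | rootParent =>
    rw [show u = Vertex.root from h] at hu ⊢
    rw [Vertex.root, node_mem_subtree, List.suffix_nil] at hu
    rw [hu]; rfl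
  | node v =>
    rw [node_mem_subtree] at hv
    rcases h with rfl | ⟨i, rfl⟩
    · cases v with
      | nil => exact absurd hu (rootParent_notMem_subtree w)
      | cons i v => exact absurd ((node_mem_subtree.1 hu).trans (List.suffix_cons i v)) hv
    · rcases List.suffix_cons_iff.1 (node_mem_subtree.1 hu) with h | h
      · rw [h]
      · exact absurd h hv

/-- The subtree of `w` can only be left from `w` to its parent. -/
lemma Adj.level_lt_of_notMem_subtree {v u : Vertex b} {w : List (Fin b)} (h : Adj v u)
    (hv : v ∈ subtree w) (hu : u ∉ subtree w) : u.level < w.length := by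
  obtain ⟨y, rfl⟩ := hv
  rcases h with rfl | ⟨i, rfl⟩
  · cases y with
    | nil => rw [List.nil_append, level_parentOfNode]; omega
    | cons i y => exact absurd (node_mem_subtree.2 (List.suffix_append y w)) hu
  · exact absurd (node_mem_subtree.2 (List.suffix_append (i :: y) w)) hu

lemma IsWalk.exists_entrance {X : ℕ → Vertex b} (hX : IsWalk X) {w : List (Fin b)} {n : ℕ}
    (hn : X n ∈ subtree w) :
    ∃ m ≤ n, X m = .node w ∧ ∀ i < m, X i ∉ subtree w := by
  classical
  have hex : ∃ n, X n ∈ subtree w := ⟨n, hn⟩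
  refine ⟨Nat.find hex, Nat.find_min' hex hn, ?_, fun i hi => Nat.find_min hex hi⟩
  have hs := Nat.find_spec hex
  rcases Nat.eq_zero_or_pos (Nat.find hex) with h0 | h0
  · rw [h0, hX.1, Vertex.root, node_mem_subtree, List.suffix_nil] at hs
    rw [h0, hX.1, hs]; rfl
  · have h := hX.2 (Nat.find hex - 1)
    rw [Nat.sub_add_cancel h0] at h
    exact h.eq_of_mem_subtree (Nat.find_min hex (by omega)) hs

lemma IsWalk.mem_subtree {X : ℕ → Vertex b} (hX : IsWalk X) {w : List (Fin b)} {s t : ℕ}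
    (hst : s ≤ t) (hs : X s ∈ subtree w)
    (h : ∀ i, s ≤ i → i ≤ t → (w.length : ℤ) ≤ (X i).level) : X t ∈ subtree w := by
  induction t, hst using Nat.le_induction with
  | base => exact hs
  | succ t hst ih =>
    by_contra hno
    have h1 := (hX.2 t).level_lt_of_notMem_subtree (ih fun i h1 h2 => h i h1 (by omega)) hno
    have h2 := h (t + 1) (by omega) le_rfl
    omega

lemma IsWalk.exists_first_level {X : ℕ → Vertex b} (hX : IsWalk X) {k n : ℕ}
    (hn : (k : ℤ) ≤ (X n).level) :
    ∃ m ≤ n, (X m).level = k ∧ ∀ i < m, (X i).level < k := by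
  classical
  have hex : ∃ n, (k : ℤ) ≤ (X n).level := ⟨n, hn⟩
  refine ⟨Nat.find hex, Nat.find_min' hex hn, le_antisymm ?_ (Nat.find_spec hex),
    fun i hi => not_le.1 (Nat.find_min hex hi)⟩
  rcases Nat.eq_zero_or_pos (Nat.find hex) with h0 | h0
  · rw [h0, hX.1]; simp [Vertex.root, Vertex.level]
  · have h := (hX.2 (Nat.find hex - 1)).level_le
    rw [Nat.sub_add_cancel h0] at h
    have := not_le.1 (Nat.find_min hex (m := Nat.find hex - 1) (by omega))
    omega

lemma exists_node_of_level {v : Vertex b} {k : ℕ} (h : v.level = k) :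
    ∃ w : List (Fin b), v = .node w ∧ w.length = k := by
  cases v with
  | rootParent => simp [Vertex.level] at h
  | node w => exact ⟨w, rfl, by simpa [Vertex.level] using h⟩

end

/-! ### Moment inequalities -/

section
variable {α : Type*} [MeasurableSpace α] {Q : Measure α}

lemma lintegral_Lp_sum_le {f : ℕ → α → ℝ≥0∞} (hf : ∀ i, Measurable (f i)) {q : ℝ} (hq : 1 ≤ q)
    (n : ℕ) :
    (∫⁻ x, (∑ i ∈ Finset.range n, f i x) ^ q ∂Q) ^ (1 / q) ≤
      ∑ i ∈ Finset.range n, (∫⁻ x, f i x ^ q ∂Q) ^ (1 / q) := by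
  have hq0 : 0 < q := by linarith
  induction n with
  | zero => simp [ENNReal.zero_rpow_of_pos, hq0]
  | succ n ih =>
    simp_rw [Finset.sum_range_succ]
    refine (ENNReal.lintegral_Lp_add_le (f := fun x => ∑ i ∈ Finset.range n, f i x)
      (Finset.measurable_fun_sum _ fun i _ => hf i).aemeasurable (hf n).aemeasurable hq).trans ?_
    gcongr

/-- Minkowski's inequality for countably many summands. -/
lemma lintegral_Lp_tsum_le {f : ℕ → α → ℝ≥0∞} (hf : ∀ i, Measurable (f i)) {q : ℝ} (hq : 1 ≤ q) :
    (∫⁻ x, (∑' i, f i x) ^ q ∂Q) ^ (1 / q) ≤ ∑' i, (∫⁻ x, f i x ^ q ∂Q) ^ (1 / q) := by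
  have hq0 : 0 < q := by linarith
  have hs : ∀ x, (∑' i, f i x) ^ q = ⨆ n, (∑ i ∈ Finset.range n, f i x) ^ q := fun x => by
    rw [ENNReal.tsum_eq_iSup_nat]
    exact (ENNReal.orderIsoRpow q hq0).map_iSup _
  simp_rw [hs]
  rw [lintegral_iSup (fun n => (Finset.measurable_fun_sum _ fun i _ => hf i).pow_const q)
    fun n m h x => ENNReal.rpow_le_rpow (Finset.sum_le_sum_of_subset
      (Finset.range_subset_range.2 h)) hq0.le]
  rw [show ∀ u : ℕ → ℝ≥0∞, (⨆ n, u n) ^ (1 / q) = ⨆ n, u n ^ (1 / q) from fun u =>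
    (ENNReal.orderIsoRpow (1 / q) (by positivity)).map_iSup u]
  exact iSup_le fun n => (lintegral_Lp_sum_le hf hq n).trans (ENNReal.sum_le_tsum _)

/-- Jensen's inequality for powers. -/
lemma lintegral_rpow_le_rpow_lintegral [IsProbabilityMeasure Q] {f : α → ℝ≥0∞}
    (hf : Measurable f) {p q : ℝ} (hp : 0 < p) (hpq : p ≤ q) :
    ∫⁻ x, f x ^ p ∂Q ≤ (∫⁻ x, f x ^ q ∂Q) ^ (p / q) := by
  have h := eLpNorm'_le_eLpNorm'_of_exponent_le hp hpq Q hf.aestronglyMeasurable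
  simp only [eLpNorm', enorm_eq_self] at h
  have h2 := ENNReal.rpow_le_rpow h hp.le
  rwa [← ENNReal.rpow_mul, ← ENNReal.rpow_mul, one_div_mul_cancel hp.ne', ENNReal.rpow_one,
    one_div, inv_mul_eq_div] at h2

/-- Hölder's inequality for the second moment on an event. -/
lemma lintegral_indicator_sq_le {f : α → ℝ≥0∞} (hf : Measurable f) {G : Set α}
    (hG : MeasurableSet G) {q : ℝ} (hq : 2 < q) :
    (∫⁻ x, G.indicator f x ^ (2 : ℝ) ∂Q) ^ (1 / (2 : ℝ)) ≤
      (∫⁻ x, f x ^ q ∂Q) ^ (1 / q) * Q G ^ (1 / 2 - 1 / q) := by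
  have hq0 : 0 < q := by linarith
  have hc : (q / 2).HolderConjugate (q / (q - 2)) := by
    rw [Real.holderConjugate_iff]
    refine ⟨by linarith, ?_⟩
    have : q - 2 ≠ 0 := by linarith
    field_simp
    ring
  have h := ENNReal.lintegral_mul_le_Lp_mul_Lq Q hc (f := fun x => f x ^ (2 : ℝ))
    (g := G.indicator 1) (hf.pow_const _).aemeasurable (measurable_one.indicator hG).aemeasurable
  have e1 : ∀ x, G.indicator f x ^ (2 : ℝ) = ((fun x => f x ^ (2 : ℝ)) * G.indicator 1 : α → ℝ≥0∞) x := by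
    intro x
    by_cases hx : x ∈ G <;> simp [hx]
  have e2 : ∀ x, (G.indicator 1 x : ℝ≥0∞) ^ (q / (q - 2)) = G.indicator 1 x := by
    intro x
    have : 0 < q / (q - 2) := div_pos hq0 (by linarith)
    by_cases hx : x ∈ G <;> simp [hx, this]
  simp_rw [e1]
  simp_rw [e2, ← ENNReal.rpow_mul] at h
  rw [lintegral_indicator_one hG, mul_div_cancel₀ q two_ne_zero] at h
  refine (ENNReal.rpow_le_rpow h (by norm_num : (0 : ℝ) ≤ 1 / 2)).trans_eq ?_
  rw [ENNReal.mul_rpow_of_nonneg _ _ (by norm_num), ← ENNReal.rpow_mul, ← ENNReal.rpow_mul]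
  have : q - 2 ≠ 0 := by linarith
  congr 2 <;> field_simp

end

/-- A fresh family has at most one event that occurs, so that powers can be taken termwise. -/
lemma IsFresh.tsum_indicator_rpow {b : ℕ} {S : ℕ → List (Fin b) → Set (ℕ → Vertex b)}
    (hS : IsFresh S) (Φ : ℕ × List (Fin b) → (ℕ → Vertex b) → ℝ≥0∞) {q : ℝ} (hq : 0 < q)
    (X : ℕ → Vertex b) :
    (∑' p : ℕ × List (Fin b), (S p.1 p.2).indicator (Φ p) X) ^ q =
      ∑' p : ℕ × List (Fin b), (S p.1 p.2).indicator (fun X => Φ p X ^ q) X := by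
  by_cases hX : ∃ p : ℕ × List (Fin b), X ∈ S p.1 p.2
  · obtain ⟨p, hp⟩ := hX
    have h : ∀ p' : ℕ × List (Fin b), p' ≠ p → X ∉ S p'.1 p'.2 := fun p' hne h' =>
      hne (hS.eq_of_mem h' hp)
    rw [tsum_eq_single p fun p' hne => Set.indicator_of_notMem (h p' hne) _,
      tsum_eq_single p fun p' hne => Set.indicator_of_notMem (h p' hne) _,
      Set.indicator_of_mem hp, Set.indicator_of_mem hp]
  · have h : ∀ p : ℕ × List (Fin b), X ∉ S p.1 p.2 := not_exists.1 hX
    simp [h, hq]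

/-! ### The number of visits to a level -/

/-- The number of visits to the vertices of level `k`. -/
noncomputable def levelVisits {b : ℕ} (k : ℕ) (X : ℕ → Vertex b) : ℝ≥0∞ :=
  ∑' n, {v : Vertex b | v.level = k}.indicator 1 (X n)

lemma measurable_levelVisits {b : ℕ} (k : ℕ) : Measurable (levelVisits (b := b) k) :=
  .tsum fun n =>
    (measurable_of_countable ({v : Vertex b | v.level = k}.indicator (1 : Vertex b → ℝ≥0∞))).comp
      (measurable_pi_apply n)

open Classical in
/-- The number of distinct vertices of level `k` seen before time `n`. -/
noncomputable def levelCount {b : ℕ} (k n : ℕ) (X : ℕ → Vertex b) : ℕ :=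
  (((Finset.range n).image X).filter fun v => v.level = (k : ℤ)).card

/-- The walk discovers at time `n` the vertex `w` of level `k`, after `j` others of this level. -/
def newVertex {b : ℕ} (k j n : ℕ) (w : List (Fin b)) : Set (ℕ → Vertex b) :=
  {X | X n = .node w ∧ w.length = k ∧ (∀ i < n, X i ∉ subtree w) ∧ levelCount k n X = j}

section
variable {b : ℕ}

lemma levelCount_congr {k n : ℕ} {X Y : ℕ → Vertex b} (h : ∀ i < n, X i = Y i) :
    levelCount k n X = levelCount k n Y := by
  classical
  rw [levelCount, levelCount, Finset.image_congr fun i hi => h i (by simpa using hi)]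

lemma levelCount_mono (k : ℕ) (X : ℕ → Vertex b) : Monotone fun n => levelCount k n X := by
  classical
  intro n m h
  exact Finset.card_le_card (Finset.filter_subset_filter _
    (Finset.image_subset_image (Finset.range_subset_range.2 h)))

lemma levelCount_succ_le (k n : ℕ) (X : ℕ → Vertex b) :
    levelCount k (n + 1) X ≤ levelCount k n X + 1 := by
  classical
  unfold levelCount
  rw [Finset.range_add_one, Finset.image_insert, Finset.filter_insert]
  split_ifs
  · exact Finset.card_insert_le _ _
  · omega

lemma levelCount_succ_of_new {k n : ℕ} {X : ℕ → Vertex b} (hk : (X n).level = k)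
    (h : ∀ i < n, X i ≠ X n) : levelCount k (n + 1) X = levelCount k n X + 1 := by
  classical
  unfold levelCount
  rw [Finset.range_add_one, Finset.image_insert, Finset.filter_insert, if_pos hk,
    Finset.card_insert_of_notMem]
  simpa using fun i hi h1 => absurd h1 (h i hi)

lemma new_of_levelCount_lt {k n : ℕ} {X : ℕ → Vertex b}
    (h : levelCount k n X < levelCount k (n + 1) X) :
    (X n).level = k ∧ ∀ i < n, X i ≠ X n := by
  classical
  unfold levelCount at h
  rw [Finset.range_add_one, Finset.image_insert, Finset.filter_insert] at h
  split_ifs at h with h1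
  · refine ⟨h1, fun i hi he => ?_⟩
    rw [Finset.insert_eq_of_mem] at h
    · exact lt_irrefl _ h
    · exact Finset.mem_filter.2 ⟨Finset.mem_image.2 ⟨i, Finset.mem_range.2 hi, he⟩, h1⟩
  · exact absurd h (lt_irrefl _)

lemma isFresh_newVertex (k j : ℕ) : IsFresh (newVertex (b := b) k j) where
  determined n w X Y h := by
    rintro ⟨h1, h2, h3, h4⟩
    refine ⟨by rw [← h n le_rfl, h1], h2, fun i hi => by rw [← h i hi.le]; exact h3 i hi, ?_⟩
    rw [← h4]
    exact levelCount_congr fun i hi => (h i hi.le).symm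
  at_vertex n w X h := h.1
  avoids n w X h := h.2.2.1
  disjoint := by
    have key : ∀ n w n' w', ∀ X : ℕ → Vertex b, X ∈ newVertex k j n w → X ∈ newVertex k j n' w' →
        ¬ n < n' := by
      rintro n w n' w' X ⟨h1, h2, h3, h4⟩ ⟨-, -, -, h4'⟩ hlt
      have h5 := levelCount_mono k X (Nat.succ_le_of_lt hlt)
      simp only [Nat.succ_eq_add_one] at h5
      rw [levelCount_succ_of_new (by rw [h1, level_node, h2])] at h5
      · omega
      · intro i hi he
        exact h3 i hi (by rw [he, h1]; exact node_mem_subtree.2 List.suffix_rfl)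
    exact fun n w n' w' X h h' => le_antisymm (not_lt.1 (key _ _ _ _ _ h' h))
      (not_lt.1 (key _ _ _ _ _ h h'))

/-- To discover another vertex of the level, the walk has to leave the subtree of the last one. -/
lemma IsWalk.newVertex_succ {X : ℕ → Vertex b} (hX : IsWalk X) {k j : ℕ}
    (h : X ∈ stopped (newVertex (b := b) k (j + 1))) :
    X ∈ ⋃ p : ℕ × List (Fin b), newVertex k j p.1 p.2 ∩
      shiftPath p.1 ⁻¹' {X | ∃ n, X n ∈ (subtree p.2)ᶜ} := by
  classical
  obtain ⟨⟨n, w⟩, h1, h2, h3, h4⟩ := Set.mem_iUnion.1 h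
  simp only at h1 h2 h3 h4
  have hex : ∃ m, j + 1 ≤ levelCount k m X := ⟨n, h4.ge⟩
  obtain ⟨m, hm⟩ : ∃ m, Nat.find hex = m + 1 := by
    refine Nat.exists_eq_add_one.2 (Nat.pos_of_ne_zero fun h0 => ?_)
    have := Nat.find_spec hex
    rw [h0] at this
    simp [levelCount] at this
  have hspec := Nat.find_spec hex
  rw [hm] at hspec
  have hmn : m + 1 ≤ n := hm ▸ Nat.find_min' hex h4.ge
  have hlt : levelCount k m X < j + 1 := not_le.1 (Nat.find_min hex (by omega))
  have hle := levelCount_succ_le k m X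
  obtain ⟨hl, hnew⟩ := new_of_levelCount_lt (hlt.trans_le hspec)
  obtain ⟨w', hw', hlen⟩ := exists_node_of_level hl
  have hj : levelCount k m X = j := by omega
  refine Set.mem_iUnion.2 ⟨(m, w'), ⟨hw', hlen, fun i hi hmem => ?_, hj⟩, n - m, ?_⟩
  · obtain ⟨i', hi', he, -⟩ := hX.exists_entrance hmem
    exact hnew i' (by omega) (he.trans hw'.symm)
  · simp only [shiftPath, Set.mem_compl_iff]
    rw [show m + (n - m) = n by omega, h1]
    intro hmem
    have := eq_of_mem_subtree_of_level hmem (by rw [level_node, h2, hlen])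
    exact h3 m (by omega) (by rw [hw', ← this]; exact node_mem_subtree.2 List.suffix_rfl)

lemma pathLaw_newVertex_le (μ : Measure (Weights b)) [IsProbabilityMeasure μ] (k j : ℕ) :
    pathLaw μ (stopped (newVertex k j)) ≤ failProb μ ^ j := by
  induction j with
  | zero => simpa using prob_le_one
  | succ j ih =>
    refine (measure_mono_ae ?_).trans
      (((isFresh_newVertex k j).pathLaw_exit_le μ).trans ((mul_le_mul_left ih _).trans_eq (pow_succ _ _).symm))
    filter_upwards [ae_isWalk μ] with X hX h
    exact hX.newVertex_succ h

lemma visits_le_shiftPath {v : Vertex b} {m : ℕ} {X : ℕ → Vertex b} (h : ∀ i < m, X i ≠ v) :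
    visits v X ≤ visits v (shiftPath m X) := by
  unfold visits
  rw [← ENNReal.summable.sum_add_tsum_nat_add' (k := m), Finset.sum_eq_zero, zero_add]
  · simp only [shiftPath, add_comm]; exact le_rfl
  · intro i hi
    simp [h i (Finset.mem_range.1 hi)]

lemma levelVisits_eq_tsum (k : ℕ) (X : ℕ → Vertex b) :
    levelVisits k X = ∑' w : List (Fin b), if w.length = k then visits (.node w) X else 0 := by
  classical
  have : ∀ w : List (Fin b), (if w.length = k then visits (.node w) X else 0) =
      ∑' n, if w.length = k ∧ X n = .node w then 1 else 0 := by
    intro w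
    split_ifs with h
    · simp [visits, h, Set.indicator_apply]
    · simp [h]
  simp_rw [this]
  rw [ENNReal.tsum_comm, levelVisits]
  refine tsum_congr fun n => ?_
  by_cases h : (X n).level = k
  · obtain ⟨w, hw, hl⟩ := exists_node_of_level h
    rw [tsum_eq_single w]
    · simp [hw, hl, level_node]
    · intro w' hne
      rw [if_neg]
      rintro ⟨-, h'⟩
      rw [hw, Vertex.node.injEq] at h'
      exact hne h'.symm
  · rw [Set.indicator_of_notMem (by exact h)]
    symm
    rw [ENNReal.tsum_eq_zero]
    intro w
    rw [if_neg]
    rintro ⟨h1, h2⟩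
    exact h (by rw [h2, level_node, h1])

/-- The visits to a level are spread over the successively discovered vertices of this level. -/
lemma IsWalk.levelVisits_le {X : ℕ → Vertex b} (hX : IsWalk X) (k : ℕ) :
    levelVisits k X ≤ ∑' (j : ℕ) (p : ℕ × List (Fin b)), (newVertex k j p.1 p.2).indicator
      (fun X => visits (.node p.2) (shiftPath p.1 X)) X := by
  have e : ∀ j, ∑' p : ℕ × List (Fin b), (newVertex k j p.1 p.2).indicator
      (fun X => visits (.node p.2) (shiftPath p.1 X)) X =
      ∑' (w : List (Fin b)) (n : ℕ), (newVertex k j n w).indicator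
      (fun X => visits (.node w) (shiftPath n X)) X := fun j => by
    rw [ENNReal.tsum_comm, ← ENNReal.tsum_prod]
  simp_rw [e]
  rw [ENNReal.tsum_comm, levelVisits_eq_tsum]
  refine ENNReal.tsum_le_tsum fun w => ?_
  split_ifs with hw
  · by_cases h : ∃ n, X n = .node w
    · obtain ⟨n, hn⟩ := h
      obtain ⟨m, -, hm, hav⟩ := hX.exists_entrance (w := w) (n := n)
        (by rw [hn]; exact node_mem_subtree.2 List.suffix_rfl)
      refine le_trans ?_ (ENNReal.le_tsum (levelCount k m X))
      refine le_trans ?_ (ENNReal.le_tsum m)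
      rw [Set.indicator_of_mem (show X ∈ newVertex k _ m w from ⟨hm, hw, hav, rfl⟩)]
      exact visits_le_shiftPath fun i hi he =>
        hav i hi (by rw [he]; exact node_mem_subtree.2 List.suffix_rfl)
    · rw [not_exists] at h
      simp [visits, h]
  · exact zero_le

/-- The number of visits to a level has a `q`-th moment that is bounded uniformly in the level. -/
lemma exists_lintegral_levelVisits_le (μ : Measure (Weights b)) [IsProbabilityMeasure μ]
    (hρ : failProb μ < 1) {q : ℝ} (hq : 1 ≤ q) (hq3 : q ≤ 3)
    (hγ : ∫⁻ ω, (ENNReal.ofReal (neverBack ω))⁻¹ ^ q ∂(envLaw μ) < ∞) :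
    ∃ C < ∞, ∀ k, (∫⁻ X, levelVisits k X ^ q ∂(pathLaw μ)) ^ (1 / q) ≤ C := by
  have hq0 : 0 < q := by linarith
  set g : Env b → ℝ≥0∞ := fun ω => 6 ^ (q / 3) * (ENNReal.ofReal (neverBack ω))⁻¹ ^ q with hg
  have hgm : Measurable g := by
    have := measurable_neverBack (b := b)
    fun_prop
  have hle : ∀ (ω : Env b) w, ∫⁻ X, visits (.node w) X ^ q ∂(quenchedLaw (.node w) ω) ≤
      g (shiftEnv w ω) := by
    intro ω w
    refine (lintegral_rpow_le_rpow_lintegral (measurable_visits _) hq0 hq3).trans ?_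
    have h := lintegral_visits_pow_three_le ω w
    simp_rw [← ENNReal.rpow_natCast] at h
    push_cast at h
    refine (ENNReal.rpow_le_rpow h (by positivity)).trans_eq ?_
    rw [hg, ENNReal.mul_rpow_of_nonneg _ _ (by positivity), ← ENNReal.rpow_mul,
      mul_div_cancel₀ q three_ne_zero]
  have hG : ∫⁻ ω, g ω ∂(envLaw μ) < ∞ := by
    have := measurable_neverBack (b := b)
    rw [lintegral_const_mul _ (by fun_prop)]
    exact ENNReal.mul_lt_top (ENNReal.rpow_lt_top_of_nonneg (by positivity) (by norm_num)) hγ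
  refine ⟨∑' j : ℕ, (failProb μ ^ j * ∫⁻ ω, g ω ∂(envLaw μ)) ^ (1 / q), ?_, fun k => ?_⟩
  · have : ∀ j : ℕ, (failProb μ ^ j * ∫⁻ ω, g ω ∂(envLaw μ)) ^ (1 / q) =
        (failProb μ ^ (1 / q)) ^ j * (∫⁻ ω, g ω ∂(envLaw μ)) ^ (1 / q) := fun j => by
      rw [ENNReal.mul_rpow_of_nonneg _ _ (by positivity), ← ENNReal.rpow_natCast,
        ← ENNReal.rpow_natCast, ← ENNReal.rpow_mul, ← ENNReal.rpow_mul, mul_comm (j : ℝ)]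
    simp_rw [this]
    rw [ENNReal.tsum_mul_right, ENNReal.tsum_geometric]
    refine ENNReal.mul_lt_top (ENNReal.inv_lt_top.2 (tsub_pos_of_lt ?_))
      (ENNReal.rpow_lt_top_of_nonneg (by positivity) hG.ne)
    exact ENNReal.rpow_lt_one hρ (by positivity)
  · have hm : ∀ j, Measurable fun X : ℕ → Vertex b => ∑' p : ℕ × List (Fin b),
        (newVertex k j p.1 p.2).indicator
          (fun X => visits (.node p.2) (shiftPath p.1 X)) X := fun j => .tsum fun p =>
      ((measurable_visits _).comp (measurable_shiftPath _)).indicator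
        ((isFresh_newVertex k j).measurableSet _ _)
    refine le_trans ?_ ((lintegral_Lp_tsum_le (Q := pathLaw μ) hm hq).trans
      (ENNReal.tsum_le_tsum fun j => ?_))
    · refine ENNReal.rpow_le_rpow (lintegral_mono_ae ?_) (by positivity)
      filter_upwards [ae_isWalk μ] with X hX
      exact ENNReal.rpow_le_rpow (hX.levelVisits_le k) hq0.le
    · refine ENNReal.rpow_le_rpow ?_ (by positivity)
      simp_rw [(isFresh_newVertex k j).tsum_indicator_rpow _ hq0]
      exact ((isFresh_newVertex k j).lintegral_le μ (Φ := fun w X => visits (.node w) X ^ q)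
        (fun w => (measurable_visits _).pow_const q) hgm hle).trans
        (mul_le_mul_left (pathLaw_newVertex_le μ k j) _)

end

section
variable {b : ℕ}

/-- The number of times in a set `T` is bounded by the visits to the levels that the walk occupies
at these times. A visit to the parent of the root is charged to the visit to the root that follows,
whence the factor `2`. -/
lemma IsWalk.tsum_indicator_le {X : ℕ → Vertex b} (hX : IsWalk X) {T : Set ℕ} {c : ℕ → ℝ≥0∞}
    (h : ∀ n ∈ T, 1 ≤ c (X n).level.toNat) :
    ∑' n, T.indicator 1 n ≤ ∑' k, 2 * (levelVisits k X * c k) := by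
  set e : ℕ → Vertex b → ℝ≥0∞ := fun k => {v : Vertex b | v.level = k}.indicator 1 with he
  have hek : ∀ (k : ℕ) (v : Vertex b), v.level = k → 1 ≤ e k v := fun k v hv => by
    simp only [he]
    rw [Set.indicator_of_mem (by exact hv)]
    exact le_rfl
  have h1 : ∀ n, T.indicator (1 : ℕ → ℝ≥0∞) n ≤ ∑' k, (e k (X n) + e k (X (n + 1))) * c k := by
    intro n
    by_cases hn : n ∈ T
    · rw [Set.indicator_of_mem hn]
      refine le_trans ?_ (ENNReal.le_tsum (X n).level.toNat)
      refine le_trans (mul_one (1 : ℝ≥0∞)).ge (mul_le_mul' ?_ (h n hn))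
      · have hs := hX.2 n
        cases hv : X n with
        | rootParent =>
          rw [hv] at hs
          rw [show X (n + 1) = Vertex.root from hs]
          exact (hek _ _ (by simp [Vertex.root, Vertex.level])).trans le_add_self
        | node w =>
          exact (hek _ _ (by simp [Vertex.level])).trans le_self_add
    · rw [Set.indicator_of_notMem hn]; exact zero_le
  refine (ENNReal.tsum_le_tsum h1).trans ?_
  rw [ENNReal.tsum_comm]
  refine ENNReal.tsum_le_tsum fun k => ?_
  rw [ENNReal.tsum_mul_right, ← mul_assoc, ENNReal.tsum_add, two_mul]
  exact mul_le_mul_left (add_le_add le_rfl (ENNReal.tsum_comp_le_tsum_of_injective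
    (add_left_injective 1) fun n => e k (X n))) _

lemma ae_levelVisits_lt_top (μ : Measure (Weights b)) [IsProbabilityMeasure μ] {q : ℝ}
    (hq : 0 < q) {C : ℝ≥0∞} (hC : C < ∞)
    (h : ∀ k, (∫⁻ X, levelVisits k X ^ q ∂(pathLaw μ)) ^ (1 / q) ≤ C) :
    ∀ᵐ X ∂(pathLaw μ), ∀ k, levelVisits k X < ∞ := by
  refine ae_all_iff.2 fun k => ?_
  have h1 : ∫⁻ X, levelVisits k X ^ q ∂(pathLaw μ) < ∞ :=
    (ENNReal.rpow_lt_top_iff_of_pos (by positivity)).1 ((h k).trans_lt hC)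
  filter_upwards [ae_lt_top ((measurable_levelVisits k).pow_const q) h1.ne] with X hX
  exact (ENNReal.rpow_lt_top_iff_of_pos hq).1 hX

/-- A walk with finitely many visits to each level reaches all levels. -/
lemma IsWalk.exists_level_ge {X : ℕ → Vertex b} (hX : IsWalk X)
    (h : ∀ k, levelVisits k X < ∞) (k : ℕ) : ∃ n, (k : ℤ) ≤ (X n).level := by
  by_contra! hno
  have h1 := hX.tsum_indicator_le (T := Set.univ) (c := fun i => if i < k + 1 then 1 else 0)
    fun n _ => by
      have := hno n
      rw [if_pos (by omega)]
  have h2 : ∑' i, 2 * (levelVisits i X * if i < k + 1 then 1 else 0) < ∞ := by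
    rw [tsum_eq_sum (s := Finset.range (k + 1)) fun i hi => by
      rw [if_neg (by simpa using hi), mul_zero, mul_zero]]
    refine ENNReal.sum_lt_top.2 fun i hi => ?_
    rw [if_pos (by simpa using hi), mul_one]
    exact ENNReal.mul_lt_top (by norm_num) (h i)
  have h3 : ∑' n : ℕ, (Set.univ : Set ℕ).indicator (1 : ℕ → ℝ≥0∞) n = ∞ := by
    simp
  exact absurd (h1.trans_lt h2) (by rw [h3]; exact lt_irrefl _)

/-! ### Levels without cut times -/

/-- The walk hits the level `a + J m` for the first time at time `n`, in the vertex `w`, and for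
each `j < J` it has gone from the level `a + j m` to lower levels before hitting the level
`a + (j + 1) m`. -/
def blockEvent (a m J n : ℕ) (w : List (Fin b)) : Set (ℕ → Vertex b) :=
  {X | X n = .node w ∧ w.length = a + J * m ∧ (∀ i < n, (X i).level < (a + J * m : ℕ)) ∧
    ∀ j < J, ∃ s t, s ≤ t ∧ t < n ∧ (X s).level = (a + j * m : ℕ) ∧
      (X t).level < (a + j * m : ℕ) ∧ ∀ i ≤ t, (X i).level < (a + (j + 1) * m : ℕ)}

lemma isFresh_blockEvent (a m J : ℕ) : IsFresh (blockEvent (b := b) a m J) where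
  determined n w X Y h := by
    rintro ⟨h1, h2, h3, h4⟩
    refine ⟨by rw [← h n le_rfl, h1], h2, fun i hi => by rw [← h i hi.le]; exact h3 i hi,
      fun j hj => ?_⟩
    obtain ⟨s, t, hst, ht, h5, h6, h7⟩ := h4 j hj
    exact ⟨s, t, hst, ht, by rw [← h s (by omega), h5], by rw [← h t (by omega)]; exact h6,
      fun i hi => by rw [← h i (by omega)]; exact h7 i hi⟩
  at_vertex n w X h := h.1
  avoids := by
    rintro n w X ⟨-, h2, h3, -⟩ i hi hmem
    have := subtree_level_le hmem
    have := h3 i hi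
    omega
  disjoint := by
    have key : ∀ n w n' w', ∀ X : ℕ → Vertex b, X ∈ blockEvent a m J n w →
        X ∈ blockEvent a m J n' w' → ¬ n < n' := by
      rintro n w n' w' X ⟨h1, h2, -, -⟩ ⟨-, -, h3, -⟩ hlt
      have := h3 n hlt
      rw [h1, level_node] at this
      omega
    exact fun n w n' w' X h h' => le_antisymm (not_lt.1 (key _ _ _ _ _ h' h))
      (not_lt.1 (key _ _ _ _ _ h h'))

/-- The backward excursion of the block leaves the subtree of the vertex where the block is
entered. -/
lemma IsWalk.blockEvent_succ {X : ℕ → Vertex b} (hX : IsWalk X) {a m J : ℕ}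
    (h : X ∈ stopped (blockEvent (b := b) a m (J + 1))) :
    X ∈ ⋃ p : ℕ × List (Fin b), blockEvent a m J p.1 p.2 ∩
      shiftPath p.1 ⁻¹' {X | ∃ n, X n ∈ (subtree p.2)ᶜ} := by
  obtain ⟨⟨n, w⟩, h1, h2, h3, h4⟩ := Set.mem_iUnion.1 h
  simp only at h1 h2 h3 h4
  obtain ⟨s, t, hst, htn, hs, ht, -⟩ := h4 J (by omega)
  obtain ⟨T, hTs, hT, hbefore⟩ := hX.exists_first_level hs.ge
  obtain ⟨w', hw', hlen⟩ := exists_node_of_level hT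
  refine Set.mem_iUnion.2 ⟨(T, w'), ⟨hw', hlen, hbefore, fun j hj => ?_⟩, t - T, ?_⟩
  · obtain ⟨s', t', hst', htn', hs', ht', hi'⟩ := h4 j (by omega)
    refine ⟨s', t', hst', not_le.1 fun hle => ?_, hs', ht', hi'⟩
    have h5 := hi' T hle
    rw [hT] at h5
    have : (j + 1) * m ≤ J * m := Nat.mul_le_mul_right m hj
    omega
  · simp only [shiftPath, Set.mem_compl_iff]
    rw [show T + (t - T) = t by omega]
    intro hmem
    have := subtree_level_le hmem
    omega

lemma pathLaw_blockEvent_le (μ : Measure (Weights b)) [IsProbabilityMeasure μ] (a m J : ℕ) :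
    pathLaw μ (stopped (blockEvent a m J)) ≤ failProb μ ^ J := by
  induction J with
  | zero => simpa using prob_le_one
  | succ J ih =>
    refine (measure_mono_ae ?_).trans (((isFresh_blockEvent a m J).pathLaw_exit_le μ).trans
      ((mul_le_mul_left ih _).trans_eq (pow_succ _ _).symm))
    filter_upwards [ae_isWalk μ] with X hX h
    exact hX.blockEvent_succ h

/-- The walk reaches the depth `m` in the subtree of `w` and leaves this subtree later. -/
def deepExit (m : ℕ) (w : List (Fin b)) : Set (ℕ → Vertex b) :=
  {X | ∃ n t, X n ∈ {v | ∃ u : List (Fin b), u.length = m ∧ v = .node (u ++ w)} ∧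
    X (n + t) ∈ (subtree w)ᶜ}

lemma measurableSet_deepExit (m : ℕ) (w : List (Fin b)) : MeasurableSet (deepExit m w) := by
  have : deepExit m w = ⋃ n, ⋃ t,
      {X | X n ∈ {v | ∃ u : List (Fin b), u.length = m ∧ v = .node (u ++ w)}} ∩
        {X | X (n + t) ∈ (subtree w)ᶜ} := by
    ext X; simp [deepExit]
  rw [this]
  exact .iUnion fun n => .iUnion fun t =>
    ((measurable_pi_apply (X := fun _ : ℕ => Vertex b) n) (.of_discrete)).inter
      ((measurable_pi_apply (X := fun _ : ℕ => Vertex b) (n + t)) (.of_discrete))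

/-- If no time with a level in `[a, a + J m)` is a cut time, then the walk has a backward excursion
in each of the `J` blocks of `m` levels, unless one of these excursions starts after the block is
crossed. -/
lemma IsWalk.mem_blockEvent_or {X : ℕ → Vertex b} (hX : IsWalk X)
    (hlev : ∀ k : ℕ, ∃ n, (k : ℤ) ≤ (X n).level) {a m J : ℕ} (hm : 0 < m)
    (h : ∀ n, (a : ℤ) ≤ (X n).level → (X n).level < (a + J * m : ℕ) → ¬ IsCutTime X n) :
    X ∈ stopped (blockEvent a m J) ∨ ∃ j < J, X ∈ ⋃ p : ℕ × List (Fin b),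
      blockEvent (a + j * m) m 0 p.1 p.2 ∩ shiftPath p.1 ⁻¹' deepExit m p.2 := by
  by_cases hE : ∀ j < J, ∃ s t, s ≤ t ∧ (X s).level = (a + j * m : ℕ) ∧
      (X t).level < (a + j * m : ℕ) ∧ ∀ i ≤ t, (X i).level < (a + (j + 1) * m : ℕ)
  · left
    obtain ⟨n, hn⟩ := hlev (a + J * m)
    obtain ⟨T, -, hT, hbefore⟩ := hX.exists_first_level hn
    obtain ⟨w, hw, hlen⟩ := exists_node_of_level hT
    refine Set.mem_iUnion.2 ⟨(T, w), hw, hlen, hbefore, fun j hj => ?_⟩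
    obtain ⟨s, t, hst, hs, ht, hi⟩ := hE j hj
    refine ⟨s, t, hst, not_le.1 fun hle => ?_, hs, ht, hi⟩
    have h5 := hi T hle
    rw [hT] at h5
    have : (j + 1) * m ≤ J * m := Nat.mul_le_mul_right m hj
    omega
  · right
    simp only [not_forall] at hE
    obtain ⟨j, hj, hE⟩ := hE
    have hjm : (j + 1) * m ≤ J * m := Nat.mul_le_mul_right m hj
    have hjm' : (j + 1) * m = j * m + m := by ring
    obtain ⟨n, hn⟩ := hlev (a + j * m)
    obtain ⟨T, -, hT, hbefore⟩ := hX.exists_first_level hn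
    obtain ⟨w, hw, hlen⟩ := exists_node_of_level hT
    obtain ⟨t, hTt, ht⟩ : ∃ t ≥ T, (X t).level < (X T).level := by
      by_contra! hno
      exact h T (by omega) (by omega) ⟨fun i hi => by rw [hT]; exact hbefore i hi, hno⟩
    have hno : ∀ t ≥ T, (X t).level < (a + j * m : ℕ) →
        ∃ i ≤ t, ((a + (j + 1) * m : ℕ) : ℤ) ≤ (X i).level := fun t hTt ht => by
      by_contra! hno
      exact hE ⟨T, t, hTt, hT, ht, hno⟩
    obtain ⟨i, hit, hi⟩ := hno t hTt (by omega)
    obtain ⟨T', hT'i, hT', hbefore'⟩ := hX.exists_first_level hi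
    have hTT' : T ≤ T' := not_lt.1 fun hlt => by
      have := hbefore T' hlt
      omega
    have hmem : X T' ∈ subtree w := hX.mem_subtree hTT'
      (by rw [hw]; exact node_mem_subtree.2 List.suffix_rfl) fun i h1 h2 => by
        by_contra! hlt
        rw [hlen] at hlt
        obtain ⟨i', hi', hle⟩ := hno i h1 hlt
        rcases lt_or_eq_of_le (hi'.trans h2) with h3 | h3
        · have := hbefore' i' h3
          omega
        · have : i = T' := by omega
          rw [this] at hlt
          omega
    obtain ⟨u, hu⟩ := hmem
    refine ⟨j, hj, Set.mem_iUnion.2 ⟨(T, w), ⟨hw, by simpa using hlen, by simpa using hbefore,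
      fun j hj => absurd hj (Nat.not_lt_zero j)⟩, T' - T, t - T', ⟨u, ?_, ?_⟩, ?_⟩⟩
    · rw [hu, level_node, List.length_append] at hT'
      omega
    · simp only [shiftPath]
      rw [show T + (T' - T) = T' by omega, hu]
    · simp only [shiftPath, Set.mem_compl_iff]
      rw [show T + (T' - T + (t - T')) = t by omega]
      intro hmem
      have := subtree_level_le hmem
      omega

lemma quenchedLaw_deepExit_le (σ : Fin b → Fin b) {r : ℕ} (hr : 1 ≤ r) (m : ℕ) (ω : Env b)
    (w : List (Fin b)) :
    quenchedLaw (.node w) ω (deepExit m w) ≤ retSum σ r m (shiftEnv w ω) ^ (1 / (r : ℝ)) := by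
  refine quenchedLaw_hit_hit_le ω _ _ _ ?_ _
  rintro v ⟨u, hu, rfl⟩
  refine (quenchedLaw_exit_subtree_le ω u w).trans ?_
  have h := ENNReal.rpow_le_rpow (ret_pow_le_retSum σ r u (shiftEnv w ω))
    (by positivity : 0 ≤ 1 / (r : ℝ))
  have hr0 : (r : ℝ) ≠ 0 := by positivity
  rwa [← ENNReal.rpow_natCast, ← ENNReal.rpow_mul, mul_one_div_cancel hr0, ENNReal.rpow_one, hu] at h

/-- No time with a level in `[a, a + J m)` is a cut time. -/
def noCut (a m J : ℕ) : Set (ℕ → Vertex b) :=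
  {X | ∀ n, (a : ℤ) ≤ (X n).level → (X n).level < (a + J * m : ℕ) → ¬ IsCutTime X n}

/-- The two terms bound the two cases of `IsWalk.mem_blockEvent_or`. -/
lemma pathLaw_noCut_le (μ : Measure (Weights b)) [IsProbabilityMeasure μ]
    (hlev : ∀ᵐ X ∂(pathLaw μ), ∀ k, levelVisits k X < ∞) {σ : Fin b → Fin b} {r : ℕ} (hr : 1 ≤ r)
    (hret : ∀ n, ∫⁻ ω, retSum σ r n ω ∂(envLaw μ) ≤ 2⁻¹ ^ n) (a : ℕ) {m : ℕ} (hm : 0 < m)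
    (J : ℕ) :
    pathLaw μ (noCut a m J) ≤ failProb μ ^ J + J * (2⁻¹ ^ (1 / (r : ℝ))) ^ m := by
  set R : ℕ → Set (ℕ → Vertex b) := fun j => ⋃ p : ℕ × List (Fin b),
    blockEvent (a + j * m) m 0 p.1 p.2 ∩ shiftPath p.1 ⁻¹' deepExit m p.2 with hR
  have hRle : ∀ j, pathLaw μ (R j) ≤ (2⁻¹ ^ (1 / (r : ℝ))) ^ m := fun j => by
    refine ((isFresh_blockEvent (a + j * m) m 0).pathLaw_le μ
      (fun w => measurableSet_deepExit m w) ((measurable_retSum σ r m).pow_const (1 / (r : ℝ)))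
      fun ω w => quenchedLaw_deepExit_le σ hr m ω w).trans ?_
    refine (mul_le_mul_left prob_le_one _).trans ?_
    rw [one_mul]
    refine (lintegral_rpow_le_rpow_lintegral (measurable_retSum σ r m) (p := 1 / r) (q := 1)
      (by positivity) (by rw [div_le_one (by positivity)]; exact_mod_cast hr)).trans ?_
    simp only [ENNReal.rpow_one, div_one]
    refine (ENNReal.rpow_le_rpow (hret m) (by positivity)).trans_eq ?_
    rw [← ENNReal.rpow_natCast, ← ENNReal.rpow_natCast, ← ENNReal.rpow_mul, ← ENNReal.rpow_mul,
      mul_comm]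
  have hsub : pathLaw μ (noCut a m J) ≤
      pathLaw μ (stopped (blockEvent a m J) ∪ ⋃ j ∈ Finset.range J, R j) := by
    refine measure_mono_ae ?_
    filter_upwards [ae_isWalk μ, hlev] with X hX hl h
    rcases hX.mem_blockEvent_or (hX.exists_level_ge hl) hm h with h | ⟨j, hj, h⟩
    · exact Or.inl h
    · exact Or.inr (Set.mem_biUnion (Finset.mem_coe.2 (Finset.mem_range.2 hj)) h)
  refine hsub.trans ((measure_union_le _ _).trans (add_le_add (pathLaw_blockEvent_le μ a m J) ?_))
  refine (measure_biUnion_finset_le _ _).trans ((Finset.sum_le_sum fun j _ => hRle j).trans_eq ?_)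
  simp

end

/-- There is at most one positive cut time with level at most `k`. -/
def atMostOneCut {b : ℕ} (k : ℕ) : Set (ℕ → Vertex b) :=
  {X | ∀ s t, 0 < s → s < t → IsCutTime X s → IsCutTime X t → (k : ℤ) < (X t).level}

section
variable {b : ℕ}

lemma measurableSet_atMostOneCut (k : ℕ) : MeasurableSet (atMostOneCut (b := b) k) := by
  have : atMostOneCut (b := b) k = ⋂ s, ⋂ t, ⋂ (_ : 0 < s), ⋂ (_ : s < t),
      ({X | IsCutTime X s}ᶜ ∪ ({X | IsCutTime X t}ᶜ ∪ {X | (k : ℤ) < (X t).level})) := by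
    ext X
    simp only [atMostOneCut, Set.mem_ofPred_eq, Set.mem_iInter, Set.mem_union, Set.mem_compl_iff,
      imp_iff_not_or]
  rw [this]
  exact .iInter fun s => .iInter fun t => .iInter fun _ => .iInter fun _ =>
    (measurableSet_isCutTime s).compl.union ((measurableSet_isCutTime t).compl.union
      ((measurable_pi_apply (X := fun _ : ℕ => Vertex b) t)
        (MeasurableSet.of_discrete (s := {v : Vertex b | (k : ℤ) < v.level}))))

/-- Two disjoint stretches of `J * m` levels cannot both contain cut times. The first one starts at
level `1`, which excludes the time `0`. -/
lemma IsWalk.noCut_of_atMostOneCut {X : ℕ → Vertex b} (hX : IsWalk X) {k m J : ℕ}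
    (hk : 2 * (J * m) ≤ k) (h : X ∈ atMostOneCut k) :
    X ∈ noCut 1 m J ∪ noCut (1 + J * m) m J := by
  by_contra hno
  rw [Set.mem_union, not_or] at hno
  simp only [noCut, Set.mem_ofPred_eq, not_forall, not_not] at hno
  obtain ⟨⟨s, hs1, hs2, hs⟩, t, ht1, ht2, ht⟩ := hno
  have h0 : (X 0).level = 0 := by rw [hX.1]; rfl
  have hs0 : 0 < s := Nat.pos_of_ne_zero fun h => by
    rw [h, h0] at hs1
    omega
  have hst : s < t := by
    rcases lt_trichotomy s t with h1 | rfl | h1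
    · exact h1
    · omega
    · have := hs.1 t h1
      omega
  have := h s t hs0 hst hs ht
  omega

lemma pathLaw_atMostOneCut_le (μ : Measure (Weights b)) [IsProbabilityMeasure μ]
    (hlev : ∀ᵐ X ∂(pathLaw μ), ∀ k, levelVisits k X < ∞) {σ : Fin b → Fin b} {r : ℕ} (hr : 1 ≤ r)
    (hret : ∀ n, ∫⁻ ω, retSum σ r n ω ∂(envLaw μ) ≤ 2⁻¹ ^ n) {k J : ℕ} (hk : 2 * (J * J) ≤ k) :
    pathLaw μ (atMostOneCut k) ≤
      2 * ((J + 1) * (failProb μ ⊔ 2⁻¹ ^ (1 / (r : ℝ))) ^ J) := by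
  rcases Nat.eq_zero_or_pos J with rfl | hJ
  · refine prob_le_one.trans ?_
    simp
  set η := failProb μ ⊔ 2⁻¹ ^ (1 / (r : ℝ)) with hη
  have key : ∀ a, pathLaw μ (noCut a J J) ≤ (J + 1) * η ^ J := fun a => by
    refine (pathLaw_noCut_le μ hlev hr hret a hJ J).trans ?_
    rw [add_mul, one_mul, add_comm]
    gcongr
    · exact le_sup_right
    · exact le_sup_left
  calc pathLaw μ (atMostOneCut k) ≤ pathLaw μ (noCut 1 J J ∪ noCut (1 + J * J) J J) := by
        refine measure_mono_ae ?_
        filter_upwards [ae_isWalk μ] with X hX h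
        exact hX.noCut_of_atMostOneCut hk h
    _ ≤ pathLaw μ (noCut 1 J J) + pathLaw μ (noCut (1 + J * J) J J) := measure_union_le _ _
    _ ≤ _ := by rw [two_mul]; exact add_le_add (key _) (key _)

lemma summable_sqrt_mul_pow {y : ℝ} (hy : 0 ≤ y) (hy1 : y < 1) :
    Summable fun k : ℕ => 2 * (((Nat.sqrt (k / 2) : ℝ) + 1) * y ^ Nat.sqrt (k / 2)) := by
  obtain ⟨B, hB⟩ : ∃ B, ∀ n : ℕ, (n : ℝ) ^ 5 * y ^ n ≤ B := by
    obtain ⟨B, hB⟩ := (tendsto_pow_const_mul_const_pow_of_abs_lt_one 5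
      (by rwa [abs_of_nonneg hy])).bddAbove_range
    exact ⟨B, fun n => hB ⟨n, rfl⟩⟩
  have hB0 : 0 ≤ B := by simpa using hB 0
  have hD : ∀ n : ℕ, ((n : ℝ) + 1) ^ 5 * y ^ n ≤ 32 * B + 1 := fun n => by
    rcases Nat.eq_zero_or_pos n with rfl | hn
    · simpa using hB0
    · have h1 : (1 : ℝ) ≤ n := by exact_mod_cast hn
      calc ((n : ℝ) + 1) ^ 5 * y ^ n ≤ (2 * n) ^ 5 * y ^ n := by gcongr; linarith
        _ = 32 * (n ^ 5 * y ^ n) := by ring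
        _ ≤ 32 * B + 1 := by linarith [hB n]
  have hsum : Summable fun k : ℕ => (32 * B + 1) * 8 * (1 / ((k + 1 : ℕ) : ℝ) ^ 2) :=
    (((summable_nat_add_iff 1).2 (Real.summable_one_div_nat_pow.2 one_lt_two))).mul_left _
  refine hsum.of_nonneg_of_le (fun k => by positivity) fun k => ?_
  set J := Nat.sqrt (k / 2)
  have hk : k + 1 ≤ 2 * (J + 1) ^ 2 := by
    have : k / 2 < (J + 1) * (J + 1) := Nat.lt_succ_sqrt (k / 2)
    rw [pow_two]
    omega
  have hk' : ((k + 1 : ℕ) : ℝ) ≤ 2 * ((J : ℝ) + 1) ^ 2 := by exact_mod_cast hk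
  have h2 : ((k + 1 : ℕ) : ℝ) ^ 2 ≤ 4 * ((J : ℝ) + 1) ^ 4 := by
    calc ((k + 1 : ℕ) : ℝ) ^ 2 ≤ (2 * ((J : ℝ) + 1) ^ 2) ^ 2 := by gcongr
      _ = _ := by ring
  rw [mul_one_div, le_div_iff₀ (by positivity)]
  calc 2 * (((J : ℝ) + 1) * y ^ J) * ((k + 1 : ℕ) : ℝ) ^ 2
      ≤ 2 * (((J : ℝ) + 1) * y ^ J) * (4 * ((J : ℝ) + 1) ^ 4) := by gcongr
    _ = ((J + 1) ^ 5 * y ^ J) * 8 := by ring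
    _ ≤ _ := by gcongr; exact hD J

lemma tsum_sqrt_rpow_lt_top {η : ℝ≥0∞} (hη : η < 1) {α : ℝ} (hα : 0 < α) (hα1 : α ≤ 1) :
    ∑' k : ℕ, (2 * (((Nat.sqrt (k / 2) : ℝ≥0∞) + 1) * η ^ Nat.sqrt (k / 2))) ^ α < ∞ := by
  have hy : η ^ α < 1 := ENNReal.rpow_lt_one hη hα
  lift η ^ α to NNReal using hy.ne_top with y hyη
  have hy1 : y < 1 := by exact_mod_cast hy
  refine lt_of_le_of_lt (ENNReal.tsum_le_tsum fun k => ?_)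
    (summable_sqrt_mul_pow (NNReal.coe_nonneg y) hy1).tsum_ofReal_lt_top
  set J := Nat.sqrt (k / 2)
  have h1 : (1 : ℝ≥0∞) ≤ 2 * ((J : ℝ≥0∞) + 1) := by
    exact_mod_cast (by omega : 1 ≤ 2 * (J + 1))
  rw [← mul_assoc, ENNReal.mul_rpow_of_nonneg _ _ hα.le, ← ENNReal.rpow_natCast, ← ENNReal.rpow_mul,
    mul_comm (J : ℝ), ENNReal.rpow_mul, ← hyη, ENNReal.rpow_natCast, ← mul_assoc,
    ENNReal.ofReal_mul (by positivity), ENNReal.ofReal_pow (NNReal.coe_nonneg y)]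
  refine mul_le_mul' ?_ (by rw [ENNReal.ofReal_coe_nnreal])
  refine (ENNReal.rpow_le_rpow_of_exponent_le h1 hα1).trans_eq ?_
  rw [ENNReal.rpow_one, ENNReal.ofReal_mul (by norm_num), ENNReal.ofReal_add (by positivity)
    (by norm_num)]
  simp

/-! ### Second moments of the regeneration times -/

lemma regenTime_one_le_two (X : ℕ → Vertex b) : regenTime X 1 ≤ regenTime X 2 := by
  rw [regenTime]
  exact le_iInf₂ fun k hk => hk.1.le

lemma regenTime_two_le {X : ℕ → Vertex b} {s t : ℕ} (h0 : 0 < s) (hst : s < t)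
    (hs : IsCutTime X s) (ht : IsCutTime X t) : regenTime X 2 ≤ t := by
  have h1 : regenTime X 1 ≤ s := by
    rw [regenTime]
    exact iInf₂_le s ⟨by rw [regenTime]; exact_mod_cast h0, hs⟩
  rw [regenTime]
  exact iInf₂_le t ⟨h1.trans_lt (by exact_mod_cast hst), ht⟩

lemma toENNReal_le_tsum_indicator (N : ℕ∞) :
    (N : ℝ≥0∞) ≤ ∑' n : ℕ, {n : ℕ | (n : ℕ∞) < N}.indicator 1 n := by
  cases N with
  | top => simp
  | coe N =>
    refine le_trans ?_ (ENNReal.sum_le_tsum (Finset.range N))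
    rw [Finset.sum_congr rfl fun n hn => Set.indicator_of_mem (by simpa using hn) _]
    simp

/-- The time before the second regeneration is spent at levels below which there is at most one
cut time. -/
lemma IsWalk.regenTime_two_le_tsum {X : ℕ → Vertex b} (hX : IsWalk X) :
    ((regenTime X 2 : ℕ∞) : ℝ≥0∞) ≤ 2 * ∑' k, (atMostOneCut k).indicator (levelVisits k) X := by
  refine (toENNReal_le_tsum_indicator _).trans ((hX.tsum_indicator_le
    (c := fun k => (atMostOneCut k).indicator 1 X) fun n hn => ?_).trans_eq ?_)
  · rw [Set.indicator_of_mem]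
    · exact le_rfl
    · intro s t h0 hst hs ht
      have h1 : (n : ℕ∞) < t := lt_of_lt_of_le hn (regenTime_two_le h0 hst hs ht)
      have h2 := ht.1 n (by exact_mod_cast h1)
      have h3 := ht.1 0 (by omega)
      have h4 : (X 0).level = 0 := by rw [hX.1]; rfl
      omega
  · rw [ENNReal.tsum_mul_left]
    congr 1
    refine tsum_congr fun k => ?_
    by_cases h : X ∈ atMostOneCut k <;> simp [h]

lemma lintegral_regenTime_two_sq_lt_top (μ : Measure (Weights b)) [IsProbabilityMeasure μ]
    (hb : 2 ≤ b) (hpos : ∀ᵐ ω ∂(envLaw μ), 0 < escLim ω) {q : ℝ} (hq : 2 < q) (hq3 : q ≤ 3)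
    (hS : ∫⁻ a, ENNReal.ofReal (totalWeight a ^ (-q)) ∂μ < ∞) :
    ∫⁻ z, ((regenTime z.2 2 : ℕ∞) : ℝ≥0∞) ^ 2 ∂(annealed μ Vertex.root) < ∞ := by
  obtain ⟨σ, hσ⟩ := exists_ne_map hb
  obtain ⟨r, hr, hret⟩ := exists_lintegral_retSum_le μ hpos σ hσ
  have hq1 : 1 ≤ q := by linarith
  obtain ⟨C, hC, hvis⟩ := exists_lintegral_levelVisits_le μ (failProb_lt_one μ hpos) hq1 hq3
    (lintegral_inv_neverBack_rpow_lt_top (by omega) μ hq1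
      (lintegral_invEsc_rpow_lt_top hb μ hpos hq1 hS))
  have hlev := ae_levelVisits_lt_top μ (by linarith) hC hvis
  set f : ℕ → (ℕ → Vertex b) → ℝ≥0∞ := fun k => (atMostOneCut k).indicator (levelVisits k) with hf
  have hfm : ∀ k, Measurable (f k) := fun k =>
    (measurable_levelVisits k).indicator (measurableSet_atMostOneCut k)
  have hη : failProb μ ⊔ 2⁻¹ ^ (1 / (r : ℝ)) < 1 := max_lt (failProb_lt_one μ hpos)
    (ENNReal.rpow_lt_one (by simp) (by positivity))
  have hα : 0 < 1 / 2 - 1 / q := by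
    rw [sub_pos]
    exact one_div_lt_one_div_of_lt two_pos hq
  have hα1 : 1 / 2 - 1 / q ≤ 1 := by
    have : 0 ≤ 1 / q := by positivity
    linarith
  -- level `k` leaves room for two times `J` blocks of `J` levels with `J = √(k / 2)`
  have h1 : (∫⁻ X, (∑' k, f k X) ^ (2 : ℝ) ∂(pathLaw μ)) ^ (1 / (2 : ℝ)) < ∞ := by
    refine lt_of_le_of_lt (lintegral_Lp_tsum_le hfm one_le_two) (lt_of_le_of_lt
      (ENNReal.tsum_le_tsum fun k => (lintegral_indicator_sq_le (measurable_levelVisits k)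
        (measurableSet_atMostOneCut k) hq).trans (mul_le_mul' (hvis k) (ENNReal.rpow_le_rpow
          (pathLaw_atMostOneCut_le μ hlev hr hret (J := Nat.sqrt (k / 2)) ?_) hα.le))) ?_)
    · have := Nat.sqrt_le (k / 2)
      omega
    · rw [ENNReal.tsum_mul_left]
      exact ENNReal.mul_lt_top hC (tsum_sqrt_rpow_lt_top hη hα hα1)
  have h2 : ∫⁻ X, (2 * ∑' k, f k X) ^ 2 ∂(pathLaw μ) < ∞ := by
    simp_rw [mul_pow]
    have hm : Measurable fun X => ∑' k, f k X := .tsum hfm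
    rw [lintegral_const_mul _ (hm.pow_const 2)]
    refine ENNReal.mul_lt_top (by norm_num) ?_
    simpa [ENNReal.rpow_lt_top_iff_of_pos] using h1
  refine lt_of_le_of_lt ?_ h2
  have hm : Measurable fun X => (2 * ∑' k, f k X) ^ 2 :=
    ((Measurable.tsum hfm).const_mul 2).pow_const 2
  rw [pathLaw, lintegral_map hm measurable_snd]
  refine lintegral_mono_ae ?_
  filter_upwards [ae_of_ae_map measurable_snd.aemeasurable (ae_isWalk μ)] with z hz
  exact pow_le_pow_left' hz.regenTime_two_le_tsum 2

/-- A negative moment of the total weight controls the lower ones. -/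
lemma lintegral_totalWeight_rpow_lt_top (μ : Measure (Weights b)) [IsProbabilityMeasure μ]
    (hb : 0 < b) {p q : ℝ} (hq : 0 < q) (hqp : q ≤ p)
    (h : ∫⁻ a, ENNReal.ofReal (totalWeight a ^ (-p)) ∂μ < ∞) :
    ∫⁻ a, ENNReal.ofReal (totalWeight a ^ (-q)) ∂μ < ∞ := by
  have h2 : ∫⁻ a, (1 + ENNReal.ofReal (totalWeight a ^ (-p))) ∂μ < ∞ := by
    rw [lintegral_add_left measurable_const]
    simpa using h
  refine lt_of_le_of_lt (lintegral_mono fun a => ?_) h2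
  rw [← ENNReal.ofReal_one, ← ENNReal.ofReal_add zero_le_one
    (Real.rpow_nonneg (totalWeight_nonneg a) _)]
  refine ENNReal.ofReal_le_ofReal ?_
  have hpos := totalWeight_pos hb a
  have h3 : 0 ≤ totalWeight a ^ (-p) := by positivity
  rcases le_total 1 (totalWeight a) with h1 | h1
  · have := Real.rpow_le_one_of_one_le_of_nonpos h1 (by linarith : -q ≤ 0)
    linarith
  · have := Real.rpow_le_rpow_of_exponent_ge hpos h1 (by linarith : -p ≤ -q)
    linarith

lemma one_lt_sum_of_inv_lt_entryMoment {μ : Measure (Weights b)} {t : ℝ}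
    (h : (b : ℝ≥0∞)⁻¹ < entryMoment μ t) :
    1 < ∑ i, ∫⁻ a, ENNReal.ofReal ((a i : ℝ) ^ t) ∂μ := by
  by_contra! hno
  refine absurd h (not_lt.2 ?_)
  rw [entryMoment]
  exact (mul_le_mul_right hno _).trans_eq (mul_one _)

lemma two_le_of_inv_lt_entryMoment {μ : Measure (Weights b)} [IsProbabilityMeasure μ]
    (h : (b : ℝ≥0∞)⁻¹ < entryMoment μ 0) : 2 ≤ b := by
  have h1 := one_lt_sum_of_inv_lt_entryMoment h
  simp only [Real.rpow_zero, ENNReal.ofReal_one, lintegral_const, measure_univ, mul_one,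
    Finset.sum_const, Finset.card_univ, Fintype.card_fin, nsmul_eq_mul] at h1
  exact_mod_cast h1

end

end TreeRWRE

theorem mainTheorem4 (b : ℕ)
    (μ : Measure (TreeRWRE.Weights b)) [IsProbabilityMeasure μ]
    (hA : (b : ℝ≥0∞)⁻¹ < ⨅ t ∈ Set.Icc (0 : ℝ) 1, TreeRWRE.entryMoment μ t)
    (hp : ∃ p : ℝ, 2 < p ∧
      ∫⁻ a, ENNReal.ofReal ((TreeRWRE.totalWeight a) ^ (-p)) ∂μ < ∞) :
    ∫⁻ z, ((TreeRWRE.regenTime z.2 1 : ℕ∞) : ℝ≥0∞) ^ 2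
        ∂(TreeRWRE.annealed μ TreeRWRE.Vertex.root) < ∞ ∧
    ∫⁻ z, ((TreeRWRE.regenTime z.2 2 - TreeRWRE.regenTime z.2 1 : ℕ∞) : ℝ≥0∞) ^ 2
        ∂(TreeRWRE.annealed μ TreeRWRE.Vertex.root) < ∞ := by
  have hA' : ∀ t ∈ Set.Icc (0 : ℝ) 1, (b : ℝ≥0∞)⁻¹ < TreeRWRE.entryMoment μ t := fun t ht =>
    hA.trans_le (iInf₂_le t ht)
  have hb := TreeRWRE.two_le_of_inv_lt_entryMoment (hA' 0 ⟨le_rfl, zero_le_one⟩)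
  obtain ⟨p, hp2, hp⟩ := hp
  have hq : 2 < min p 3 := lt_min hp2 (by norm_num)
  have h2 := TreeRWRE.lintegral_regenTime_two_sq_lt_top μ hb
    (TreeRWRE.ae_escLim_pos hb μ fun t ht =>
      TreeRWRE.one_lt_sum_of_inv_lt_entryMoment (hA' t ht)) hq (min_le_right _ _)
    (TreeRWRE.lintegral_totalWeight_rpow_lt_top μ (by omega) (by linarith) (min_le_left _ _) hp)
  refine ⟨lt_of_le_of_lt (lintegral_mono fun z => ?_) h2,
    lt_of_le_of_lt (lintegral_mono fun z => ?_) h2⟩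
  · gcongr
    exact TreeRWRE.regenTime_one_le_two z.2
  · gcongr
    exact tsub_le_self
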